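/- Let $\mathbf z_1,\mathbf z_2,\dots$ be independent copies of a random vector $\mathbf z=(z_1,\dots,z_p)^T$ whose components are mutually independent with $E(z_k)=0$ and $E(z_k^2)=1$. Write $$\gamma_k=E(z_k^3),\quad \beta_k=E(z_k^4),\quad \kappa_k=\beta_k-3,\quad \nu_k=\beta_k-1,\quad \omega_k=E(z_k^6)-\gamma_k^2,\quad \eta_k=E(z_k^5)-\gamma_k .$$ For a univariate random variable $x$ with $x_{st}=(x-E(x))/\sqrt{Var(x)}$ let $\gamma(x)=E(x_{st}^3)$ and $\kappa(x)=E(x_{st}^4)-3$. For $\alpha\in[0,1]$ and a distribution $F$ on $\mathbb R^p$ with mean $\boldsymbol\mu$ and positive definite covariance matrix $\boldsymbol\Sigma$, the symmetric projection pursuit functional takes the values $\mathbf W=\mathbf U\boldsymbol\Sigma^{-1/2}$, where $\mathbf x\sim F$, $\mathbf x_{st}=\boldsymbol\Sigma^{-1/2}(\mathbf x-\boldsymbol\mu)$ and $\mathbf U$, with rows $\mathbf u_1^T,\dots,\mathbf u_p^T$, is any maximizer over the orthogonal $p\times p$ matrices of $$\alpha\sum_{k=1}^p\gamma^2(\mathbf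 u_k^T\mathbf x_{st})+(1-\alpha)\sum_{k=1}^p\kappa^2(\mathbf u_k^T\mathbf x_{st}).$$ A sequence of solutions with weight $\alpha$ is a sequence of measurable matrix-valued functions $\hat{\mathbf W}=\hat{\mathbf W}_n$ of $\mathbf z_1,\dots,\mathbf z_n$ such that $\hat{\mathbf W}_n$ is a value of this functional at the empirical distribution of $\mathbf z_1,\dots,\mathbf z_n$ whenever the sample covariance matrix is positive definite (and is arbitrary otherwise). Put \begin{align*} \zeta_{11}&=\gamma_k^2(\nu_k-\gamma_k^2)+\gamma_l^2(\nu_l-\gamma_l^2)+\gamma_l^4,\\ \zeta_{22}&=\kappa_k^2(\omega_k-\beta_k^2)+\kappa_l^2(\omega_l-\beta_l^2)+\kappa_l^4,\\ \zeta_{12}&=\gamma_k\kappa_k(\eta_k-\gamma_k\beta_k)+\gamma_l\kappa_l(\eta_l-\gamma_l\beta_l)+\gamma_l^2\kappa_l^2 . \end{align*} In each of the cases (i)-(iii) below there exists a sequence of solutions with weight $\alpha$ such that $\hat{\mathbf W}\to\mathbf I_p$ in probability. Moreover, there is one multivariate normal distribution with mean vector $\mathbf 0$ such that, for every such sequence,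 $\sqrt n\,vec(\hat{\mathbf W}-\mathbf I_p)$ converges in distribution to it. Its variances (denoted $ASV$) are $ASV(\hat w_{kk})=(\kappa_k+2)/4$ on the diagonal and, for $k\neq l$, as follows. (i) $\alpha=1$, finite sixth moments, at most one of $\gamma_1,\dots,\gamma_p$ is zero: $$ASV(\hat w_{kl})=\frac{\zeta_{11}}{(\gamma_k^2+\gamma_l^2)^2}.$$ (ii) $\alpha=0$, finite eighth moments, at most one of $\kappa_1,\dots,\kappa_p$ is zero: $$ASV(\hat w_{kl})=\frac{\zeta_{22}}{(\kappa_k^2+\kappa_l^2)^2}.$$ (iii) $0<\alpha<1$, finite eighth moments, $\gamma_k=\kappa_k=0$ for at most one $k$: $$ASV(\hat w_{kl})=\frac{9\alpha^2\zeta_{11}+16(1-\alpha)^2\zeta_{22}+24\alpha(1-\alpha)\zeta_{12}}{\bigl(3\alpha(\gamma_k^2+\gamma_l^2)+4(1-\alpha)(\kappa_k^2+\kappa_l^2)\bigr)^2}.$$ -/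

import Mathlib

open MeasureTheory ProbabilityTheory Filter Matrix
open scoped ENNReal Topology

namespace SymPP

noncomputable section

/-! ### Univariate cumulants and the symmetric projection pursuit functional -/

/-- Skewness `γ(X) = E[X_st ^ 3]`, where `X_st = (X - E X) / √(Var X)`. -/
def skewness {S : Type*} [MeasurableSpace S] (F : Measure S) (X : S → ℝ) : ℝ :=
  ∫ s, ((X s - ∫ t, X t ∂F) / √(variance X F)) ^ 3 ∂F

/-- Excess kurtosis `κ(X) = E[X_st ^ 4] - 3`, where `X_st = (X - E X) / √(Var X)`. -/
def exKurtosis {S : Type*} [MeasurableSpace S] (F : Measure S) (X : S → ℝ) : ℝ :=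
  (∫ s, ((X s - ∫ t, X t ∂F) / √(variance X F)) ^ 4 ∂F) - 3

/-- Mean vector of a distribution `F` on `ℝ^p`. -/
def meanVec {p : ℕ} (F : Measure (Fin p → ℝ)) : Fin p → ℝ :=
  fun i => ∫ x, x i ∂F

/-- Covariance matrix of a distribution `F` on `ℝ^p`. -/
def covMat {p : ℕ} (F : Measure (Fin p → ℝ)) : Matrix (Fin p) (Fin p) ℝ :=
  Matrix.of fun i j => covariance (fun x : Fin p → ℝ => x i) (fun x : Fin p → ℝ => x j) F

/-- `G` is the inverse square root of `A`: the symmetric positive definite matrix with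
`G A G = I`. Such a `G` exists exactly when `A` is positive definite, and it is then unique. -/
def IsInvSqrt {p : ℕ} (A G : Matrix (Fin p) (Fin p) ℝ) : Prop :=
  G.PosDef ∧ G * A * G = 1

/-- The standardized vector `x_st = G (x - E x)`, for `G = Cov(x)^(-1/2)`. -/
def standardize {p : ℕ} (F : Measure (Fin p → ℝ)) (G : Matrix (Fin p) (Fin p) ℝ)
    (x : Fin p → ℝ) : Fin p → ℝ :=
  G *ᵥ (x - meanVec F)

/-- The projection index
`α ∑ₖ γ²(uₖᵀ x_st) + (1 - α) ∑ₖ κ²(uₖᵀ x_st)`, where `uₖᵀ` are the rows of `U`. -/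
def projIndex {p : ℕ} (α : ℝ) (F : Measure (Fin p → ℝ)) (G U : Matrix (Fin p) (Fin p) ℝ) : ℝ :=
  α * ∑ k, skewness F (fun x => U k ⬝ᵥ standardize F G x) ^ 2
    + (1 - α) * ∑ k, exKurtosis F (fun x => U k ⬝ᵥ standardize F G x) ^ 2

/-- `W` is a value at `F` of the symmetric projection pursuit functional with weight `α`:
`W = U Σ^(-1/2)`, where `Σ` is the covariance matrix of `F` and the orthogonal matrix `U`
maximizes the projection index over all orthogonal matrices. -/
def IsSymPP {p : ℕ} (α : ℝ) (F : Measure (Fin p → ℝ)) (W : Matrix (Fin p) (Fin p) ℝ) : Prop :=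
  ∃ G U : Matrix (Fin p) (Fin p) ℝ,
    IsInvSqrt (covMat F) G ∧
    U ∈ Matrix.orthogonalGroup (Fin p) ℝ ∧
    (∀ V ∈ Matrix.orthogonalGroup (Fin p) ℝ, projIndex α F G V ≤ projIndex α F G U) ∧
    W = U * G

/-! ### Estimators: the functional at the empirical distribution -/

/-- The empirical distribution of the data `x₁, …, xₙ`. -/
def empirical {p n : ℕ} (x : Fin n → Fin p → ℝ) : Measure (Fin p → ℝ) :=
  (n : ℝ≥0∞)⁻¹ • ∑ i, Measure.dirac (x i)

/-- A sequence of solutions with weight `α`: for every sample size `n`, a measurable function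
`Ŵₙ` of the data which is a value of the symmetric projection pursuit functional at the empirical
distribution, for every data set whose sample covariance matrix is positive definite (for the
other data sets the functional has no value and `Ŵₙ` is arbitrary). -/
def IsSolutionSeq {p : ℕ} (α : ℝ)
    (W : (n : ℕ) → (Fin n → Fin p → ℝ) → Matrix (Fin p) (Fin p) ℝ) : Prop :=
  ∀ n, (∀ k l, Measurable fun x => W n x k l) ∧
    ∀ x, (covMat (empirical x)).PosDef → IsSymPP α (empirical x) (W n x)

/-- The first `n` observations of the sequence `z`, at the outcome `ω`. -/
def sample {Ω : Type*} {p : ℕ} (z : ℕ → Ω → Fin p → ℝ) (n : ℕ) (ω : Ω) : Fin n → Fin p → ℝ :=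
  fun i => z i ω

/-- `Ŵₙ → I` in probability. -/
def IsConsistent {Ω : Type*} [MeasurableSpace Ω] {p : ℕ} (P : Measure Ω)
    (z : ℕ → Ω → Fin p → ℝ)
    (W : (n : ℕ) → (Fin n → Fin p → ℝ) → Matrix (Fin p) (Fin p) ℝ) : Prop :=
  ∀ k l, TendstoInMeasure P (fun n ω => W n (sample z n ω) k l) atTop
    (fun _ => (1 : Matrix (Fin p) (Fin p) ℝ) k l)

/-- The random vector `√n vec(Ŵₙ - I)` in the Euclidean space of dimension `p²`
(the coordinate `(l, k)` of `vec A` is the entry `A k l`). -/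
def scaledError {Ω : Type*} {p : ℕ} (z : ℕ → Ω → Fin p → ℝ)
    (W : (n : ℕ) → (Fin n → Fin p → ℝ) → Matrix (Fin p) (Fin p) ℝ) (n : ℕ) (ω : Ω) :
    EuclideanSpace ℝ (Fin p × Fin p) :=
  WithLp.toLp 2 (√(n : ℝ) • (W n (sample z n ω) - 1).vec)

/-! ### Moments of a standardized component and the asymptotic variances -/

section moments

variable {Ω : Type*} [MeasurableSpace Ω] (P : Measure Ω)

/-- `γ = E[X³]`. -/
def gam (X : Ω → ℝ) : ℝ := moment X 3 P

/-- `β = E[X⁴]`. -/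
def bet (X : Ω → ℝ) : ℝ := moment X 4 P

/-- `κ = E[X⁴] - 3`. -/
def kap (X : Ω → ℝ) : ℝ := moment X 4 P - 3

/-- `ω = E[X⁶] - E[X³]²`. -/
def omg (X : Ω → ℝ) : ℝ := moment X 6 P - moment X 3 P ^ 2

/-- `ν = E[X⁴] - 1`. -/
def nu (X : Ω → ℝ) : ℝ := moment X 4 P - 1

/-- `η = E[X⁵] - E[X³]`. -/
def eta (X : Ω → ℝ) : ℝ := moment X 5 P - moment X 3 P

/-- `ζ₁₁ = γₖ² (νₖ - γₖ²) + γₗ² (νₗ - γₗ²) + γₗ⁴`. -/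
def zeta11 (X Y : Ω → ℝ) : ℝ :=
  gam P X ^ 2 * (nu P X - gam P X ^ 2) + gam P Y ^ 2 * (nu P Y - gam P Y ^ 2) + gam P Y ^ 4

/-- `ζ₂₂ = κₖ² (ωₖ - βₖ²) + κₗ² (ωₗ - βₗ²) + κₗ⁴`. -/
def zeta22 (X Y : Ω → ℝ) : ℝ :=
  kap P X ^ 2 * (omg P X - bet P X ^ 2) + kap P Y ^ 2 * (omg P Y - bet P Y ^ 2) + kap P Y ^ 4

/-- `ζ₁₂ = γₖ κₖ (ηₖ - γₖ βₖ) + γₗ κₗ (ηₗ - γₗ βₗ) + γₗ² κₗ²`. -/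
def zeta12 (X Y : Ω → ℝ) : ℝ :=
  gam P X * kap P X * (eta P X - gam P X * bet P X)
    + gam P Y * kap P Y * (eta P Y - gam P Y * bet P Y) + gam P Y ^ 2 * kap P Y ^ 2

end moments

/-- The `k`-th component of the first observation. -/
def comp {Ω : Type*} {p : ℕ} (z : ℕ → Ω → Fin p → ℝ) (k : Fin p) (ω : Ω) : ℝ := z 0 ω k

/-- There is a consistent sequence of solutions with weight `α`, and for every such sequence
`√n vec(Ŵₙ - I)` converges in distribution to a centered multivariate normal vector (the same for
all of them) whose coordinates have the variances `(κₖ + 2) / 4` for the entry `(k, k)`, and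
`asv k l` for the entry `(k, l)`, `k ≠ l`. -/
def HasNormalLimit {Ω : Type*} [MeasurableSpace Ω] {p : ℕ} (P : Measure Ω)
    [IsProbabilityMeasure P] (z : ℕ → Ω → Fin p → ℝ) (α : ℝ) (asv : Fin p → Fin p → ℝ) : Prop :=
  ∃ C : Matrix (Fin p × Fin p) (Fin p × Fin p) ℝ,
    C.PosSemidef ∧
    (∀ k, C (k, k) (k, k) = (kap P (comp z k) + 2) / 4) ∧
    (∀ k l, k ≠ l → C (l, k) (l, k) = asv k l) ∧
    (∃ W, IsSolutionSeq α W ∧ IsConsistent P z W) ∧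
    (∀ W, IsSolutionSeq α W → IsConsistent P z W →
      TendstoInDistribution (scaledError z W) atTop
        (id : EuclideanSpace ℝ (Fin p × Fin p) → EuclideanSpace ℝ (Fin p × Fin p))
        (fun _ => P) (multivariateGaussian 0 C))

end

end SymPP

namespace SymPP

noncomputable section

/-! ### The functional at an empirical distribution -/

/-! At an empirical distribution with positive definite covariance matrix A, the values of the
functional are the maximizers of the index of W(x - x̄) under the constraint W A Wᵀ = I
(`isSymPP_empirical_iff`). Both index and constraint are polynomials in W and in the sample moments
of degree at most four, so the problem is one of M-estimation with finitely many averages.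

Consistency. Third and fourth cumulants of independent summands add, so for a unit vector u the
skewness of uᵀz is ∑ uᵢ³γᵢ and the excess kurtosis is ∑ uᵢ⁴κᵢ (`moments_linear_combination`). By
Cauchy–Schwarz the population index at an orthogonal U is at most ∑ᵢ wᵢ ∑ₖ Uₖᵢ⁴ with wᵢ = αγᵢ² +
(1-α)κᵢ², hence at most ∑ wᵢ, its value at I. Equality forces every column with wᵢ ≠ 0 to be a
signed unit vector, and since at most one wᵢ vanishes, U is a signed permutation. The index is blind
to signed permutations of the rows, so maximization may be restricted to the compact set `domMat`,
in which I is the only maximizer (`eq_one_of_index_le`). A measurable choice of maximizers there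
(`exists_measurable_argmax`), the strong law and compactness give `exists_consistent`.

Limit law. Stationarity under plane rotations (`stationary_of_isMax`) together with the constraint
gives a system of equations in W and the moments. `solveF` recombines it so that, at the identity
and the population moments, its derivative in W is the identity map and its derivative in the
moments is minus `influence` (`hasDerivAt_solveF`). Zeros near the identity are therefore the
influence of the moment deviation, up to a small relative error (`linearization_of_zero`); no
implicit function theorem is needed, because the zeros are given. The multivariate central limit
theorem and tightness finish the argument. Only the equations and consistency are used, so all
consistent sequences share one limit.

Variances. Up to a constant, the influence on the entry (k, l) is f(zₖ)zₗ - zₖg(zₗ) with cubic f and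
g such that f(zₖ) is uncorrelated with zₖ. The cross term drops and the variance is E f² + E g²
(`integral_influence_sq`).

The factor c. The central limit theorem for monomials of degree four needs eighth moments, which
case (i) does not grant. These monomials enter the equations with the factor 1 - α, so for α = 1
they may be multiplied by c = 0; otherwise c = 1. The consistency argument uses c = 1 throughout,
which requires only fourth moments. -/

/-- Average of finitely many numbers. -/
def avg {n : ℕ} (f : Fin n → ℝ) : ℝ := (n : ℝ)⁻¹ * ∑ i, f i

lemma avg_add {n : ℕ} (f g : Fin n → ℝ) : avg (fun i => f i + g i) = avg f + avg g := by
  simp [avg, Finset.sum_add_distrib, mul_add]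

lemma avg_mul_left {n : ℕ} (c : ℝ) (f : Fin n → ℝ) : avg (fun i => c * f i) = c * avg f := by
  simp only [avg, ← Finset.mul_sum]; ring

lemma avg_sum {n : ℕ} {ι : Type*} (s : Finset ι) (f : ι → Fin n → ℝ) :
    avg (fun i => ∑ j ∈ s, f j i) = ∑ j ∈ s, avg (f j) := by
  simp only [avg, Finset.mul_sum]; rw [Finset.sum_comm]

lemma avg_const {n : ℕ} (hn : n ≠ 0) (c : ℝ) : avg (fun _ : Fin n => c) = c := by
  have : (n : ℝ) ≠ 0 := by exact_mod_cast hn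
  simp [avg, this]

/-- No measurability of `f` is needed, since every function is integrable against a point mass here.
For n = 0 both sides are zero. -/
lemma integral_empirical {p n : ℕ} (x : Fin n → Fin p → ℝ) (f : (Fin p → ℝ) → ℝ) :
    ∫ y, f y ∂(empirical x) = avg fun i => f (x i) := by
  rw [empirical, integral_smul_measure, integral_finsetSum_measure]
  · simp [avg]
  · intro i _; exact integrable_dirac (by simp)

/-- The centered data. -/
def ctr {p n : ℕ} (x : Fin n → Fin p → ℝ) (i : Fin n) : Fin p → ℝ :=
  x i - meanVec (empirical x)

lemma avg_ctr {p n : ℕ} [NeZero n] (x : Fin n → Fin p → ℝ) (k : Fin p) :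
    avg (fun i => ctr x i k) = 0 := by
  simp only [ctr, Pi.sub_apply, sub_eq_add_neg, avg_add, avg_const (NeZero.ne n), meanVec,
    integral_empirical]
  ring

lemma avg_dotProduct_ctr {p n : ℕ} [NeZero n] (x : Fin n → Fin p → ℝ) (w : Fin p → ℝ) :
    avg (fun i => w ⬝ᵥ ctr x i) = 0 := by
  simp [dotProduct, avg_sum, avg_mul_left, avg_ctr]

lemma covMat_empirical {p n : ℕ} (x : Fin n → Fin p → ℝ) (k l : Fin p) :
    covMat (empirical x) k l = avg fun i => ctr x i k * ctr x i l := by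
  simp [covMat, covariance, integral_empirical, ctr, meanVec]

lemma avg_dotProduct_mul {p n : ℕ} (x : Fin n → Fin p → ℝ) (v w : Fin p → ℝ) :
    avg (fun i => (v ⬝ᵥ ctr x i) * (w ⬝ᵥ ctr x i)) = v ⬝ᵥ (covMat (empirical x) *ᵥ w) := by
  have h : ∀ i, (v ⬝ᵥ ctr x i) * (w ⬝ᵥ ctr x i)
      = ∑ k, ∑ l, (v k * w l) * (ctr x i k * ctr x i l) := by
    intro i
    simp only [dotProduct, Finset.sum_mul_sum]
    exact Finset.sum_congr rfl fun k _ => Finset.sum_congr rfl fun l _ => by ring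
  simp only [h, avg_sum, avg_mul_left]
  simp only [dotProduct, mulVec, covMat_empirical, Finset.mul_sum]
  exact Finset.sum_congr rfl fun k _ => Finset.sum_congr rfl fun l _ => by ring

lemma mul_covMat_mul_transpose {p n : ℕ} (x : Fin n → Fin p → ℝ)
    (W : Matrix (Fin p) (Fin p) ℝ) (k l : Fin p) :
    (W * covMat (empirical x) * Wᵀ) k l =
      avg fun i => (W k ⬝ᵥ ctr x i) * (W l ⬝ᵥ ctr x i) := by
  rw [avg_dotProduct_mul, Matrix.mul_assoc]
  simp [Matrix.mul_apply, dotProduct, mulVec]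

/-- The projection index of `W (x - x̄)`, for `W` such that these data are standardized. -/
def sampleIndex {p n : ℕ} (α : ℝ) (x : Fin n → Fin p → ℝ) (W : Matrix (Fin p) (Fin p) ℝ) : ℝ :=
  α * ∑ k, (avg fun i => (W k ⬝ᵥ ctr x i) ^ 3) ^ 2
    + (1 - α) * ∑ k, ((avg fun i => (W k ⬝ᵥ ctr x i) ^ 4) - 3) ^ 2

/-- The covariance matrix of an empty sample is zero and has no positive diagonal entry. The index
`k` excludes p = 0, where the empty matrix is positive definite. -/
lemma neZero_of_posDef {p n : ℕ} {x : Fin n → Fin p → ℝ}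
    (hA : (covMat (empirical x)).PosDef) (k : Fin p) : NeZero n := by
  constructor
  rintro rfl
  have := hA.diag_pos (i := k)
  rw [covMat_empirical] at this
  simp [avg] at this

lemma measurable_dotProduct_standardize {p : ℕ} (F : Measure (Fin p → ℝ))
    (G : Matrix (Fin p) (Fin p) ℝ) (w : Fin p → ℝ) :
    Measurable fun x => w ⬝ᵥ standardize F G x := by
  unfold standardize
  simp only [dotProduct, mulVec, Pi.sub_apply]
  fun_prop

/-- Centring gives the projections mean zero and the hypothesis gives them variance one, so the
standardization inside `skewness` and `exKurtosis` does nothing. -/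
lemma projIndex_eq_sampleIndex {p n : ℕ} (α : ℝ) {x : Fin n → Fin p → ℝ}
    (hA : (covMat (empirical x)).PosDef) (G V : Matrix (Fin p) (Fin p) ℝ)
    (h : (V * G) * covMat (empirical x) * (V * G)ᵀ = 1) :
    projIndex α (empirical x) G V = sampleIndex α x (V * G) := by
  have key : ∀ k i, V k ⬝ᵥ standardize (empirical x) G (x i) = (V * G) k ⬝ᵥ ctr x i := by
    intro k i
    rw [standardize, dotProduct_mulVec]; rfl
  have hm : ∀ k, ∫ y, V k ⬝ᵥ standardize (empirical x) G y ∂(empirical x) = 0 := by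
    intro k
    have := neZero_of_posDef hA k
    simp only [integral_empirical, key, avg_dotProduct_ctr]
  have hv : ∀ k, variance (fun y => V k ⬝ᵥ standardize (empirical x) G y) (empirical x) = 1 := by
    intro k
    rw [variance_eq_integral (measurable_dotProduct_standardize _ _ _).aemeasurable, hm,
      integral_empirical]
    simp only [key, sub_zero, sq]
    rw [← mul_covMat_mul_transpose, h, one_apply_eq]
  simp only [projIndex, sampleIndex, skewness, exKurtosis, hm, hv, integral_empirical, key,
    Real.sqrt_one, div_one, sub_zero]

/-- The inverse square root of a matrix (for positive definite matrices). -/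
def invSqrt {p : ℕ} (A : Matrix (Fin p) (Fin p) ℝ) : Matrix (Fin p) (Fin p) ℝ :=
  open scoped MatrixOrder Matrix.Norms.L2Operator in (CFC.sqrt A)⁻¹

open scoped MatrixOrder Matrix.Norms.L2Operator in
-- The square root is invertible because the square of its determinant is det A > 0.
lemma isInvSqrt_invSqrt {p : ℕ} {A : Matrix (Fin p) (Fin p) ℝ} (hA : A.PosDef) :
    IsInvSqrt A (invSqrt A) := by
  have h1 : CFC.sqrt A * CFC.sqrt A = A := CFC.sqrt_mul_sqrt_self A hA.posSemidef.nonneg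
  have hdet : IsUnit (CFC.sqrt A).det := by
    rw [isUnit_iff_ne_zero]
    intro h0
    have := hA.det_pos
    rw [← h1, det_mul, h0] at this
    simp at this
  have hs : (CFC.sqrt A).PosDef := by
    have h2 : (CFC.sqrt A).PosSemidef := (CFC.sqrt_nonneg A).posSemidef
    exact (h2.posDef_iff_isUnit).2 ((Matrix.isUnit_iff_isUnit_det _).2 hdet)
  refine ⟨hs.inv, ?_⟩
  have : (CFC.sqrt A)⁻¹ * A * (CFC.sqrt A)⁻¹
      = ((CFC.sqrt A)⁻¹ * CFC.sqrt A) * (CFC.sqrt A * (CFC.sqrt A)⁻¹) := by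
    nth_rewrite 2 [← h1]; simp only [Matrix.mul_assoc]
  rw [invSqrt, this, nonsing_inv_mul _ hdet, mul_nonsing_inv _ hdet, one_mul]

lemma IsInvSqrt.transpose_eq {p : ℕ} {A G : Matrix (Fin p) (Fin p) ℝ} (h : IsInvSqrt A G) :
    Gᵀ = G := by
  have := h.1.isHermitian.eq
  rwa [conjTranspose_eq_transpose_of_trivial] at this

lemma IsInvSqrt.isUnit_det {p : ℕ} {A G : Matrix (Fin p) (Fin p) ℝ} (h : IsInvSqrt A G) :
    IsUnit G.det := h.1.det_pos.ne'.isUnit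

lemma IsInvSqrt.eq_inv_mul_inv {p : ℕ} {A G : Matrix (Fin p) (Fin p) ℝ} (h : IsInvSqrt A G) :
    A = G⁻¹ * G⁻¹ := by
  have hd := h.isUnit_det
  calc A = (G⁻¹ * G) * A * (G * G⁻¹) := by
        rw [nonsing_inv_mul _ hd, mul_nonsing_inv _ hd, one_mul, mul_one]
    _ = G⁻¹ * (G * A * G) * G⁻¹ := by simp only [Matrix.mul_assoc]
    _ = _ := by rw [h.2, mul_one]

/-- Together with `IsInvSqrt.mul_inv_orthogonal` this makes U ↦ U G a bijection from the orthogonal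
matrices onto the solutions of W A Wᵀ = I, which removes G from the problem. -/
lemma IsInvSqrt.orthogonal_mul {p : ℕ} {A G U : Matrix (Fin p) (Fin p) ℝ} (h : IsInvSqrt A G)
    (hU : U ∈ Matrix.orthogonalGroup (Fin p) ℝ) : (U * G) * A * (U * G)ᵀ = 1 := by
  rw [transpose_mul, h.transpose_eq]
  calc U * G * A * (G * Uᵀ) = U * (G * A * G) * Uᵀ := by simp only [Matrix.mul_assoc]
    _ = 1 := by rw [h.2, mul_one]; exact (mem_orthogonalGroup_iff _ _).1 hU

lemma IsInvSqrt.mul_inv_orthogonal {p : ℕ} {A G W : Matrix (Fin p) (Fin p) ℝ} (h : IsInvSqrt A G)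
    (hW : W * A * Wᵀ = 1) : W * G⁻¹ ∈ Matrix.orthogonalGroup (Fin p) ℝ := by
  rw [mem_orthogonalGroup_iff, transpose_mul, transpose_nonsing_inv, h.transpose_eq, ← hW]
  conv_rhs => rw [h.eq_inv_mul_inv]
  simp only [Matrix.mul_assoc]

/-- At an empirical distribution with a positive definite covariance matrix `A`, the values of the
functional are the maximizers of the index over the matrices `W` with `W A Wᵀ = 1`. -/
lemma isSymPP_empirical_iff {p n : ℕ} (α : ℝ) {x : Fin n → Fin p → ℝ}
    (hA : (covMat (empirical x)).PosDef) (W : Matrix (Fin p) (Fin p) ℝ) :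
    IsSymPP α (empirical x) W ↔
      W * covMat (empirical x) * Wᵀ = 1 ∧
      ∀ W' : Matrix (Fin p) (Fin p) ℝ, W' * covMat (empirical x) * W'ᵀ = 1 →
        sampleIndex α x W' ≤ sampleIndex α x W := by
  have hinv : ∀ {G : Matrix (Fin p) (Fin p) ℝ}, IsInvSqrt (covMat (empirical x)) G →
      ∀ W' : Matrix (Fin p) (Fin p) ℝ, W' * G⁻¹ * G = W' := fun hG W' => by
    rw [Matrix.mul_assoc, nonsing_inv_mul _ hG.isUnit_det, mul_one]
  constructor
  · rintro ⟨G, U, hG, hU, hmax, rfl⟩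
    refine ⟨hG.orthogonal_mul hU, fun W' hW' => ?_⟩
    have h1 := hG.mul_inv_orthogonal hW'
    have := hmax _ h1
    rwa [projIndex_eq_sampleIndex α hA _ _ (hG.orthogonal_mul h1),
      projIndex_eq_sampleIndex α hA _ _ (hG.orthogonal_mul hU), hinv hG] at this
  · rintro ⟨hW, hmax⟩
    have hG := isInvSqrt_invSqrt hA
    refine ⟨_, W * (invSqrt (covMat (empirical x)))⁻¹, hG, hG.mul_inv_orthogonal hW, ?_,
      (hinv hG W).symm⟩
    intro V hV
    rw [projIndex_eq_sampleIndex α hA _ _ (hG.orthogonal_mul hV),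
      projIndex_eq_sampleIndex α hA _ _ (by rwa [hinv hG]), hinv hG]
    exact hmax _ (hG.orthogonal_mul hV)

/-! ### Plane rotations and the estimating equations -/

/-- The matrix of the rotation by the angle `t` in the plane of the coordinates `k` and `l`. -/
def planeRotation {p : ℕ} (k l : Fin p) (t : ℝ) : Matrix (Fin p) (Fin p) ℝ :=
  fun i => if i = k then Real.cos t • Pi.single k 1 + Real.sin t • Pi.single l 1
    else if i = l then (-Real.sin t) • Pi.single k 1 + Real.cos t • Pi.single l 1
    else Pi.single i 1

lemma planeRotation_mul_transpose {p : ℕ} {k l : Fin p} (hkl : k ≠ l) (t : ℝ) :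
    planeRotation k l t * (planeRotation k l t)ᵀ = 1 := by
  ext i j
  have : (planeRotation k l t * (planeRotation k l t)ᵀ) i j
      = planeRotation k l t i ⬝ᵥ planeRotation k l t j := rfl
  rw [this]
  unfold planeRotation
  by_cases hik : i = k <;> by_cases hil : i = l <;> by_cases hjk : j = k <;>
    by_cases hjl : j = l <;>
    simp_all [Matrix.one_apply, Pi.single_apply, eq_comm] <;> linarith [Real.sin_sq_add_cos_sq t]

lemma planeRotation_mul_dotProduct {p : ℕ} {k l : Fin p} (t : ℝ)
    (W : Matrix (Fin p) (Fin p) ℝ) (v : Fin p → ℝ) (i : Fin p) :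
    (planeRotation k l t * W) i ⬝ᵥ v =
      if i = k then Real.cos t * (W k ⬝ᵥ v) + Real.sin t * (W l ⬝ᵥ v)
      else if i = l then -Real.sin t * (W k ⬝ᵥ v) + Real.cos t * (W l ⬝ᵥ v)
      else W i ⬝ᵥ v := by
  have h1 : (planeRotation k l t * W) i ⬝ᵥ v = planeRotation k l t i ⬝ᵥ (W *ᵥ v) := by
    rw [dotProduct_mulVec]; rfl
  rw [h1]
  unfold planeRotation
  split_ifs <;> simp [add_dotProduct, smul_dotProduct, mulVec]

/-- The estimating equations: the index is stationary under rotations. -/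
lemma stationary_of_isMax {p n : ℕ} (α : ℝ) (x : Fin n → Fin p → ℝ)
    (W : Matrix (Fin p) (Fin p) ℝ) (hW : W * covMat (empirical x) * Wᵀ = 1)
    (hmax : ∀ W' : Matrix (Fin p) (Fin p) ℝ, W' * covMat (empirical x) * W'ᵀ = 1 →
        sampleIndex α x W' ≤ sampleIndex α x W) {k l : Fin p} (hkl : k ≠ l) :
    3 * α * (avg (fun i => (W k ⬝ᵥ ctr x i) ^ 3) *
          avg (fun i => (W k ⬝ᵥ ctr x i) ^ 2 * (W l ⬝ᵥ ctr x i))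
        - avg (fun i => (W l ⬝ᵥ ctr x i) ^ 3) *
          avg (fun i => (W l ⬝ᵥ ctr x i) ^ 2 * (W k ⬝ᵥ ctr x i)))
      + 4 * (1 - α) * ((avg (fun i => (W k ⬝ᵥ ctr x i) ^ 4) - 3) *
          avg (fun i => (W k ⬝ᵥ ctr x i) ^ 3 * (W l ⬝ᵥ ctr x i))
        - (avg (fun i => (W l ⬝ᵥ ctr x i) ^ 4) - 3) *
          avg (fun i => (W l ⬝ᵥ ctr x i) ^ 3 * (W k ⬝ᵥ ctr x i))) = 0 := by
  set y : Fin p → Fin n → ℝ := fun k i => W k ⬝ᵥ ctr x i with hy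
  -- The velocity of the rotated data at angle zero: row k moves towards row l, row l towards minus
  -- row k, and the other rows are at rest.
  set d : Fin p → Fin n → ℝ := fun j i => if j = k then y l i else if j = l then - y k i else 0
    with hd
  set Y : Fin p → Fin n → ℝ → ℝ := fun j i t =>
    (planeRotation k l t * W) j ⬝ᵥ ctr x i with hY
  have hY0 : ∀ j i, Y j i 0 = y j i := by
    intro j i
    simp only [hY, hy, planeRotation_mul_dotProduct]
    split_ifs with h1 h2 <;> simp [*]
  have hder : ∀ j i, HasDerivAt (Y j i) (d j i) 0 := by
    intro j i
    simp only [hY, hd, planeRotation_mul_dotProduct]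
    split_ifs with h1 h2
    · have := ((Real.hasDerivAt_cos 0).mul_const (y k i)).fun_add
        ((Real.hasDerivAt_sin 0).mul_const (y l i))
      simpa using this
    · have := ((Real.hasDerivAt_sin 0).fun_neg.mul_const (y k i)).fun_add
        ((Real.hasDerivAt_cos 0).mul_const (y l i))
      simpa using this
    · exact hasDerivAt_const _ _
  have havg : ∀ (j : Fin p) (m : ℕ), HasDerivAt (fun t => avg fun i => Y j i t ^ m)
      (m * avg fun i => y j i ^ (m - 1) * d j i) 0 := by
    intro j m
    have := (HasDerivAt.fun_sum (u := Finset.univ) fun i _ => (hder j i).fun_pow m).const_mul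
      ((n : ℝ)⁻¹)
    simp only [hY0] at this
    convert! this using 1
    rw [← avg_mul_left]; unfold avg; congr 1
    exact Finset.sum_congr rfl fun i _ => by ring
  -- The factors 6 = 2·3 and 8 = 2·4 come from squaring the third and fourth moments; the final
  -- division by 2 turns them into 3 and 4.
  have hJ : HasDerivAt (fun t => sampleIndex α x (planeRotation k l t * W))
      (α * ∑ j, 6 * (avg fun i => y j i ^ 3) * (avg fun i => y j i ^ 2 * d j i)
        + (1 - α) * ∑ j, 8 * ((avg fun i => y j i ^ 4) - 3) *
          (avg fun i => y j i ^ 3 * d j i)) 0 := by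
    have h3 := (HasDerivAt.fun_sum (u := Finset.univ) fun j _ =>
      (havg j 3).fun_pow 2).const_mul α
    have h4 := (HasDerivAt.fun_sum (u := Finset.univ) fun j _ =>
      ((havg j 4).sub_const 3).fun_pow 2).const_mul (1 - α)
    simp only [hY0] at h3 h4
    convert! h3.add h4 using 1
    congr 2 <;> refine Finset.sum_congr rfl fun j _ => ?_ <;> norm_num <;> ring
  -- A rotation of W again satisfies the constraint, so angle zero is a maximum over all angles.
  have hloc : IsLocalMax (fun t => sampleIndex α x (planeRotation k l t * W)) 0 := by
    refine Filter.Eventually.of_forall fun t => ?_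
    have h0 : sampleIndex α x (planeRotation k l 0 * W) = sampleIndex α x W := by
      have : ∀ j i, (planeRotation k l 0 * W) j ⬝ᵥ ctr x i = W j ⬝ᵥ ctr x i := hY0
      simp only [sampleIndex, this]
    simp only [h0]
    apply hmax
    rw [transpose_mul]
    calc planeRotation k l t * W * covMat (empirical x) * (Wᵀ * (planeRotation k l t)ᵀ)
        = planeRotation k l t * (W * covMat (empirical x) * Wᵀ) * (planeRotation k l t)ᵀ := by
          simp only [Matrix.mul_assoc]
      _ = 1 := by rw [hW, mul_one, planeRotation_mul_transpose hkl]
  have h0 := hloc.hasDerivAt_eq_zero hJ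
  have hz : ∀ j, j ≠ k ∧ j ≠ l → d j = 0 := by
    rintro j ⟨h1, h2⟩; ext i; simp [hd, h1, h2]
  have hdk : d k = y l := by ext i; simp [hd]
  have hdl : d l = fun i => (-1) * y k i := by ext i; simp [hd, hkl.symm]
  have havg0 : ∀ (m : ℕ) (j), (avg fun i => y j i ^ m * (0 : Fin n → ℝ) i) = 0 := by
    simp [avg]
  have hneg : ∀ (m : ℕ), (avg fun i => y l i ^ m * (-1 * y k i))
      = - avg fun i => y l i ^ m * y k i := by
    intro m
    rw [neg_eq_neg_one_mul (avg _), ← avg_mul_left]; congr 1; ext i; ring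
  rw [Finset.sum_eq_add k l hkl (fun j _ hj => by rw [hz j hj, havg0, mul_zero])
    (by simp) (by simp), Finset.sum_eq_add k l hkl
    (fun j _ hj => by rw [hz j hj, havg0, mul_zero]) (by simp) (by simp), hdk, hdl, hneg,
    hneg] at h0
  linear_combination h0 / 2

/-! ### Measurable selection of maximizers -/

/-- A function on a compact metric space depending measurably on a parameter and continuous in the
point has a maximizer depending measurably on the parameter. -/
theorem exists_measurable_argmax {X K : Type*} [MeasurableSpace X] [MetricSpace K] [CompactSpace K]
    [Nonempty K] [MeasurableSpace K] [BorelSpace K] (h : X → K → ℝ)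
    (hm : ∀ u, Measurable fun x => h x u) (hc : ∀ x, Continuous (h x)) :
    ∃ s : X → K, Measurable s ∧ ∀ x u, h x u ≤ h x (s x) := by
  -- A nonempty compact metric space is a continuous image of the Cantor set. As a subset of the
  -- line the latter is ordered, so there is a canonical choice: the least parameter of a maximizer.
  obtain ⟨g₀, hg₀, hg₀s⟩ := exists_nat_bool_continuous_surjective_of_compact K
  set g : cantorSet → K := g₀ ∘ cantorSetHomeomorphNatToBool with hg
  have hgc : Continuous g := hg₀.comp cantorSetHomeomorphNatToBool.continuous
  have hgs : Function.Surjective g := hg₀s.comp cantorSetHomeomorphNatToBool.surjective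
  have : CompactSpace cantorSet := isCompact_iff_compactSpace.1 isCompact_cantorSet
  have : Nonempty cantorSet := ⟨⟨0, zero_mem_cantorSet⟩⟩
  -- the set of maximizers and its smallest element
  set M : X → Set cantorSet := fun x => {t | ∀ u, h x (g u) ≤ h x (g t)} with hM
  have hMc : ∀ x, IsClosed (M x) := by
    intro x
    simp only [hM, Set.ofPred_forall]
    exact isClosed_iInter fun u => isClosed_le continuous_const ((hc x).comp hgc)
  have hMne : ∀ x, (M x).Nonempty := by
    intro x
    obtain ⟨t, -, ht⟩ := isCompact_univ.exists_isMaxOn Set.univ_nonempty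
      ((hc x).comp hgc).continuousOn
    exact ⟨t, fun u => ht (Set.mem_univ u)⟩
  have hleast : ∀ x, ∃ t ∈ M x, ∀ u ∈ M x, t ≤ u := by
    intro x
    obtain ⟨t, ht, hmin⟩ := (hMc x).isCompact.exists_isMinOn (hMne x) continuous_id.continuousOn
    exact ⟨t, ht, fun u hu => hmin hu⟩
  choose τ hτ hτle using hleast
  -- By continuity the supremum over a compact set of parameters is one over a countable dense
  -- subset, hence measurable in x.
  have hsup : ∀ (F : Set cantorSet), IsCompact F → F.Nonempty →
      Measurable fun x => ⨆ t : F, h x (g t) := by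
    intro F hF hne
    have : Nonempty F := hne.to_subtype
    have : CompactSpace F := isCompact_iff_compactSpace.1 hF
    have heq : (fun x => ⨆ t : F, h x (g t)) = fun x => ⨆ n, h x (g (TopologicalSpace.denseSeq F n)) := by
      ext x
      have hcx : Continuous fun t : F => h x (g t) :=
        (hc x).comp (hgc.comp continuous_subtype_val)
      have hb : BddAbove (Set.range fun t : F => h x (g t)) := (isCompact_range hcx).bddAbove
      apply le_antisymm
      · refine ciSup_le fun t => ?_
        have hcl : IsClosed {t : F | h x (g t) ≤ ⨆ n, h x (g (TopologicalSpace.denseSeq F n))} :=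
          isClosed_le hcx continuous_const
        have := closure_minimal (s := Set.range (TopologicalSpace.denseSeq F)) (by
          rintro _ ⟨n, rfl⟩
          exact le_ciSup (f := fun n => h x (g (TopologicalSpace.denseSeq F n)))
            (hb.mono (by rintro _ ⟨n, rfl⟩; exact ⟨_, rfl⟩)) n) hcl
        exact this (by rw [(TopologicalSpace.denseRange_denseSeq F).closure_range]; trivial)
      · exact ciSup_le fun n => le_ciSup hb (TopologicalSpace.denseSeq F n)
    rw [heq]
    exact Measurable.iSup fun n => hm _
  -- The least maximizer is at most c exactly when the supremum over {t ≤ c} reaches the overall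
  -- supremum, which is an inequality between measurable functions.
  have hτm : Measurable fun x => (τ x : ℝ) := by
    refine measurable_of_Iic fun c => ?_
    set F : Set cantorSet := {t | (t : ℝ) ≤ c} with hF
    have hFc : IsClosed F := isClosed_le continuous_subtype_val continuous_const
    by_cases hne : F.Nonempty
    · have : (fun x => (τ x : ℝ)) ⁻¹' Set.Iic c =
          {x | (⨆ t : (Set.univ : Set cantorSet), h x (g t)) ≤ ⨆ t : F, h x (g t)} := by
        ext x
        have hcx : Continuous fun t => h x (g t) := (hc x).comp hgc
        have hbd : ∀ S : Set cantorSet, BddAbove (Set.range fun t : S => h x (g t)) := fun S =>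
          (isCompact_range hcx).bddAbove.mono (by rintro _ ⟨n, rfl⟩; exact ⟨_, rfl⟩)
        constructor
        · intro hx
          have : Nonempty (Set.univ : Set cantorSet) := ⟨⟨τ x, trivial⟩⟩
          exact (ciSup_le fun t : (Set.univ : Set cantorSet) => hτ x t).trans
            (le_ciSup (hbd F) ⟨τ x, hx⟩)
        · intro hx
          obtain ⟨t, ht, hmax⟩ := hFc.isCompact.exists_isMaxOn hne hcx.continuousOn
          have : Nonempty F := hne.to_subtype
          have h1 : t ∈ M x := fun u => (le_ciSup (hbd Set.univ) ⟨u, trivial⟩).trans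
            (le_trans hx (ciSup_le fun v => hmax v.2))
          exact le_trans (b := (t : ℝ)) (hτle x t h1) ht
      rw [this]
      exact measurableSet_le (hsup _ isCompact_univ Set.univ_nonempty) (hsup _ hFc.isCompact hne)
    · have : (fun x => (τ x : ℝ)) ⁻¹' Set.Iic c = ∅ := by
        ext x
        simp only [Set.mem_preimage, Set.mem_Iic, Set.mem_empty_iff_false, iff_false]
        exact fun hx => hne ⟨τ x, hx⟩
      rw [this]; exact MeasurableSet.empty
  refine ⟨fun x => g (τ x), hgc.measurable.comp
    (Measurable.subtype_mk (h := fun x => (τ x).2) hτm), fun x u => ?_⟩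
  obtain ⟨t, rfl⟩ := hgs u
  exact hτ x t

/-! ### Continuity and measurability of the inverse square root -/

open scoped MatrixOrder Matrix.Norms.L2Operator in
-- The square root is continuous on the positive semidefinite matrices, and inversion is continuous
-- at invertible ones.
lemma continuousOn_invSqrt (p : ℕ) :
    ContinuousOn (invSqrt : Matrix (Fin p) (Fin p) ℝ → Matrix (Fin p) (Fin p) ℝ)
      {A | A.PosDef} := by
  intro A hA
  have h1 : ContinuousWithinAt (CFC.sqrt : Matrix (Fin p) (Fin p) ℝ → Matrix (Fin p) (Fin p) ℝ)
      {A | A.PosDef} A :=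
    (CFC.continuousOn_sqrt A (Matrix.PosDef.posSemidef hA).nonneg).mono
      fun B hB => (Matrix.PosDef.posSemidef hB).nonneg
  have hu : IsUnit (CFC.sqrt A) := by
    have h := (isInvSqrt_invSqrt hA).isUnit_det
    rw [invSqrt, Matrix.isUnit_nonsing_inv_det_iff] at h
    exact (Matrix.isUnit_iff_isUnit_det _).2 h
  have h2 : ContinuousAt (Ring.inverse : Matrix (Fin p) (Fin p) ℝ → _) (CFC.sqrt A) := by
    obtain ⟨u, hu⟩ := hu
    rw [← hu]
    exact NormedRing.inverse_continuousAt u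
  have h3 := h2.comp_continuousWithinAt h1
  refine h3.congr (fun B _ => ?_) ?_ <;> simp [invSqrt, Matrix.nonsing_inv_eq_ringInverse]

open scoped MatrixOrder Matrix.Norms.L2Operator in
lemma invSqrt_one (p : ℕ) : invSqrt (1 : Matrix (Fin p) (Fin p) ℝ) = 1 := by
  simp [invSqrt, CFC.sqrt_one]

/-- Symmetry and nonnegativity of the quadratic form are closed conditions, so the uncountable
intersection over vectors is harmless; given them, definiteness amounts to the open condition det ≠
0. -/
lemma measurableSet_posDef (p : ℕ) :
    MeasurableSet {A : Fin p → Fin p → ℝ | (Matrix.of A).PosDef} := by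
  have h : {A : Fin p → Fin p → ℝ | (Matrix.of A).PosDef} =
      {A | (Matrix.of A)ᵀ = Matrix.of A} ∩ (⋂ x : Fin p → ℝ, {A | 0 ≤ x ⬝ᵥ (Matrix.of A *ᵥ x)}) ∩
        {A | (Matrix.of A).det ≠ 0} := by
    ext A
    simp only [Set.mem_ofPred_eq, Set.mem_inter_iff, Set.mem_iInter]
    constructor
    · intro hA
      refine ⟨⟨?_, fun x => ?_⟩, hA.det_pos.ne'⟩
      · have := hA.isHermitian.eq
        rwa [conjTranspose_eq_transpose_of_trivial] at this
      · simpa using hA.posSemidef.dotProduct_mulVec_nonneg x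
    · rintro ⟨⟨h1, h2⟩, h3⟩
      have hp : (Matrix.of A).PosSemidef := by
        refine Matrix.PosSemidef.of_dotProduct_mulVec_nonneg ?_ fun x => by simpa using h2 x
        rw [Matrix.IsHermitian, conjTranspose_eq_transpose_of_trivial, h1]
      exact hp.posDef_iff_isUnit.2 ((Matrix.isUnit_iff_isUnit_det _).2 h3.isUnit)
  have hcd : Continuous fun A : Fin p → Fin p → ℝ => (Matrix.of A).det :=
    Continuous.matrix_det continuous_id
  rw [h]
  refine ((IsClosed.inter ?_ ?_).measurableSet).inter ?_
  · exact isClosed_eq (Continuous.matrix_transpose continuous_id) continuous_id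
  · refine isClosed_iInter fun x => isClosed_le continuous_const ?_
    exact Continuous.dotProduct continuous_const
      (Continuous.matrix_mulVec continuous_id continuous_const)
  · exact (isOpen_ne_fun hcd continuous_const).measurableSet

/-- The extension is by zero off the positive definite matrices, where the value of the estimator
does not matter. -/
lemma exists_measurable_invSqrt (p : ℕ) : ∃ H : (Fin p → Fin p → ℝ) → Fin p → Fin p → ℝ,
    Measurable H ∧ ∀ A : Matrix (Fin p) (Fin p) ℝ, A.PosDef → Matrix.of (H A) = invSqrt A := by
  classical
  let f : (Fin p → Fin p → ℝ) → Fin p → Fin p → ℝ := fun A => invSqrt (Matrix.of A)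
  have hf : ContinuousOn f {A : Fin p → Fin p → ℝ | (Matrix.of A).PosDef} := continuousOn_invSqrt p
  refine ⟨{A : Fin p → Fin p → ℝ | (Matrix.of A).PosDef}.piecewise f (fun _ => 0), ?_,
    fun A hA => ?_⟩
  · exact ContinuousOn.measurable_piecewise hf continuousOn_const (measurableSet_posDef p)
  · have : Matrix.of.symm A ∈ {A : Fin p → Fin p → ℝ | (Matrix.of A).PosDef} := hA
    exact congrArg Matrix.of (Set.piecewise_eq_of_mem _ f (fun _ => 0) this)

/-- Matrices close to the identity in a sequence of positive semidefinite ones are positive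
definite. -/
lemma eventually_posDef {ι : Type*} {L : Filter ι} {p : ℕ} {A : ι → Matrix (Fin p) (Fin p) ℝ}
    (hA : ∀ i, (A i).PosSemidef) (h : Tendsto A L (𝓝 1)) : ∀ᶠ i in L, (A i).PosDef := by
  have h1 : Tendsto (fun i => (A i).det) L (𝓝 1) := by
    have : Continuous fun A : Matrix (Fin p) (Fin p) ℝ => A.det :=
      Continuous.matrix_det continuous_id
    have h2 := (this.tendsto 1).comp h
    rw [Matrix.det_one] at h2
    exact h2
  filter_upwards [h1.eventually_ne one_ne_zero] with i hi
  exact (hA i).posDef_iff_isUnit.2 ((Matrix.isUnit_iff_isUnit_det _).2 hi.isUnit)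

lemma tendsto_invSqrt {ι : Type*} {L : Filter ι} {p : ℕ} {A : ι → Matrix (Fin p) (Fin p) ℝ}
    (hA : ∀ i, (A i).PosSemidef) (h : Tendsto A L (𝓝 1)) :
    Tendsto (fun i => invSqrt (A i)) L (𝓝 1) := by
  have h1 := continuousOn_invSqrt p 1 Matrix.PosDef.one
  rw [ContinuousWithinAt, invSqrt_one] at h1
  exact h1.comp (tendsto_nhdsWithin_iff.2 ⟨h, eventually_posDef hA h⟩)

/-! ### Moments of independent sums -/

section Moments

variable {Ω : Type*} [MeasurableSpace Ω] {P : Measure Ω} [IsProbabilityMeasure P]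

lemma integrable_pow_of_memLp {X : Ω → ℝ} {m : ℕ} (hX : MemLp X m P) {k : ℕ} (hk : k ≤ m) :
    Integrable (fun ω => X ω ^ k) P := by
  have h1 : MemLp X k P := hX.mono_exponent (by exact_mod_cast hk)
  refine (integrable_norm_iff (h1.1.pow k)).1 ?_
  simpa [norm_pow] using h1.integrable_norm_pow'

omit [IsProbabilityMeasure P] in
lemma IndepFun.integral_pow_mul_pow {X Y : Ω → ℝ} (h : IndepFun X Y P)
    (hX : AEStronglyMeasurable X P) (hY : AEStronglyMeasurable Y P) (a b : ℕ) :
    ∫ ω, X ω ^ a * Y ω ^ b ∂P = (∫ ω, X ω ^ a ∂P) * ∫ ω, Y ω ^ b ∂P :=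
  (h.comp (φ := fun x => x ^ a) (ψ := fun x => x ^ b) (by fun_prop)
    (by fun_prop)).integral_fun_mul_eq_mul_integral (hX.pow a) (hY.pow b)

lemma IndepFun.integrable_pow_mul_pow {X Y : Ω → ℝ} (h : IndepFun X Y P) {m : ℕ}
    (hX : MemLp X m P) (hY : MemLp Y m P) {a b : ℕ} (ha : a ≤ m) (hb : b ≤ m) :
    Integrable (fun ω => X ω ^ a * Y ω ^ b) P :=
  (h.comp (φ := fun x => x ^ a) (ψ := fun x => x ^ b) (by fun_prop)
    (by fun_prop)).integrable_mul (integrable_pow_of_memLp hX ha) (integrable_pow_of_memLp hY hb)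

/-- Additivity of the first four cumulants of centered variables, the fourth being E Y⁴ - 3(E Y²)².
In the binomial expansion of one more summand, all mixed terms with a first power vanish; only 6 E
Y² E S² survives, and it completes the square of the total variance. -/
lemma moments_sum_of_iIndepFun {ι : Type*} {Y : ι → Ω → ℝ} (hind : iIndepFun Y P)
    (hmeas : ∀ i, Measurable (Y i)) (h4 : ∀ i, MemLp (Y i) 4 P) (h0 : ∀ i, ∫ ω, Y i ω ∂P = 0)
    (s : Finset ι) :
    MemLp (fun ω => ∑ i ∈ s, Y i ω) 4 P ∧ ∫ ω, ∑ i ∈ s, Y i ω ∂P = 0 ∧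
    ∫ ω, (∑ i ∈ s, Y i ω) ^ 2 ∂P = ∑ i ∈ s, ∫ ω, Y i ω ^ 2 ∂P ∧
    ∫ ω, (∑ i ∈ s, Y i ω) ^ 3 ∂P = ∑ i ∈ s, ∫ ω, Y i ω ^ 3 ∂P ∧
    ∫ ω, (∑ i ∈ s, Y i ω) ^ 4 ∂P = 3 * (∑ i ∈ s, ∫ ω, Y i ω ^ 2 ∂P) ^ 2
      + ∑ i ∈ s, (∫ ω, Y i ω ^ 4 ∂P - 3 * (∫ ω, Y i ω ^ 2 ∂P) ^ 2) := by
  classical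
  induction s using Finset.induction_on with
  | empty => simp
  | insert a s ha ih =>
    obtain ⟨i4, i1, i2, i3, i5⟩ := ih
    have hI : IndepFun (Y a) (fun ω => ∑ i ∈ s, Y i ω) P := by
      have := (hind.indepFun_finsetSum_of_notMem hmeas ha).symm
      convert this using 1
      ext ω; simp
    set S : Ω → ℝ := fun ω => ∑ i ∈ s, Y i ω with hS
    have hi : ∀ ω, ∑ i ∈ insert a s, Y i ω = Y a ω + S ω := fun ω => Finset.sum_insert ha
    have hp : ∀ b c : ℕ, ∫ ω, Y a ω ^ b * S ω ^ c ∂P = (∫ ω, Y a ω ^ b ∂P) * ∫ ω, S ω ^ c ∂P :=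
      IndepFun.integral_pow_mul_pow hI (h4 a).1 i4.1
    have hint : ∀ b c : ℕ, b ≤ 4 → c ≤ 4 → Integrable (fun ω => Y a ω ^ b * S ω ^ c) P :=
      fun b c hb hc => IndepFun.integrable_pow_mul_pow hI (m := 4) (by exact_mod_cast h4 a)
        (by exact_mod_cast i4) hb hc
    have e0 : ∫ ω, Y a ω ^ 0 ∂P = 1 := by simp
    have e1 : ∫ ω, Y a ω ^ 1 ∂P = 0 := by simpa using h0 a
    have s0 : ∫ ω, S ω ^ 0 ∂P = 1 := by simp
    have s1 : ∫ ω, S ω ^ 1 ∂P = 0 := by simpa using i1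
    simp only [hi, Finset.sum_insert ha]
    refine ⟨(h4 a).add i4, ?_, ?_, ?_, ?_⟩
    · have := integral_add (hint 1 0 (by norm_num) (by norm_num))
        (hint 0 1 (by norm_num) (by norm_num))
      rw [hp, hp, e1, s1] at this
      simpa using this
    · have h : ∀ ω, (Y a ω + S ω) ^ 2 = Y a ω ^ 2 * S ω ^ 0 + 2 * (Y a ω ^ 1 * S ω ^ 1)
          + Y a ω ^ 0 * S ω ^ 2 := fun ω => by ring
      have j1 := hint 2 0 (by norm_num) (by norm_num)
      have j2 := (hint 1 1 (by norm_num) (by norm_num)).const_mul 2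
      have j3 := hint 0 2 (by norm_num) (by norm_num)
      simp only [h]
      rw [integral_add (j1.fun_add j2) j3, integral_add j1 j2, integral_const_mul, hp, hp, hp, e0, e1,
        s0, i2]
      ring
    · have h : ∀ ω, (Y a ω + S ω) ^ 3 = Y a ω ^ 3 * S ω ^ 0 + 3 * (Y a ω ^ 2 * S ω ^ 1)
          + 3 * (Y a ω ^ 1 * S ω ^ 2) + Y a ω ^ 0 * S ω ^ 3 := fun ω => by ring
      have j1 := hint 3 0 (by norm_num) (by norm_num)
      have j2 := (hint 2 1 (by norm_num) (by norm_num)).const_mul 3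
      have j3 := (hint 1 2 (by norm_num) (by norm_num)).const_mul 3
      have j4 := hint 0 3 (by norm_num) (by norm_num)
      simp only [h]
      rw [integral_add ((j1.fun_add j2).fun_add j3) j4, integral_add (j1.fun_add j2) j3, integral_add j1 j2,
        integral_const_mul, integral_const_mul, hp, hp, hp, hp, e0, e1, s0, s1, i3]
      ring
    · have h : ∀ ω, (Y a ω + S ω) ^ 4 = Y a ω ^ 4 * S ω ^ 0 + 4 * (Y a ω ^ 3 * S ω ^ 1)
          + 6 * (Y a ω ^ 2 * S ω ^ 2) + 4 * (Y a ω ^ 1 * S ω ^ 3) + Y a ω ^ 0 * S ω ^ 4 :=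
        fun ω => by ring
      have j1 := hint 4 0 (by norm_num) (by norm_num)
      have j2 := (hint 3 1 (by norm_num) (by norm_num)).const_mul 4
      have j3 := (hint 2 2 (by norm_num) (by norm_num)).const_mul 6
      have j4 := (hint 1 3 (by norm_num) (by norm_num)).const_mul 4
      have j5 := hint 0 4 (by norm_num) (by norm_num)
      simp only [h]
      rw [integral_add (((j1.fun_add j2).fun_add j3).fun_add j4) j5, integral_add ((j1.fun_add j2).fun_add j3) j4,
        integral_add (j1.fun_add j2) j3, integral_add j1 j2,
        integral_const_mul, integral_const_mul, integral_const_mul, hp, hp, hp, hp, hp, e0, e1, s0,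
        s1, i2, i5]
      ring

end Moments

/-! ### The index as a function of finitely many moments -/

/-- The coordinates of a vector together with the constant `1`. -/
def aug {p : ℕ} (x : Fin p → ℝ) (a : Option (Fin p)) : ℝ := a.elim 1 x

@[simp] lemma aug_none {p : ℕ} (x : Fin p → ℝ) : aug x none = 1 := rfl
@[simp] lemma aug_some {p : ℕ} (x : Fin p → ℝ) (i : Fin p) : aug x (some i) = x i := rfl

/-- Indices of the monomials of degree at most `3`, and of those of degree at most `4`. -/
abbrev MIdx (p : ℕ) : Type :=
  (Option (Fin p) × Option (Fin p) × Option (Fin p)) ⊕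
    (Option (Fin p) × Option (Fin p) × Option (Fin p) × Option (Fin p))

/-- The monomials, those of the second kind with a factor `c`. -/
def monom {p : ℕ} (c : ℝ) (x : Fin p → ℝ) : MIdx p → ℝ :=
  Sum.elim (fun a => aug x a.1 * aug x a.2.1 * aug x a.2.2)
    (fun a => c * (aug x a.1 * aug x a.2.1 * aug x a.2.2.1 * aug x a.2.2.2))

/-- The moment of a product of three affine functions. -/
def triple {p : ℕ} (u v w : Option (Fin p) → ℝ) (m : MIdx p → ℝ) : ℝ :=
  ∑ a, ∑ b, ∑ d, u a * v b * w d * m (.inl (a, b, d))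

/-- The moment of a product of four affine functions. -/
def quadruple {p : ℕ} (u v w y : Option (Fin p) → ℝ) (m : MIdx p → ℝ) : ℝ :=
  ∑ a, ∑ b, ∑ d, ∑ e, u a * v b * w d * y e * m (.inr (a, b, d, e))

/-- The value of an affine function. -/
def affine {p : ℕ} (u : Option (Fin p) → ℝ) (x : Fin p → ℝ) : ℝ := ∑ a, u a * aug x a

lemma triple_monom {p : ℕ} (u v w : Option (Fin p) → ℝ) (c : ℝ) (x : Fin p → ℝ) :
    triple u v w (monom c x) = affine u x * affine v x * affine w x := by
  rw [mul_assoc]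
  simp only [triple, affine, monom, Sum.elim_inl]
  rw [Finset.sum_mul]
  refine Finset.sum_congr rfl fun a _ => ?_
  rw [Finset.sum_mul, Finset.mul_sum]
  refine Finset.sum_congr rfl fun b _ => ?_
  rw [Finset.mul_sum, Finset.mul_sum]
  exact Finset.sum_congr rfl fun d _ => by ring

lemma quadruple_monom {p : ℕ} (u v w y : Option (Fin p) → ℝ) (c : ℝ) (x : Fin p → ℝ) :
    quadruple u v w y (monom c x) =
      c * (affine u x * affine v x * affine w x * affine y x) := by
  rw [mul_assoc, mul_assoc]
  simp only [quadruple, affine, monom, Sum.elim_inr]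
  rw [Finset.sum_mul, Finset.mul_sum]
  refine Finset.sum_congr rfl fun a _ => ?_
  rw [Finset.sum_mul, Finset.mul_sum, Finset.mul_sum]
  refine Finset.sum_congr rfl fun b _ => ?_
  rw [Finset.sum_mul, Finset.mul_sum, Finset.mul_sum, Finset.mul_sum]
  refine Finset.sum_congr rfl fun d _ => ?_
  rw [Finset.mul_sum, Finset.mul_sum, Finset.mul_sum, Finset.mul_sum]
  exact Finset.sum_congr rfl fun e _ => by ring

/-- The moments of a finite data set. -/
def sampleMoments {p n : ℕ} (c : ℝ) (x : Fin n → Fin p → ℝ) (j : MIdx p) : ℝ :=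
  avg fun i => monom c (x i) j

/-- `triple` is linear in the moments and so commutes with averages. -/
lemma triple_sampleMoments {p n : ℕ} (u v w : Option (Fin p) → ℝ) (c : ℝ)
    (x : Fin n → Fin p → ℝ) : triple u v w (sampleMoments c x) =
      avg fun i => affine u (x i) * affine v (x i) * affine w (x i) := by
  simp only [← triple_monom u v w c, triple, avg_sum, avg_mul_left, sampleMoments]

lemma quadruple_sampleMoments {p n : ℕ} (u v w y : Option (Fin p) → ℝ) (c : ℝ)
    (x : Fin n → Fin p → ℝ) : quadruple u v w y (sampleMoments c x) =
      c * avg fun i => affine u (x i) * affine v (x i) * affine w (x i) * affine y (x i) := by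
  simp only [← avg_mul_left, ← quadruple_monom u v w y c]
  simp only [quadruple, avg_sum, avg_mul_left, sampleMoments]

/-- The coefficients of the affine function `x ↦ (W (x - E x))ₖ`. -/
def coef {p : ℕ} (W : Fin p → Fin p → ℝ) (m : MIdx p → ℝ) (k : Fin p) (a : Option (Fin p)) : ℝ :=
  a.elim (-∑ i, W k i * m (.inl (none, none, some i))) (W k)

lemma affine_coef {p n : ℕ} (W : Matrix (Fin p) (Fin p) ℝ) (c : ℝ) (x : Fin n → Fin p → ℝ) (k : Fin p)
    (i : Fin n) : affine (coef W (sampleMoments c x) k) (x i) = W k ⬝ᵥ ctr x i := by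
  have h : ∀ j, sampleMoments c x (.inl (none, none, some j)) = meanVec (empirical x) j := by
    intro j; simp [sampleMoments, monom, meanVec, integral_empirical]
  rw [ctr, dotProduct_sub]
  simp only [affine, Fintype.sum_option, coef, Option.elim, aug_none, aug_some, h, dotProduct]
  ring

/-- The coefficients of a constant function and of a coordinate. -/
def unitVec {p : ℕ} (a : Option (Fin p)) : Option (Fin p) → ℝ := Pi.single a 1

@[simp] lemma affine_unitVec {p : ℕ} (a : Option (Fin p)) (x : Fin p → ℝ) :
    affine (unitVec a) x = aug x a := by
  simp only [affine, unitVec, Pi.single_apply, ite_mul, one_mul, zero_mul, Finset.sum_ite_eq',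
    Finset.mem_univ, if_true]

/-- Covariances of `W x`, in terms of the moments of `x`. -/
def covF {p : ℕ} (W : Fin p → Fin p → ℝ) (m : MIdx p → ℝ) (k l : Fin p) : ℝ :=
  triple (unitVec none) (coef W m k) (coef W m l) m

/-- The moments `E[yₖ² yₗ]` of `y = W (x - E x)`, in terms of the moments of `x`. -/
def thirdF {p : ℕ} (W : Fin p → Fin p → ℝ) (m : MIdx p → ℝ) (k l : Fin p) : ℝ :=
  triple (coef W m k) (coef W m k) (coef W m l) m

/-- The moments `E[yₖ³ yₗ]` of `y = W (x - E x)`, in terms of the moments of `x`. -/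
def fourthF {p : ℕ} (W : Fin p → Fin p → ℝ) (m : MIdx p → ℝ) (k l : Fin p) : ℝ :=
  quadruple (coef W m k) (coef W m k) (coef W m k) (coef W m l) m

/-- The projection index in terms of moments. -/
def indexF {p : ℕ} (α : ℝ) (W : Fin p → Fin p → ℝ) (m : MIdx p → ℝ) : ℝ :=
  α * ∑ k, thirdF W m k k ^ 2 + (1 - α) * ∑ k, (fourthF W m k k - 3) ^ 2

/-- The estimating functions in terms of moments. -/
def estF {p : ℕ} (α : ℝ) (W : Fin p → Fin p → ℝ) (m : MIdx p → ℝ) (k l : Fin p) : ℝ :=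
  3 * α * (thirdF W m k k * thirdF W m k l - thirdF W m l l * thirdF W m l k)
    + 4 * (1 - α) * ((fourthF W m k k - 3) * fourthF W m k l
        - (fourthF W m l l - 3) * fourthF W m l k)

lemma covF_sampleMoments {p n : ℕ} (W : Matrix (Fin p) (Fin p) ℝ) (c : ℝ)
    (x : Fin n → Fin p → ℝ) (k l : Fin p) :
    covF W (sampleMoments c x) k l = (W * covMat (empirical x) * Wᵀ) k l := by
  unfold covF
  rw [triple_sampleMoments, mul_covMat_mul_transpose]
  simp [affine_coef]

lemma thirdF_sampleMoments {p n : ℕ} (W : Matrix (Fin p) (Fin p) ℝ) (c : ℝ)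
    (x : Fin n → Fin p → ℝ) (k l : Fin p) :
    thirdF W (sampleMoments c x) k l
      = avg fun i => (W k ⬝ᵥ ctr x i) ^ 2 * (W l ⬝ᵥ ctr x i) := by
  simp only [thirdF, triple_sampleMoments, affine_coef, pow_succ, pow_zero, one_mul]

lemma fourthF_sampleMoments {p n : ℕ} (W : Matrix (Fin p) (Fin p) ℝ) (c : ℝ)
    (x : Fin n → Fin p → ℝ) (k l : Fin p) :
    fourthF W (sampleMoments c x) k l
      = c * avg fun i => (W k ⬝ᵥ ctr x i) ^ 3 * (W l ⬝ᵥ ctr x i) := by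
  simp only [fourthF, quadruple_sampleMoments, affine_coef, pow_succ, pow_zero, one_mul]

lemma indexF_sampleMoments {p n : ℕ} (α : ℝ) (W : Matrix (Fin p) (Fin p) ℝ)
    (x : Fin n → Fin p → ℝ) : indexF α W (sampleMoments 1 x) = sampleIndex α x W := by
  simp only [indexF, thirdF_sampleMoments, fourthF_sampleMoments, sampleIndex, one_mul, ← pow_succ]

/-- The moments of degree four carry the factor c, but they also carry 1 - α, so any c is allowed
when α = 1. -/
lemma estF_eq_zero {p n : ℕ} {α c : ℝ} (hc : α = 1 ∨ c = 1) {x : Fin n → Fin p → ℝ}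
    (hA : (covMat (empirical x)).PosDef) {W : Matrix (Fin p) (Fin p) ℝ}
    (hW : IsSymPP α (empirical x) W) {k l : Fin p} (hkl : k ≠ l) :
    estF α W (sampleMoments c x) k l = 0 := by
  rw [isSymPP_empirical_iff α hA] at hW
  have := stationary_of_isMax α x W hW.1 hW.2 hkl
  simp only [estF, thirdF_sampleMoments, fourthF_sampleMoments, ← pow_succ]
  rcases hc with rfl | rfl
  · simpa using this
  · simpa using this

lemma covF_eq_one {p n : ℕ} {α : ℝ} (c : ℝ) {x : Fin n → Fin p → ℝ}
    (hA : (covMat (empirical x)).PosDef) {W : Matrix (Fin p) (Fin p) ℝ}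
    (hW : IsSymPP α (empirical x) W) (k l : Fin p) :
    covF W (sampleMoments c x) k l = (1 : Matrix (Fin p) (Fin p) ℝ) k l := by
  rw [covF_sampleMoments, ((isSymPP_empirical_iff α hA W).1 hW).1]

section Continuity

lemma continuous_coef {p : ℕ} (k : Fin p) (a : Option (Fin p)) :
    Continuous fun q : (Fin p → Fin p → ℝ) × (MIdx p → ℝ) => coef q.1 q.2 k a := by
  cases a <;> simp only [coef, Option.elim] <;> fun_prop

lemma continuous_covF {p : ℕ} (k l : Fin p) :
    Continuous fun q : (Fin p → Fin p → ℝ) × (MIdx p → ℝ) => covF q.1 q.2 k l := by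
  have h := fun (k : Fin p) a => continuous_coef k a
  unfold covF triple
  fun_prop

lemma continuous_thirdF {p : ℕ} (k l : Fin p) :
    Continuous fun q : (Fin p → Fin p → ℝ) × (MIdx p → ℝ) => thirdF q.1 q.2 k l := by
  have h := fun (k : Fin p) a => continuous_coef k a
  unfold thirdF triple
  fun_prop

lemma continuous_fourthF {p : ℕ} (k l : Fin p) :
    Continuous fun q : (Fin p → Fin p → ℝ) × (MIdx p → ℝ) => fourthF q.1 q.2 k l := by
  have h := fun (k : Fin p) a => continuous_coef k a
  unfold fourthF quadruple
  fun_prop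

lemma continuous_indexF {p : ℕ} (α : ℝ) :
    Continuous fun q : (Fin p → Fin p → ℝ) × (MIdx p → ℝ) => indexF α q.1 q.2 := by
  have h3 := fun k l : Fin p => continuous_thirdF k l
  have h4 := fun k l : Fin p => continuous_fourthF k l
  unfold indexF
  fun_prop

end Continuity

/-! ### Maximizers of the population index -/

/-- The sum of the fourth powers of the entries of a unit vector is at most `1`. -/
lemma sum_pow_four_le_one {ι : Type*} [Fintype ι] {u : ι → ℝ} (h : ∑ i, u i ^ 2 = 1) :
    ∑ i, u i ^ 4 ≤ 1 := by
  rw [← h]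
  refine Finset.sum_le_sum fun i hi => ?_
  have h1 : u i ^ 2 ≤ 1 := h ▸ Finset.single_le_sum (f := fun i => u i ^ 2)
    (fun j _ => sq_nonneg (u j)) hi
  nlinarith [sq_nonneg (u i)]

lemma sq_le_one_of_sum {ι : Type*} [Fintype ι] {u : ι → ℝ} (h : ∑ i, u i ^ 2 = 1) (i : ι) :
    u i ^ 2 ≤ 1 :=
  h ▸ Finset.single_le_sum (f := fun i => u i ^ 2) (fun j _ => sq_nonneg (u j)) (Finset.mem_univ i)

/-- Cauchy–Schwarz for u³a = u · (u²a), with u of norm one. -/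
lemma sum_cube_mul_sq_le {ι : Type*} [Fintype ι] {u : ι → ℝ} (h : ∑ i, u i ^ 2 = 1)
    (a : ι → ℝ) : (∑ i, u i ^ 3 * a i) ^ 2 ≤ ∑ i, u i ^ 4 * a i ^ 2 := by
  have := Finset.sum_mul_sq_le_sq_mul_sq Finset.univ u fun i => u i ^ 2 * a i
  rw [h, one_mul] at this
  calc (∑ i, u i ^ 3 * a i) ^ 2 = (∑ i, u i * (u i ^ 2 * a i)) ^ 2 := by
        congr 1; exact Finset.sum_congr rfl fun i _ => by ring
    _ ≤ _ := this
    _ = _ := Finset.sum_congr rfl fun i _ => by ring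

/-- Cauchy–Schwarz for u⁴a = u · (u³a) yields u⁶a², and uᵢ² ≤ 1 lowers the exponent from six to
four, so that skewness and kurtosis obey the same bound. -/
lemma sum_pow_four_mul_sq_le {ι : Type*} [Fintype ι] {u : ι → ℝ} (h : ∑ i, u i ^ 2 = 1)
    (a : ι → ℝ) : (∑ i, u i ^ 4 * a i) ^ 2 ≤ ∑ i, u i ^ 4 * a i ^ 2 := by
  have := Finset.sum_mul_sq_le_sq_mul_sq Finset.univ u fun i => u i ^ 3 * a i
  rw [h, one_mul] at this
  calc (∑ i, u i ^ 4 * a i) ^ 2 = (∑ i, u i * (u i ^ 3 * a i)) ^ 2 := by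
        congr 1; exact Finset.sum_congr rfl fun i _ => by ring
    _ ≤ _ := this
    _ ≤ _ := Finset.sum_le_sum fun i _ => by
        have h1 := sq_le_one_of_sum h i
        have h2 : 0 ≤ u i ^ 4 * a i ^ 2 := by positivity
        nlinarith

/-- The orthogonal matrices whose trace is not increased by a permutation of the rows with changes
of signs. -/
def domMat (p : ℕ) : Set (Fin p → Fin p → ℝ) :=
  {U | Matrix.of U * (Matrix.of U)ᵀ = 1 ∧ ∀ (σ : Equiv.Perm (Fin p)) (s : Fin p → ℤˣ),
    ∑ i, ((s i : ℤ) : ℝ) * U (σ i) i ≤ ∑ i, U i i}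

lemma sum_row_sq {p : ℕ} {U : Matrix (Fin p) (Fin p) ℝ} (h : U * Uᵀ = 1) (k : Fin p) :
    ∑ i, U k i ^ 2 = 1 := by
  have := congrFun (congrFun h k) k
  simpa [Matrix.mul_apply, sq] using this

lemma sum_col_sq {p : ℕ} {U : Matrix (Fin p) (Fin p) ℝ} (h : U * Uᵀ = 1) (i : Fin p) :
    ∑ k, U k i ^ 2 = 1 := by
  have h' : Uᵀ * U = 1 := mul_eq_one_comm.1 h
  have := congrFun (congrFun h' i) i
  simpa [Matrix.mul_apply, sq] using this

lemma intUnits_cast_sq (s : ℤˣ) : ((s : ℤ) : ℝ) ^ 2 = 1 := by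
  rcases Int.units_eq_one_or s with rfl | rfl <;> simp

lemma one_mem_domMat (p : ℕ) : (1 : Matrix (Fin p) (Fin p) ℝ) ∈ domMat p := by
  refine ⟨?_, fun σ s => Finset.sum_le_sum fun i _ => ?_⟩
  · exact (by simp : (1 : Matrix (Fin p) (Fin p) ℝ) * 1ᵀ = 1)
  · have h2 : ((s i : ℤ) : ℝ) ≤ 1 := by
      rcases Int.units_eq_one_or (s i) with h | h <;> simp [h]
    by_cases h : σ i = i <;> simp [Matrix.one_apply, h, h2]

lemma isCompact_domMat (p : ℕ) : IsCompact (domMat p) := by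
  have hcl : IsClosed (domMat p) := by
    have : domMat p = {U | Matrix.of U * (Matrix.of U)ᵀ = 1} ∩
        ⋂ (σ : Equiv.Perm (Fin p)) (s : Fin p → ℤˣ),
          {U | ∑ i, ((s i : ℤ) : ℝ) * U (σ i) i ≤ ∑ i, U i i} := by
      ext U; simp [domMat]
    rw [this]
    refine IsClosed.inter ?_ ?_
    · refine isClosed_eq ?_ continuous_const
      exact Continuous.matrix_mul continuous_id (Continuous.matrix_transpose continuous_id)
    · exact isClosed_iInter fun σ => isClosed_iInter fun s =>
        isClosed_le (by fun_prop) (by fun_prop)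
  refine (isCompact_univ_pi fun _ : Fin p => isCompact_univ_pi fun _ : Fin p =>
    isCompact_Icc (a := (-1 : ℝ)) (b := 1)).of_isClosed_subset hcl ?_
  intro U hU
  simp only [Set.mem_pi, Set.mem_univ, true_imp_iff, Set.mem_Icc]
  intro k i
  exact abs_le.1 ((sq_le_one_iff_abs_le_one _).1 (sq_le_one_of_sum (sum_row_sq hU.1 k) i))

/-- Every orthogonal matrix can be moved to `domMat` by a signed permutation of its rows. -/
lemma exists_signedPerm_mem_domMat {p : ℕ} {V : Matrix (Fin p) (Fin p) ℝ} (hV : V * Vᵀ = 1) :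
    ∃ (σ : Equiv.Perm (Fin p)) (s : Fin p → ℤˣ),
      (fun i j => ((s i : ℤ) : ℝ) * V (σ i) j) ∈ domMat p := by
  -- There are finitely many signed permutations; the one giving the largest trace works, because
  -- they are closed under composition.
  obtain ⟨⟨σ, s⟩, hmax⟩ := Finite.exists_max
    (fun q : Equiv.Perm (Fin p) × (Fin p → ℤˣ) => ∑ i, ((q.2 i : ℤ) : ℝ) * V (q.1 i) i)
  refine ⟨σ, s, ?_, fun τ r => ?_⟩
  · ext i j
    have h1 := congrFun (congrFun hV (σ i)) (σ j)
    simp only [Matrix.mul_apply, Matrix.transpose_apply] at h1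
    have h2 : (Matrix.of (fun i j => ((s i : ℤ) : ℝ) * V (σ i) j) *
        (Matrix.of (fun i j => ((s i : ℤ) : ℝ) * V (σ i) j))ᵀ) i j
        = ((s i : ℤ) : ℝ) * (s j : ℤ) * ∑ x, V (σ i) x * V (σ j) x := by
      simp only [Matrix.mul_apply, Matrix.transpose_apply, Matrix.of_apply, Finset.mul_sum]
      exact Finset.sum_congr rfl fun x _ => by ring
    rw [h2, h1]
    by_cases hij : i = j
    · subst hij; simpa [sq] using intUnits_cast_sq (s i)
    · simp [hij]
  · have := hmax (τ.trans σ, fun i => r i * s (τ i))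
    refine le_trans (le_of_eq ?_) this
    refine Finset.sum_congr rfl fun i _ => ?_
    simp [mul_assoc]

/-- The only matrix in `domMat` with entries `0` and `±1` is the identity. -/
lemma eq_one_of_mem_domMat {p : ℕ} {U : Matrix (Fin p) (Fin p) ℝ} (hU : U ∈ domMat p)
    (h01 : ∀ k i, U k i ^ 2 = 0 ∨ U k i ^ 2 = 1) : U = 1 := by
  have hr := sum_row_sq (U := U) hU.1
  have hc := sum_col_sq (U := U) hU.1
  have hex : ∀ i, ∃ k, U k i ^ 2 = 1 := by
    intro i
    by_contra! hne
    have : ∑ k, U k i ^ 2 = 0 := Finset.sum_eq_zero fun k _ => (h01 k i).resolve_right (hne k)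
    rw [hc] at this; exact one_ne_zero this
  choose σ hσ using hex
  have hoff : ∀ k i j, i ≠ j → U k i ^ 2 = 1 → U k j ^ 2 = 0 := by
    intro k i j hij h1
    have := Finset.add_le_sum (f := fun i => U k i ^ 2) (s := Finset.univ)
      (fun j _ => sq_nonneg (U k j)) (Finset.mem_univ i) (Finset.mem_univ j) hij
    simp only [hr] at this
    have h2 := sq_nonneg (U k j)
    linarith
  have hinj : Function.Injective σ := by
    intro i j hij
    by_contra hne
    have h1 := hoff _ _ _ hne (hσ i)
    rw [hij, hσ j] at h1
    exact one_ne_zero h1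
  have hsgn : ∀ i, ∃ s : ℤˣ, ((s : ℤ) : ℝ) * U (σ i) i = 1 := by
    intro i
    rcases mul_self_eq_one_iff.1 ((sq _).symm.trans (hσ i)) with h | h
    · exact ⟨1, by simp [h]⟩
    · exact ⟨-1, by simp [h]⟩
  choose s hs using hsgn
  -- The signed permutation that undoes U has trace p, so the trace of U is at least p; as the
  -- diagonal entries are at most 1, all of them equal 1.
  have h1 := hU.2 (Equiv.ofBijective σ (Finite.injective_iff_bijective.1 hinj)) s
  simp only [Equiv.ofBijective_apply, hs] at h1
  have hle : ∀ i, U i i ≤ 1 := fun i =>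
    (abs_le.1 ((sq_le_one_iff_abs_le_one _).1 (sq_le_one_of_sum (hr i) i))).2
  have hd : ∀ i, U i i = 1 := by
    have := (Finset.sum_eq_sum_iff_of_le (s := Finset.univ) fun i _ => hle i).1
      (le_antisymm (Finset.sum_le_sum fun i _ => hle i) h1)
    exact fun i => this i (Finset.mem_univ i)
  ext k i
  by_cases hki : k = i
  · subst hki; simp [hd]
  · rw [Matrix.one_apply_ne hki]
    exact pow_eq_zero_iff two_ne_zero |>.1 (hoff k k i hki (by simp [hd]))

/-- The identity is the only maximizer in `domMat` of the population index. -/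
lemma eq_one_of_index_le {p : ℕ} {α : ℝ} (h0 : 0 ≤ α) (h1 : α ≤ 1) {a b : Fin p → ℝ}
    (hw : ∀ k l, α * a k ^ 2 + (1 - α) * b k ^ 2 = 0 → α * a l ^ 2 + (1 - α) * b l ^ 2 = 0 → k = l)
    {U : Matrix (Fin p) (Fin p) ℝ} (hU : U ∈ domMat p)
    (hle : α * ∑ k, a k ^ 2 + (1 - α) * ∑ k, b k ^ 2 ≤
      α * ∑ k, (∑ i, U k i ^ 3 * a i) ^ 2 + (1 - α) * ∑ k, (∑ i, U k i ^ 4 * b i) ^ 2) :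
    U = 1 := by
  have hr := sum_row_sq (U := U) hU.1
  have hc := sum_col_sq (U := U) hU.1
  set w : Fin p → ℝ := fun i => α * a i ^ 2 + (1 - α) * b i ^ 2 with hwdef
  have hw0 : ∀ i, 0 ≤ w i := fun i => by
    have : 0 ≤ 1 - α := by linarith
    positivity
  set q : Fin p → ℝ := fun i => ∑ k, U k i ^ 4 with hq
  have hq1 : ∀ i, q i ≤ 1 := fun i => sum_pow_four_le_one (hc i)
  have e1 : ∑ k, (∑ i, U k i ^ 3 * a i) ^ 2 ≤ ∑ i, q i * a i ^ 2 := by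
    calc _ ≤ ∑ k, ∑ i, U k i ^ 4 * a i ^ 2 :=
          Finset.sum_le_sum fun k _ => sum_cube_mul_sq_le (hr k) a
      _ = _ := by rw [Finset.sum_comm]; simp only [hq, Finset.sum_mul]
  have e2 : ∑ k, (∑ i, U k i ^ 4 * b i) ^ 2 ≤ ∑ i, q i * b i ^ 2 := by
    calc _ ≤ ∑ k, ∑ i, U k i ^ 4 * b i ^ 2 :=
          Finset.sum_le_sum fun k _ => sum_pow_four_mul_sq_le (hr k) b
      _ = _ := by rw [Finset.sum_comm]; simp only [hq, Finset.sum_mul]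
  -- The index at U is at most ∑ wᵢqᵢ and at least ∑ wᵢ, while wᵢ ≥ 0 and qᵢ ≤ 1, so every term wᵢ(1
  -- - qᵢ) vanishes.
  have e3 : ∑ i, w i * (1 - q i) ≤ 0 := by
    have : ∑ i, w i * (1 - q i) = α * ∑ k, a k ^ 2 + (1 - α) * ∑ k, b k ^ 2 -
        (α * ∑ i, q i * a i ^ 2 + (1 - α) * ∑ i, q i * b i ^ 2) := by
      simp only [Finset.mul_sum, ← Finset.sum_add_distrib, ← Finset.sum_sub_distrib]
      exact Finset.sum_congr rfl fun i _ => by simp only [hwdef]; ring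
    have f1 := mul_le_mul_of_nonneg_left e1 h0
    have f2 := mul_le_mul_of_nonneg_left e2 (sub_nonneg.2 h1)
    linarith
  have hz : ∀ i, w i = 0 ∨ q i = 1 := by
    have hn : ∀ i ∈ Finset.univ, 0 ≤ w i * (1 - q i) := fun i _ =>
      mul_nonneg (hw0 i) (by linarith [hq1 i])
    intro i
    have := (Finset.sum_eq_zero_iff_of_nonneg hn).1
      (le_antisymm e3 (Finset.sum_nonneg hn)) i (Finset.mem_univ i)
    rcases mul_eq_zero.1 this with h | h
    · exact .inl h
    · exact .inr (by linarith)
  -- Equality in the fourth power bound: ∑ₖ Uₖᵢ²(1 - Uₖᵢ²) = 1 - qᵢ = 0 with nonnegative terms.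
  have hcol : ∀ i, q i = 1 → ∀ k, U k i ^ 2 = 0 ∨ U k i ^ 2 = 1 := by
    intro i hi k
    have hn : ∀ k ∈ Finset.univ, 0 ≤ U k i ^ 2 * (1 - U k i ^ 2) := fun k _ =>
      mul_nonneg (sq_nonneg _) (by linarith [sq_le_one_of_sum (hc i) k])
    have hs : ∑ k, U k i ^ 2 * (1 - U k i ^ 2) = 0 := by
      have : ∑ k, U k i ^ 2 * (1 - U k i ^ 2) = ∑ k, U k i ^ 2 - q i := by
        rw [hq, ← Finset.sum_sub_distrib]
        exact Finset.sum_congr rfl fun i _ => by ring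
      rw [this, hc, hi, sub_self]
    rcases mul_eq_zero.1 ((Finset.sum_eq_zero_iff_of_nonneg hn).1 hs k (Finset.mem_univ k))
      with h | h
    · exact .inl h
    · exact .inr (by linarith)
  refine eq_one_of_mem_domMat hU fun k i => ?_
  -- The one column whose weight may vanish is settled by the rows: the other squared entries of row
  -- k are 0 or 1 and the row has norm one.
  rcases hz i with hi | hi
  · have hoth : ∀ j, j ≠ i → U k j ^ 2 = 0 ∨ U k j ^ 2 = 1 := fun j hj =>
      hcol j ((hz j).resolve_left fun h => hj (hw j i h hi)) k
    by_cases hex : ∃ j, j ≠ i ∧ U k j ^ 2 = 1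
    · obtain ⟨j, hj, hj1⟩ := hex
      have := Finset.add_le_sum (f := fun i => U k i ^ 2) (s := Finset.univ)
        (fun j _ => sq_nonneg (U k j)) (Finset.mem_univ i) (Finset.mem_univ j) hj.symm
      simp only [hr, hj1] at this
      exact .inl (le_antisymm (by linarith) (sq_nonneg _))
    · push Not at hex
      have := hr k
      rw [Finset.sum_eq_single i (fun j _ hj => (hoth j hj).resolve_right (hex j hj))
        (by simp)] at this
      exact .inr this
  · exact hcol i hi k

/-! ### Moments of the population -/

/-- Mutually independent random variables with mean `0` and variance `1`. -/
structure IsIndepStd {Ω : Type*} [MeasurableSpace Ω] {p : ℕ} (X : Fin p → Ω → ℝ)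
    (P : Measure Ω) : Prop where
  meas : ∀ k, Measurable (X k)
  indep : iIndepFun X P
  mean : ∀ k, ∫ ω, X k ω ∂P = 0
  var : ∀ k, ∫ ω, X k ω ^ 2 ∂P = 1

/-- The moments of a random vector. -/
def popMoments {Ω : Type*} [MeasurableSpace Ω] {p : ℕ} (c : ℝ) (X : Fin p → Ω → ℝ)
    (P : Measure Ω) (j : MIdx p) : ℝ :=
  ∫ ω, monom c (fun k => X k ω) j ∂P

lemma holderTriple_four : ENNReal.HolderTriple 4 4 2 := ⟨by
  rw [← ENNReal.toReal_eq_toReal_iff' (by simp) (by simp), ENNReal.toReal_add (by simp) (by simp)]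
  norm_num⟩

lemma holderTriple_six : ENNReal.HolderTriple 6 6 3 := ⟨by
  rw [← ENNReal.toReal_eq_toReal_iff' (by simp) (by simp), ENNReal.toReal_add (by simp) (by simp)]
  norm_num⟩

lemma holderTriple_six_three : ENNReal.HolderTriple 6 3 2 := ⟨by
  rw [← ENNReal.toReal_eq_toReal_iff' (by simp) (by simp), ENNReal.toReal_add (by simp) (by simp)]
  norm_num⟩

lemma holderTriple_eight : ENNReal.HolderTriple 8 8 4 := ⟨by
  rw [← ENNReal.toReal_eq_toReal_iff' (by simp) (by simp), ENNReal.toReal_add (by simp) (by simp)]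
  norm_num⟩

lemma holderTriple_two : ENNReal.HolderTriple 2 2 1 := ⟨by
  rw [← ENNReal.toReal_eq_toReal_iff' (by simp) (by simp), ENNReal.toReal_add (by simp) (by simp)]
  norm_num⟩

section Population

variable {Ω : Type*} [MeasurableSpace Ω] {P : Measure Ω} [IsProbabilityMeasure P] {p : ℕ}
  {X : Fin p → Ω → ℝ}

lemma memLp_aug {q : ℝ≥0∞} (h : ∀ k, MemLp (X k) q P) (a : Option (Fin p)) :
    MemLp (fun ω => aug (fun k => X k ω) a) q P := by
  cases a with
  | none => exact memLp_const 1
  | some k => exact h k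

lemma integrable_monom (h4 : ∀ k, MemLp (X k) 4 P) (c : ℝ) (j : MIdx p) :
    Integrable (fun ω => monom c (fun k => X k ω) j) P := by
  have h := memLp_aug h4
  have t1 := holderTriple_four
  have t2 := holderTriple_two
  have h2 : ∀ a b, MemLp (fun ω => aug (fun k => X k ω) a * aug (fun k => X k ω) b) 2 P :=
    fun a b => (h b).mul' (h a)
  have h4' : ∀ a b d e, Integrable (fun ω => (aug (fun k => X k ω) a * aug (fun k => X k ω) b) *
      (aug (fun k => X k ω) d * aug (fun k => X k ω) e)) P :=
    fun a b d e => memLp_one_iff_integrable.1 ((h2 d e).mul' (h2 a b))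
  rcases j with ⟨a, b, d⟩ | ⟨a, b, d, e⟩
  · simpa [monom, mul_assoc] using h4' a b d none
  · simpa [monom, mul_assoc] using (h4' a b d e).const_mul c

/-- Hölder: three factors in L⁶ or four in L⁸ have their product in L². With c = 0 the second kind
of monomial is zero, and sixth moments suffice. -/
lemma memLp_two_monom (h6 : ∀ k, MemLp (X k) 6 P) {c : ℝ} (hc : c = 0 ∨ ∀ k, MemLp (X k) 8 P)
    (j : MIdx p) : MemLp (fun ω => monom c (fun k => X k ω) j) 2 P := by
  rcases j with ⟨a, b, d⟩ | ⟨a, b, d, e⟩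
  · have t1 := holderTriple_six
    have t2 := holderTriple_six_three
    have h := memLp_aug h6
    simpa [monom, mul_assoc] using ((h d).mul' (h b) : MemLp _ 3 P).mul' (h a)
  · rcases hc with rfl | h8
    · simp [monom]
    · have t1 := holderTriple_eight
      have t2 := holderTriple_four
      have h := memLp_aug h8
      have := (((h e).mul' (h d) : MemLp _ 4 P).mul' ((h b).mul' (h a) : MemLp _ 4 P)
        : MemLp _ 2 P).const_mul c
      simpa [monom, mul_assoc] using this

omit [IsProbabilityMeasure P] in
lemma triple_popMoments {c : ℝ} (hi : ∀ j, Integrable (fun ω => monom c (fun k => X k ω) j) P)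
    (u v w : Option (Fin p) → ℝ) : triple u v w (popMoments c X P) =
      ∫ ω, affine u (fun k => X k ω) * affine v (fun k => X k ω) * affine w (fun k => X k ω) ∂P := by
  simp only [← triple_monom u v w c]
  simp only [triple, popMoments]
  rw [integral_finsetSum _ fun a _ => integrable_finsetSum _ fun b _ =>
    integrable_finsetSum _ fun d _ => (hi _).const_mul _]
  refine Finset.sum_congr rfl fun a _ => ?_
  rw [integral_finsetSum _ fun b _ => integrable_finsetSum _ fun d _ => (hi _).const_mul _]
  refine Finset.sum_congr rfl fun b _ => ?_
  rw [integral_finsetSum _ fun d _ => (hi _).const_mul _]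
  exact Finset.sum_congr rfl fun d _ => (integral_const_mul _ _).symm

omit [IsProbabilityMeasure P] in
lemma quadruple_popMoments {c : ℝ} (hi : ∀ j, Integrable (fun ω => monom c (fun k => X k ω) j) P)
    (u v w y : Option (Fin p) → ℝ) : quadruple u v w y (popMoments c X P) =
      c * ∫ ω, affine u (fun k => X k ω) * affine v (fun k => X k ω) * affine w (fun k => X k ω) *
        affine y (fun k => X k ω) ∂P := by
  rw [← integral_const_mul]
  simp only [← quadruple_monom u v w y c]
  simp only [quadruple, popMoments]
  rw [integral_finsetSum _ fun a _ => integrable_finsetSum _ fun b _ =>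
    integrable_finsetSum _ fun d _ => integrable_finsetSum _ fun e _ => (hi _).const_mul _]
  refine Finset.sum_congr rfl fun a _ => ?_
  rw [integral_finsetSum _ fun b _ => integrable_finsetSum _ fun d _ =>
    integrable_finsetSum _ fun e _ => (hi _).const_mul _]
  refine Finset.sum_congr rfl fun b _ => ?_
  rw [integral_finsetSum _ fun d _ => integrable_finsetSum _ fun e _ => (hi _).const_mul _]
  refine Finset.sum_congr rfl fun d _ => ?_
  rw [integral_finsetSum _ fun e _ => (hi _).const_mul _]
  exact Finset.sum_congr rfl fun e _ => (integral_const_mul _ _).symm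

omit [IsProbabilityMeasure P] in
lemma popMoments_coord (hX : IsIndepStd X P) (c : ℝ) (i : Fin p) :
    popMoments c X P (.inl (none, none, some i)) = 0 := by
  simpa [popMoments, monom] using hX.mean i

omit [IsProbabilityMeasure P] in
lemma affine_coef_popMoments (hX : IsIndepStd X P) (c : ℝ) (U : Fin p → Fin p → ℝ) (k : Fin p)
    (x : Fin p → ℝ) : affine (coef U (popMoments c X P) k) x = ∑ i, U k i * x i := by
  simp [affine, coef, popMoments_coord hX, Fintype.sum_option]

omit [IsProbabilityMeasure P] in
lemma integral_mul_eq_one_apply (hX : IsIndepStd X P) (k l : Fin p) :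
    ∫ ω, X k ω * X l ω ∂P = (1 : Matrix (Fin p) (Fin p) ℝ) k l := by
  by_cases hkl : k = l
  · subst hkl; simpa [sq] using hX.var k
  · rw [(hX.indep.indepFun hkl).integral_fun_mul_eq_mul_integral
      (hX.meas k).aestronglyMeasurable (hX.meas l).aestronglyMeasurable, hX.mean,
      Matrix.one_apply_ne hkl, zero_mul]

lemma covF_one_popMoments (hX : IsIndepStd X P) (h4 : ∀ k, MemLp (X k) 4 P) (c : ℝ)
    (k l : Fin p) : covF (1 : Matrix (Fin p) (Fin p) ℝ) (popMoments c X P) k l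
      = (1 : Matrix (Fin p) (Fin p) ℝ) k l := by
  unfold covF
  rw [triple_popMoments (integrable_monom h4 c), ← integral_mul_eq_one_apply hX k l]
  refine integral_congr_ae (ae_of_all _ fun ω => ?_)
  have h : ∀ k, affine (coef (1 : Matrix (Fin p) (Fin p) ℝ) (popMoments c X P) k)
      (fun k => X k ω) = X k ω := fun k => by
    refine (affine_coef_popMoments hX c (1 : Matrix (Fin p) (Fin p) ℝ) k _).trans ?_
    simp [Matrix.one_apply]
  simp [h]

/-- Cumulants of order r are additive over independent summands and homogeneous of degree r; the
unit norm of u makes the variance one. -/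
lemma moments_linear_combination (hX : IsIndepStd X P) (h4 : ∀ k, MemLp (X k) 4 P)
    {u : Fin p → ℝ} (hu : ∑ i, u i ^ 2 = 1) :
    ∫ ω, (∑ i, u i * X i ω) ^ 3 ∂P = ∑ i, u i ^ 3 * gam P (X i) ∧
    ∫ ω, (∑ i, u i * X i ω) ^ 4 ∂P - 3 = ∑ i, u i ^ 4 * kap P (X i) := by
  have hind : iIndepFun (fun i ω => u i * X i ω) P :=
    hX.indep.comp (fun i x => u i * x) fun i => by fun_prop
  obtain ⟨-, -, -, h3, h5⟩ := moments_sum_of_iIndepFun hind (fun i => (hX.meas i).const_mul _)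
    (fun i => (h4 i).const_mul _) (fun i => by rw [integral_const_mul, hX.mean, mul_zero])
    Finset.univ
  simp only [mul_pow, integral_const_mul, hX.var, mul_one, hu] at h3 h5
  refine ⟨by rw [h3]; rfl, ?_⟩
  rw [h5]
  simp only [kap, moment, Pi.pow_apply]
  rw [one_pow, mul_one, add_sub_cancel_left]
  exact Finset.sum_congr rfl fun i _ => by ring

lemma indexF_popMoments (hX : IsIndepStd X P) (h4 : ∀ k, MemLp (X k) 4 P) (α : ℝ)
    {U : Fin p → Fin p → ℝ} (hU : ∀ k, ∑ i, U k i ^ 2 = 1) :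
    indexF α U (popMoments 1 X P) = α * ∑ k, (∑ i, U k i ^ 3 * gam P (X i)) ^ 2
      + (1 - α) * ∑ k, (∑ i, U k i ^ 4 * kap P (X i)) ^ 2 := by
  have h := fun k => moments_linear_combination hX h4 (hU k)
  have hi := integrable_monom h4 1
  have h3 : ∀ k, thirdF U (popMoments 1 X P) k k = ∑ i, U k i ^ 3 * gam P (X i) := fun k => by
    rw [← (h k).1, thirdF, triple_popMoments hi]
    simp only [affine_coef_popMoments hX, pow_succ, pow_zero, one_mul]
  have h4 : ∀ k, fourthF U (popMoments 1 X P) k k - 3 = ∑ i, U k i ^ 4 * kap P (X i) := fun k => by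
    rw [← (h k).2, fourthF, quadruple_popMoments hi, one_mul]
    simp only [affine_coef_popMoments hX, pow_succ, pow_zero, one_mul]
  simp only [indexF, h3, h4]

end Population

/-! ### Existence of a consistent sequence of solutions -/

lemma measurable_sampleMoments {p n : ℕ} (c : ℝ) :
    Measurable fun x : Fin n → Fin p → ℝ => sampleMoments c x := by
  have h : ∀ (i : Fin n) (a : Option (Fin p)), Measurable fun x : Fin n → Fin p → ℝ =>
      aug (x i) a := by
    intro i a
    cases a <;> simp only [aug_none, aug_some] <;> fun_prop
  refine measurable_pi_lambda _ fun j => ?_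
  rcases j with ⟨a, b, d⟩ | ⟨a, b, d, e⟩ <;>
    simp only [sampleMoments, avg, monom, Sum.elim_inl, Sum.elim_inr] <;> fun_prop

lemma covF_one_sampleMoments {p n : ℕ} (c : ℝ) (x : Fin n → Fin p → ℝ) :
    covF (1 : Matrix (Fin p) (Fin p) ℝ) (sampleMoments c x) = covMat (empirical x) := by
  ext k l
  rw [covF_sampleMoments]
  simp

/-- Signs disappear in the squared third moments and in the fourth moments, and a permutation only
reorders the sums. -/
lemma sampleIndex_signedPerm {p n : ℕ} (α : ℝ) (x : Fin n → Fin p → ℝ)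
    (V G : Matrix (Fin p) (Fin p) ℝ) (σ : Equiv.Perm (Fin p)) (s : Fin p → ℤˣ) :
    sampleIndex α x (Matrix.of (fun i j => ((s i : ℤ) : ℝ) * V (σ i) j) * G)
      = sampleIndex α x (V * G) := by
  have hrow : ∀ k i, (Matrix.of (fun i j => ((s i : ℤ) : ℝ) * V (σ i) j) * G) k ⬝ᵥ ctr x i
      = ((s k : ℤ) : ℝ) * ((V * G) (σ k) ⬝ᵥ ctr x i) := by
    intro k i
    have : (Matrix.of (fun i j => ((s i : ℤ) : ℝ) * V (σ i) j) * G) k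
        = ((s k : ℤ) : ℝ) • (V * G) (σ k) := by
      ext j
      simp [Matrix.mul_apply, Finset.mul_sum, mul_assoc]
    rw [this, smul_dotProduct, smul_eq_mul]
  have h2 := fun k => intUnits_cast_sq (s k)
  simp only [sampleIndex, hrow, mul_pow, avg_mul_left]
  congr 2
  · rw [← Equiv.sum_comp σ fun k => (avg fun i => ((V * G) k ⬝ᵥ ctr x i) ^ 3) ^ 2]
    refine Finset.sum_congr rfl fun k _ => ?_
    rw [← pow_mul, show 3 * 2 = 2 * 3 by norm_num, pow_mul, h2, one_pow, one_mul]
  · rw [← Equiv.sum_comp σ fun k => ((avg fun i => ((V * G) k ⬝ᵥ ctr x i) ^ 4) - 3) ^ 2]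
    refine Finset.sum_congr rfl fun k _ => ?_
    have h4 : ((s k : ℤ) : ℝ) ^ 4 = 1 := by
      rw [show (4 : ℕ) = 2 * 2 by norm_num, pow_mul, h2, one_pow]
    rw [h4, one_mul]

lemma posSemidef_covMat_empirical {p n : ℕ} (x : Fin n → Fin p → ℝ) :
    (covMat (empirical x)).PosSemidef := by
  refine Matrix.PosSemidef.of_dotProduct_mulVec_nonneg ?_ fun v => ?_
  · ext i j
    simp [covMat_empirical, mul_comm]
  · rw [star_trivial, ← avg_dotProduct_mul]
    exact mul_nonneg (by positivity) (Finset.sum_nonneg fun i _ => mul_self_nonneg _)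

lemma measurable_monom {p : ℕ} (c : ℝ) (j : MIdx p) :
    Measurable fun x : Fin p → ℝ => monom c x j := by
  have h : ∀ a : Option (Fin p), Measurable fun x : Fin p → ℝ => aug x a := by
    intro a
    cases a <;> simp only [aug_none, aug_some] <;> fun_prop
  rcases j with ⟨a, b, d⟩ | ⟨a, b, d, e⟩ <;> simp only [monom, Sum.elim_inl, Sum.elim_inr] <;>
    fun_prop

/-- The strong law for each of the finitely many monomials. -/
lemma tendsto_sampleMoments {Ω : Type*} [MeasurableSpace Ω] {P : Measure Ω}
    [IsProbabilityMeasure P] {p : ℕ} {z : ℕ → Ω → Fin p → ℝ}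
    (hindep : iIndepFun z P) (hident : ∀ i, IdentDistrib (z i) (z 0) P P) {c : ℝ}
    (hi : ∀ j, Integrable (fun ω => monom c (fun k => comp z k ω) j) P) :
    ∀ᵐ ω ∂P, Tendsto (fun n => sampleMoments c (sample z n ω)) atTop
      (𝓝 (popMoments c (comp z) P)) := by
  have h : ∀ j : MIdx p, ∀ᵐ ω ∂P, Tendsto
      (fun n : ℕ => (∑ i ∈ Finset.range n, monom c (z i ω) j) / n) atTop
      (𝓝 (popMoments c (comp z) P j)) := fun j =>
    strong_law_ae_real (fun i ω => monom c (z i ω) j) (hi j)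
      (fun i k hik => (hindep.indepFun hik).comp (measurable_monom c j) (measurable_monom c j))
      (fun i => (hident i).comp (measurable_monom c j))
  filter_upwards [ae_all_iff.2 h] with ω hω
  refine tendsto_pi_nhds.2 fun j => ?_
  refine (hω j).congr fun n => ?_
  rw [sampleMoments, avg, ← Fin.sum_univ_eq_sum_range (fun i => monom c (z i ω) j), div_eq_inv_mul]
  rfl

/-- The index of weight `α` distinguishes all but at most one component. -/
def Separates {Ω : Type*} [MeasurableSpace Ω] {p : ℕ} (α : ℝ) (X : Fin p → Ω → ℝ)
    (P : Measure Ω) : Prop :=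
  ∀ k l, α * gam P (X k) ^ 2 + (1 - α) * kap P (X k) ^ 2 = 0 →
    α * gam P (X l) ^ 2 + (1 - α) * kap P (X l) ^ 2 = 0 → k = l

lemma tendsto_indexF {ι : Type*} {L : Filter ι} {p : ℕ} (α : ℝ) {A : ι → Fin p → Fin p → ℝ}
    {B : Fin p → Fin p → ℝ} {m : ι → MIdx p → ℝ} {m₀ : MIdx p → ℝ} (hA : Tendsto A L (𝓝 B))
    (hm : Tendsto m L (𝓝 m₀)) :
    Tendsto (fun i => indexF α (A i) (m i)) L (𝓝 (indexF α B m₀)) := by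
  have h1 := (continuous_indexF (p := p) α).tendsto (B, m₀)
  have h2 := h1.comp (hA.prodMk_nhds hm)
  exact h2

lemma tendsto_covF {ι : Type*} {L : Filter ι} {p : ℕ} (A : Fin p → Fin p → ℝ)
    {m : ι → MIdx p → ℝ} {m₀ : MIdx p → ℝ} (hm : Tendsto m L (𝓝 m₀)) (k l : Fin p) :
    Tendsto (fun i => covF A (m i) k l) L (𝓝 (covF A m₀ k l)) := by
  have h1 := (continuous_covF k l).tendsto (A, m₀)
  have h2 := h1.comp ((tendsto_const_nhds (x := A)).prodMk_nhds hm)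
  exact h2

lemma measurable_covF {p n : ℕ} (A : Fin p → Fin p → ℝ) (c : ℝ) :
    Measurable fun x : Fin n → Fin p → ℝ => covF A (sampleMoments c x) := by
  refine measurable_pi_lambda _ fun k => measurable_pi_lambda _ fun l => ?_
  have h1 := (continuous_covF k l).measurable
  have h2 := h1.comp ((measurable_const (a := A)).prodMk (measurable_sampleMoments (n := n) c))
  exact h2

lemma measurable_indexF {p n : ℕ} (α c : ℝ) {A : (Fin n → Fin p → ℝ) → Fin p → Fin p → ℝ}
    (hA : Measurable A) : Measurable fun x => indexF α (A x) (sampleMoments c x) := by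
  have h1 := (continuous_indexF (p := p) α).measurable
  have h2 := h1.comp (hA.prodMk (measurable_sampleMoments c))
  exact h2

/-- Maximizers of indices which converge to the population index converge to the identity. -/
lemma tendsto_one_of_isMax {Ω : Type*} [MeasurableSpace Ω] {P : Measure Ω}
    [IsProbabilityMeasure P] {p : ℕ} {X : Fin p → Ω → ℝ} (hX : IsIndepStd X P)
    (h4 : ∀ k, MemLp (X k) 4 P) {α : ℝ} (h0 : 0 ≤ α) (h1 : α ≤ 1) (hsep : Separates α X P)
    {m : ℕ → MIdx p → ℝ} (hm : Tendsto m atTop (𝓝 (popMoments 1 X P)))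
    {G U : ℕ → Matrix (Fin p) (Fin p) ℝ} (hG : Tendsto G atTop (𝓝 1))
    (hU : ∀ᶠ n in atTop, U n ∈ domMat p)
    (hmax : ∀ᶠ n in atTop, indexF α (1 * G n) (m n) ≤ indexF α (U n * G n) (m n)) :
    Tendsto U atTop (𝓝 1) := by
  -- By compactness it suffices to identify cluster points. Along an ultrafilter the comparison with
  -- the identity passes to the limit, where I is the only matrix of `domMat` with so large an
  -- index.
  refine (isCompact_domMat p).tendsto_nhds_of_unique_mapClusterPt hU fun V hV hcl => ?_
  obtain ⟨F, hF, hFV⟩ := mapClusterPt_iff_ultrafilter.1 hcl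
  have hlim : ∀ {A : ℕ → Matrix (Fin p) (Fin p) ℝ} {B : Matrix (Fin p) (Fin p) ℝ},
      Tendsto A F (𝓝 B) → Tendsto (fun n => indexF α (A n * G n) (m n)) F
        (𝓝 (indexF α B (popMoments 1 X P))) := by
    intro A B hA
    have hc : Tendsto (fun n => A n * G n) F (𝓝 B) := by
      have := hA.mul (hG.mono_left hF)
      rwa [mul_one] at this
    exact tendsto_indexF α hc (hm.mono_left hF)
  have hle : indexF α (1 : Matrix (Fin p) (Fin p) ℝ) (popMoments 1 X P) ≤
      indexF α V (popMoments 1 X P) :=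
    le_of_tendsto_of_tendsto (hlim tendsto_const_nhds) (hlim hFV) (hF hmax)
  have hrow1 : ∀ k, ∑ i, (1 : Matrix (Fin p) (Fin p) ℝ) k i ^ 2 = 1 :=
    sum_row_sq (by simp)
  have e1 := indexF_popMoments hX h4 α hrow1
  have e2 := indexF_popMoments hX h4 α (U := V) (sum_row_sq (U := V) hV.1)
  have hle' := (e1.symm.le.trans hle).trans e2.le
  refine eq_one_of_index_le h0 h1 hsep (U := V) hV (le_trans (le_of_eq ?_) hle')
  simp [Matrix.one_apply]

/-- Covariances involve only the monomials of the first kind, which do not carry c, so every c is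
allowed. -/
lemma tendsto_covMat_empirical {Ω ι : Type*} [MeasurableSpace Ω] {P : Measure Ω}
    [IsProbabilityMeasure P] {p : ℕ} {X : Fin p → Ω → ℝ} (hX : IsIndepStd X P)
    (h4 : ∀ k, MemLp (X k) 4 P) {c : ℝ} {L : Filter ι} {n : ι → ℕ}
    {x : (i : ι) → Fin (n i) → Fin p → ℝ}
    (hx : Tendsto (fun i => sampleMoments c (x i)) L (𝓝 (popMoments c X P))) :
    Tendsto (fun i => covMat (empirical (x i))) L (𝓝 1) := by
  refine tendsto_pi_nhds.2 fun k => tendsto_pi_nhds.2 fun l => ?_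
  have := tendsto_covF (1 : Matrix (Fin p) (Fin p) ℝ) hx k l
  rw [covF_one_popMoments hX h4] at this
  exact this.congr fun i => congrFun (congrFun (covF_one_sampleMoments c (x i)) k) l

/-- The estimator is U G, where G is the inverse root of the sample covariance matrix and U a
measurably chosen maximizer over `domMat`. The restriction to `domMat` loses no value of the index,
and it rules out the other signed permutations of the limit. -/
theorem exists_consistent {Ω : Type*} [MeasurableSpace Ω] {P : Measure Ω}
    [IsProbabilityMeasure P] {p : ℕ} {z : ℕ → Ω → Fin p → ℝ} (hmeas : ∀ i, Measurable (z i))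
    (hindep : iIndepFun z P) (hident : ∀ i, IdentDistrib (z i) (z 0) P P)
    (hX : IsIndepStd (comp z) P) (h4 : ∀ k, MemLp (comp z k) 4 P) {α : ℝ} (h0 : 0 ≤ α)
    (h1 : α ≤ 1) (hsep : Separates α (comp z) P) :
    ∃ W, IsSolutionSeq α W ∧ IsConsistent P z W := by
  have : CompactSpace (domMat p) := isCompact_iff_compactSpace.1 (isCompact_domMat p)
  have : Nonempty (domMat p) := ⟨⟨_, one_mem_domMat p⟩⟩
  obtain ⟨H, hH, hHinv⟩ := exists_measurable_invSqrt p
  -- the inverse square root of the sample covariance matrix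
  let G : (n : ℕ) → (Fin n → Fin p → ℝ) → Fin p → Fin p → ℝ := fun n x =>
    H (covF (1 : Matrix (Fin p) (Fin p) ℝ) (sampleMoments 1 x))
  have hGm : ∀ n, Measurable (G n) := fun n => hH.comp (measurable_covF _ 1)
  have hGm' : ∀ n k l, Measurable fun x => G n x k l := fun n k l =>
    (measurable_pi_apply l).comp ((measurable_pi_apply k).comp (hGm n))
  have hGinv : ∀ {n} (x : Fin n → Fin p → ℝ), (covMat (empirical x)).PosDef →
      Matrix.of (G n x) = invSqrt (covMat (empirical x)) := by
    intro n x hA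
    have := hHinv _ hA
    rwa [← covF_one_sampleMoments 1 x] at this ⊢
  let h : (n : ℕ) → (Fin n → Fin p → ℝ) → domMat p → ℝ := fun n x U =>
    indexF α (fun k l => ∑ j, (U : Fin p → Fin p → ℝ) k j * G n x j l) (sampleMoments 1 x)
  have hsel := fun n => exists_measurable_argmax (h n)
    (fun U => by
      refine measurable_indexF α 1 ?_
      refine measurable_pi_lambda _ fun k => measurable_pi_lambda _ fun l => ?_
      have := fun j => hGm' n j l
      fun_prop)
    (fun x => by
      refine continuous_iff_continuousAt.2 fun U => tendsto_indexF α ?_ tendsto_const_nhds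
      refine Continuous.tendsto ?_ U
      refine continuous_pi fun k => continuous_pi fun l => ?_
      refine continuous_finsetSum _ fun j _ => Continuous.mul ?_ continuous_const
      exact (continuous_apply j).comp ((continuous_apply k).comp continuous_subtype_val))
  choose s hsm hsmax using hsel
  let W : (n : ℕ) → (Fin n → Fin p → ℝ) → Matrix (Fin p) (Fin p) ℝ := fun n x =>
    Matrix.of (s n x : Fin p → Fin p → ℝ) * Matrix.of (G n x)
  have hindex : ∀ {n} (x : Fin n → Fin p → ℝ) (U : Matrix (Fin p) (Fin p) ℝ) (hU : U ∈ domMat p),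
      h n x ⟨U, hU⟩ = sampleIndex α x (U * Matrix.of (G n x)) := by
    intro n x U hU
    rw [← indexF_sampleMoments]
    rfl
  have hWm : ∀ n k l, Measurable fun x => W n x k l := by
    intro n k l
    have h1 : ∀ j, Measurable fun x => (s n x : Fin p → Fin p → ℝ) k j := fun j =>
      (measurable_pi_apply j).comp ((measurable_pi_apply k).comp
        (measurable_subtype_coe.comp (hsm n)))
    have h2 := fun j => hGm' n j l
    simp only [W, Matrix.mul_apply, Matrix.of_apply]
    fun_prop
  refine ⟨W, fun n => ⟨hWm n, fun x hA => ?_⟩, fun k l => ?_⟩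
  · rw [isSymPP_empirical_iff α hA]
    have hI : IsInvSqrt (covMat (empirical x)) (Matrix.of (G n x)) := by
      rw [hGinv x hA]; exact isInvSqrt_invSqrt hA
    refine ⟨hI.orthogonal_mul ((mem_orthogonalGroup_iff _ _).2 (s n x).2.1), fun W' hW' => ?_⟩
    have hV := (mem_orthogonalGroup_iff _ _).1 (hI.mul_inv_orthogonal hW')
    -- A competitor outside `domMat` is moved into it without changing its index.
    obtain ⟨σ, r, hmem⟩ := exists_signedPerm_mem_domMat hV
    have e1 := sampleIndex_signedPerm α x (W' * (Matrix.of (G n x))⁻¹) (Matrix.of (G n x)) σ r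
    rw [Matrix.mul_assoc W', nonsing_inv_mul _ hI.isUnit_det, mul_one] at e1
    rw [← e1]
    exact (hindex x _ hmem).symm.le.trans ((hsmax n x _).trans (hindex x _ (s n x).2).le)
  · refine tendstoInMeasure_of_tendsto_ae (fun n => ?_) ?_
    · refine Measurable.aestronglyMeasurable ?_
      have : Measurable fun ω => sample z n ω :=
        measurable_pi_lambda _ fun i => hmeas i
      exact (hWm n k l).comp this
    · filter_upwards [tendsto_sampleMoments hindep hident (integrable_monom h4 1)] with ω hω
      set m : ℕ → MIdx p → ℝ := fun n => sampleMoments 1 (sample z n ω) with hm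
      set A : ℕ → Matrix (Fin p) (Fin p) ℝ := fun n => covMat (empirical (sample z n ω)) with hA
      have hA1 : Tendsto A atTop (𝓝 1) := tendsto_covMat_empirical hX h4 hω
      have hpos := eventually_posDef (fun n => posSemidef_covMat_empirical (sample z n ω)) hA1
      have hG1 : Tendsto (fun n => Matrix.of (G n (sample z n ω))) atTop (𝓝 1) := by
        refine (tendsto_invSqrt (fun n => posSemidef_covMat_empirical (sample z n ω)) hA1).congr' ?_
        filter_upwards [hpos] with n hn
        exact (hGinv _ hn).symm
      have hU1 : Tendsto (fun n => Matrix.of (s n (sample z n ω) : Fin p → Fin p → ℝ)) atTop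
          (𝓝 1) := by
        refine tendsto_one_of_isMax hX h4 h0 h1 hsep hω hG1
          (Eventually.of_forall fun n => (s n _).2) (Eventually.of_forall fun n => ?_)
        have e1 := hsmax n (sample z n ω) ⟨_, one_mem_domMat p⟩
        have e2 := hindex (sample z n ω) _ (s n (sample z n ω)).2
        rw [hindex] at e1
        have e3 := e1.trans e2.le
        rwa [← indexF_sampleMoments, ← indexF_sampleMoments] at e3
      have hW1 := hU1.mul hG1
      rw [mul_one] at hW1
      exact (tendsto_pi_nhds.1 (tendsto_pi_nhds.1 hW1 k) l)

/-! ### The central limit theorem in finite dimension and linearization -/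

section CLT

variable {Ω : Type*} [MeasurableSpace Ω] {P : Measure Ω} [IsProbabilityMeasure P]
  {ι : Type*} [Fintype ι] [DecidableEq ι]

/-- The matrix of the second moments of a random vector. -/
def secondMoments (P : Measure Ω) (Y : Ω → EuclideanSpace ℝ ι) : Matrix ι ι ℝ :=
  Matrix.of fun i j => ∫ ω, Y ω i * Y ω j ∂P

omit [IsProbabilityMeasure P] [DecidableEq ι] in
lemma dotProduct_secondMoments {Y : Ω → EuclideanSpace ℝ ι} (h2 : ∀ i, MemLp (fun ω => Y ω i) 2 P)
    (t : ι → ℝ) : t ⬝ᵥ (secondMoments P Y *ᵥ t) = ∫ ω, (∑ i, t i * Y ω i) ^ 2 ∂P := by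
  have hint : ∀ i j, Integrable (fun ω => Y ω i * Y ω j) P := fun i j =>
    (h2 i).integrable_mul (h2 j)
  have h : ∀ ω, (∑ i, t i * Y ω i) ^ 2 = ∑ i, ∑ j, (t i * t j) * (Y ω i * Y ω j) := by
    intro ω
    rw [sq, Finset.sum_mul_sum]
    exact Finset.sum_congr rfl fun i _ => Finset.sum_congr rfl fun j _ => by ring
  simp only [h]
  rw [integral_finsetSum _ fun i _ => integrable_finsetSum _ fun j _ => (hint i j).const_mul _]
  simp only [dotProduct, mulVec, secondMoments, Matrix.of_apply, Finset.mul_sum]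
  refine Finset.sum_congr rfl fun i _ => ?_
  rw [integral_finsetSum _ fun j _ => (hint i j).const_mul _]
  refine Finset.sum_congr rfl fun j _ => ?_
  rw [integral_const_mul]; ring

omit [IsProbabilityMeasure P] [DecidableEq ι] in
lemma posSemidef_secondMoments {Y : Ω → EuclideanSpace ℝ ι}
    (h2 : ∀ i, MemLp (fun ω => Y ω i) 2 P) : (secondMoments P Y).PosSemidef := by
  refine Matrix.PosSemidef.of_dotProduct_mulVec_nonneg ?_ fun t => ?_
  · ext i j
    simp [secondMoments, mul_comm]
  · rw [star_trivial, dotProduct_secondMoments h2]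
    exact integral_nonneg fun ω => sq_nonneg _

/-- The multivariate central limit theorem for centered vectors. -/
theorem tendstoInDistribution_sum_multivariate {Y : ℕ → Ω → EuclideanSpace ℝ ι}
    (hmeas : ∀ i, Measurable (Y i)) (hindep : iIndepFun Y P)
    (hident : ∀ i, IdentDistrib (Y i) (Y 0) P P) (h2 : ∀ i, MemLp (fun ω => Y 0 ω i) 2 P)
    (h0 : ∀ i, ∫ ω, Y 0 ω i ∂P = 0) :
    TendstoInDistribution (fun (n : ℕ) ω => (√n)⁻¹ • ∑ i ∈ Finset.range n, Y i ω) atTop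
      (id : EuclideanSpace ℝ ι → EuclideanSpace ℝ ι) (fun _ => P)
      (multivariateGaussian 0 (secondMoments P (Y 0))) where
  forall_aemeasurable n := by fun_prop
  tendsto := by
    refine ProbabilityMeasure.tendsto_iff_tendsto_charFun.2 fun t => ?_
    -- The characteristic function at t is that of the projection onto t at 1, so the
    -- one-dimensional central limit theorem for the projection suffices.
    set X : ℕ → Ω → ℝ := fun i ω => inner ℝ (Y i ω) t with hX
    have hXsum : ∀ i ω, X i ω = ∑ j, t j * Y i ω j := fun i ω => by
      simp [hX, PiLp.inner_apply]
    have hinm : Measurable fun y : EuclideanSpace ℝ ι => (inner ℝ y t : ℝ) := by fun_prop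
    have hX2 : MemLp (X 0) 2 P := by
      have : X 0 = fun ω => ∑ j, t j * Y 0 ω j := by ext ω; exact hXsum 0 ω
      rw [this]
      exact memLp_finsetSum _ fun j _ => (h2 j).const_mul _
    have hmean : ∫ ω, X 0 ω ∂P = 0 := by
      simp only [hXsum]
      rw [integral_finsetSum _ fun j _ => ((h2 j).integrable (by norm_num)).const_mul _]
      simp [integral_const_mul, h0]
    have hvar : Var[X 0; P] = t.ofLp ⬝ᵥ (secondMoments P (Y 0) *ᵥ t.ofLp) := by
      rw [variance_of_integral_eq_zero hX2.1.aemeasurable hmean, dotProduct_secondMoments h2]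
      simp only [hXsum]
    have hclt := tendstoInDistribution_inv_sqrt_mul_sum_sub (P := P) (X := X)
      (P' := gaussianReal 0 Var[X 0; P].toNNReal) (Y := id) HasLaw.id hX2
      (hindep.comp (fun _ y => inner ℝ y t) fun _ => hinm) (fun i => (hident i).comp hinm)
    have hcf := ProbabilityMeasure.tendsto_iff_tendsto_charFun.1 hclt.tendsto 1
    have hlim : charFun (multivariateGaussian 0 (secondMoments P (Y 0))) t =
        charFun (gaussianReal 0 Var[X 0; P].toNNReal) 1 := by
      rw [charFun_multivariateGaussian (posSemidef_secondMoments h2), charFun_gaussianReal,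
        ← hvar]
      simp [Real.coe_toNNReal _ (variance_nonneg _ _)]
    simp only [ProbabilityMeasure.coe_mk, Measure.map_id] at hcf ⊢
    rw [hlim]
    refine hcf.congr fun n => ?_
    rw [charFun_apply, charFun_apply, integral_map (by fun_prop) (by fun_prop),
      integral_map (by fun_prop) (by fun_prop)]
    refine integral_congr_ae (ae_of_all _ fun ω => ?_)
    have hin : (inner ℝ ((√n)⁻¹ • ∑ i ∈ Finset.range n, Y i ω) t : ℝ)
        = (√n)⁻¹ * (∑ k ∈ Finset.range n, X k ω - n * ∫ ω, X 0 ω ∂P) := by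
      rw [hmean, mul_zero, sub_zero, real_inner_smul_left, sum_inner]
    simp only [hin]
    simp

end CLT

/-! ### Stochastic boundedness of averages and the delta method -/

section Linearization

variable {Ω S : Type*} [MeasurableSpace Ω] [MeasurableSpace S] {P : Measure Ω}
  [IsProbabilityMeasure P] {J : Type*} [Fintype J] {z : ℕ → Ω → S} {f : S → J → ℝ}

/-- Averages of a function along a sequence. -/
def runAvg (z : ℕ → Ω → S) (f : S → J → ℝ) (n : ℕ) (ω : Ω) : J → ℝ :=
  fun j => (n : ℝ)⁻¹ * ∑ i ∈ Finset.range n, f (z i ω) j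

/-- Averages of square integrable functions deviate from their means by `O(1/√n)`, in
probability. -/
lemma runAvg_bounded (hf : Measurable f) (hindep : iIndepFun z P)
    (hident : ∀ i, IdentDistrib (z i) (z 0) P P)
    (h2 : ∀ j, MemLp (fun ω => f (z 0 ω) j) 2 P) {m₀ : J → ℝ}
    (hm₀ : ∀ j, ∫ ω, f (z 0 ω) j ∂P = m₀ j) :
    ∃ V : ℝ, 0 ≤ V ∧ ∀ K > 0, ∀ n : ℕ, P {ω | K ≤ √n * ‖runAvg z f n ω - m₀‖} ≤
      ENNReal.ofReal (V / K ^ 2) := by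
  have hfj : ∀ j, Measurable fun s => f s j := fun j => (measurable_pi_apply j).comp hf
  refine ⟨∑ j, Var[fun ω => f (z 0 ω) j; P], Finset.sum_nonneg fun j _ => variance_nonneg _ _, ?_⟩
  intro K hK n
  rcases Nat.eq_zero_or_pos n with rfl | hn
  · have : {ω | K ≤ √((0 : ℕ) : ℝ) * ‖runAvg z f 0 ω - m₀‖} = ∅ := by
      ext ω
      simp only [Nat.cast_zero, Real.sqrt_zero, zero_mul, Set.mem_ofPred_eq,
        Set.mem_empty_iff_false, iff_false, not_le]
      exact hK
    rw [this]; simp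
  have hn' : (0 : ℝ) < n := by exact_mod_cast hn
  have hs : 0 < √(n : ℝ) := Real.sqrt_pos.2 hn'
  have hid : ∀ i j, IdentDistrib (fun ω => f (z i ω) j) (fun ω => f (z 0 ω) j) P P :=
    fun i j => (hident i).comp (hfj j)
  have hL : ∀ i j, MemLp (fun ω => f (z i ω) j) 2 P := fun i j => (hid i j).memLp_iff.2 (h2 j)
  have hL' : ∀ j, MemLp (∑ i ∈ Finset.range n, fun ω => f (z i ω) j) 2 P := fun j =>
    memLp_finsetSum' _ fun i _ => hL i j
  have hmean : ∀ j, ∫ ω, (∑ i ∈ Finset.range n, fun ω => f (z i ω) j) ω ∂P = n * m₀ j := by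
    intro j
    simp only [Finset.sum_apply]
    rw [integral_finsetSum _ fun i _ => (hL i j).integrable (by norm_num)]
    simp [(hid _ j).integral_eq, hm₀]
  have hvar : ∀ j, Var[∑ i ∈ Finset.range n, fun ω => f (z i ω) j; P]
      = n * Var[fun ω => f (z 0 ω) j; P] := by
    intro j
    rw [IndepFun.variance_sum (fun i _ => hL i j)
      (fun i _ k _ hik => (hindep.indepFun hik).comp (hfj j) (hfj j))]
    simp [(hid _ j).variance_eq]
  -- In the maximum norm a large deviation is a large deviation of some coordinate; a union bound
  -- and Chebyshev's inequality follow.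
  have hsub : {ω | K ≤ √n * ‖runAvg z f n ω - m₀‖} ⊆ ⋃ j ∈ (Finset.univ : Finset J),
      {ω | K * √n ≤ |(∑ i ∈ Finset.range n, fun ω => f (z i ω) j) ω
        - ∫ ω, (∑ i ∈ Finset.range n, fun ω => f (z i ω) j) ω ∂P|} := by
    intro ω hω
    simp only [Set.mem_ofPred_eq] at hω
    have h1 : ¬ ‖runAvg z f n ω - m₀‖ < K / √n := by
      rw [not_lt, div_le_iff₀ hs, mul_comm]; exact hω
    rw [pi_norm_lt_iff (by positivity)] at h1
    push Not at h1
    obtain ⟨j, hj⟩ := h1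
    simp only [Set.mem_iUnion, Set.mem_ofPred_eq]
    refine ⟨j, Finset.mem_univ j, ?_⟩
    rw [hmean]
    have h3 : (∑ i ∈ Finset.range n, fun ω => f (z i ω) j) ω - n * m₀ j
        = n * (runAvg z f n ω - m₀) j := by
      simp only [Finset.sum_apply, runAvg, Pi.sub_apply]
      field_simp
    rw [h3, abs_mul, abs_of_pos hn', ← Real.norm_eq_abs]
    calc K * √n = n * (K / √n) := by
          field_simp; rw [Real.sq_sqrt hn'.le]
      _ ≤ _ := by gcongr
  calc P {ω | K ≤ √n * ‖runAvg z f n ω - m₀‖} ≤ _ := measure_mono hsub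
    _ ≤ ∑ j, P {ω | K * √n ≤ |(∑ i ∈ Finset.range n, fun ω => f (z i ω) j) ω
        - ∫ ω, (∑ i ∈ Finset.range n, fun ω => f (z i ω) j) ω ∂P|} :=
        measure_biUnion_finset_le _ _
    _ ≤ ∑ j, ENNReal.ofReal (Var[fun ω => f (z 0 ω) j; P] / K ^ 2) := by
        refine Finset.sum_le_sum fun j _ => ?_
        refine (meas_ge_le_variance_div_sq (hL' j) (by positivity)).trans (le_of_eq ?_)
        rw [hvar, mul_pow, Real.sq_sqrt hn'.le]
        congr 1
        field_simp
    _ = _ := by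
        rw [Finset.sum_div, ENNReal.ofReal_sum_of_nonneg]
        exact fun j _ => div_nonneg (variance_nonneg _ _) (by positivity)

lemma exists_coord_eq_sum {ι : Type*} [Fintype ι]
    (A : (J → ℝ) →L[ℝ] EuclideanSpace ℝ ι) (i : ι) :
    ∃ a : J → ℝ, ∀ v : J → ℝ, (A v) i = ∑ j, v j * a j := by
  classical
  refine ⟨fun j => A (Pi.single j 1) i, fun v => ?_⟩
  conv_lhs => rw [pi_eq_sum_univ' v]
  simp [map_sum]

/-- The delta method: estimators which are approximately linear functions of averages are
asymptotically normal. -/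
theorem tendstoInDistribution_of_linearization {ι : Type*} [Fintype ι] [DecidableEq ι]
    (hz : ∀ i, Measurable (z i)) (hf : Measurable f) (hindep : iIndepFun z P)
    (hident : ∀ i, IdentDistrib (z i) (z 0) P P)
    (h2 : ∀ j, MemLp (fun ω => f (z 0 ω) j) 2 P) {m₀ : J → ℝ}
    (hm₀ : ∀ j, ∫ ω, f (z 0 ω) j ∂P = m₀ j) (A : (J → ℝ) →L[ℝ] EuclideanSpace ℝ ι)
    {T : ℕ → Ω → EuclideanSpace ℝ ι} (hT : ∀ n, AEMeasurable (T n) P)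
    (hlin : ∀ ε > 0, Tendsto (fun n => P {ω | ε * ‖runAvg z f n ω - m₀‖ <
      ‖T n ω - A (runAvg z f n ω - m₀)‖}) atTop (𝓝 0)) :
    TendstoInDistribution (fun (n : ℕ) ω => √n • T n ω) atTop
      (id : EuclideanSpace ℝ ι → EuclideanSpace ℝ ι) (fun _ => P)
      (multivariateGaussian 0 (secondMoments P fun ω => A (f (z 0 ω) - m₀))) := by
  have hg : Measurable fun s => A (f s - m₀) :=
    A.continuous.measurable.comp (hf.sub measurable_const)
  have hcoord := exists_coord_eq_sum A
  have hclt := tendstoInDistribution_sum_multivariate (P := P)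
    (Y := fun i ω => A (f (z i ω) - m₀)) (fun i => hg.comp (hz i))
    (hindep.comp (fun _ s => A (f s - m₀)) fun _ => hg) (fun i => (hident i).comp hg)
    (fun i => by
      obtain ⟨a, ha⟩ := hcoord i
      simp only [ha, Pi.sub_apply]
      exact memLp_finsetSum _ fun j _ => ((h2 j).sub (memLp_const _)).mul_const _)
    (fun i => by
      obtain ⟨a, ha⟩ := hcoord i
      have hi : ∀ j, Integrable (fun ω => f (z 0 ω) j) P := fun j =>
        (h2 j).integrable (by norm_num)
      simp only [ha, Pi.sub_apply]
      have hi' : ∀ j, Integrable (fun ω => f (z 0 ω) j - m₀ j) P := fun j =>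
        (hi j).sub (integrable_const _)
      rw [integral_finsetSum _ fun j _ => (hi' j).mul_const _]
      refine Finset.sum_eq_zero fun j _ => ?_
      rw [integral_mul_const, integral_sub (hi j) (integrable_const _), hm₀]
      simp)
  -- Slutsky: the linear part converges by the central limit theorem, and the scaled remainder must
  -- vanish in probability.
  refine tendstoInDistribution_of_tendstoInMeasure_sub _ _ hclt ?_ fun n =>
    (hT n).fun_const_smul _
  have hsum : ∀ (n : ℕ) ω, (√n)⁻¹ • ∑ i ∈ Finset.range n, A (f (z i ω) - m₀)
      = √n • A (runAvg z f n ω - m₀) := by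
    intro n ω
    rcases Nat.eq_zero_or_pos n with rfl | hn
    · simp
    have hn' : (0 : ℝ) < n := by exact_mod_cast hn
    rw [← map_sum, ← map_smul, ← map_smul]
    congr 1
    ext j
    have hs : √(n : ℝ) ≠ 0 := (Real.sqrt_pos.2 hn').ne'
    simp only [Pi.smul_apply, Finset.sum_apply, Pi.sub_apply, smul_eq_mul, runAvg,
      Finset.sum_sub_distrib, Finset.sum_const, Finset.card_range, nsmul_eq_mul]
    field_simp
    rw [Real.sq_sqrt hn'.le]
    field_simp
    simp
  obtain ⟨V, hV0, hV⟩ := runAvg_bounded hf hindep hident h2 hm₀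
  rw [tendstoInMeasure_iff_norm]
  intro η hη
  rw [ENNReal.tendsto_nhds_zero]
  intro τ hτ
  -- Tightness: K bounds the scaled deviation of the averages outside an event of probability at
  -- most τ/2. The relative error η/K then becomes an absolute error below η.
  obtain ⟨K, hK, hKτ⟩ : ∃ K > 0, ENNReal.ofReal (V / K ^ 2) ≤ τ / 2 := by
    have : Tendsto (fun K : ℝ => ENNReal.ofReal (V / K ^ 2)) atTop (𝓝 0) := by
      rw [← ENNReal.ofReal_zero]
      exact ENNReal.tendsto_ofReal (tendsto_const_nhds.div_atTop (tendsto_pow_atTop two_ne_zero))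
    have h3 := (this.eventually_le_const (ENNReal.half_pos hτ.ne')).and (eventually_gt_atTop 0)
    obtain ⟨K, h4, h5⟩ := h3.exists
    exact ⟨K, h5, h4⟩
  have h6 := (hlin (η / K) (by positivity)).eventually_le_const (ENNReal.half_pos hτ.ne')
  filter_upwards [h6] with n hn
  calc _ ≤ P ({ω | η / K * ‖runAvg z f n ω - m₀‖ < ‖T n ω - A (runAvg z f n ω - m₀)‖} ∪
        {ω | K ≤ √n * ‖runAvg z f n ω - m₀‖}) := by
        refine measure_mono fun ω hω => ?_
        simp only [Pi.sub_apply, Set.mem_ofPred_eq, Pi.zero_apply, sub_zero, hsum, ← smul_sub,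
          norm_smul, Real.norm_eq_abs, abs_of_nonneg (Real.sqrt_nonneg _)] at hω
        by_contra hne
        simp only [Set.mem_union, Set.mem_ofPred_eq, not_or, not_lt, not_le] at hne
        have h7 := mul_le_mul_of_nonneg_left hne.1 (Real.sqrt_nonneg (n : ℝ))
        have h8 : √(n : ℝ) * (η / K * ‖runAvg z f n ω - m₀‖) < η := by
          calc _ = η / K * (√(n : ℝ) * ‖runAvg z f n ω - m₀‖) := by ring
            _ < η / K * K := by gcongr; exact hne.2
            _ = η := by field_simp
        linarith
    _ ≤ τ / 2 + τ / 2 := (measure_union_le _ _).trans (add_le_add hn ((hV K hK n).trans hKτ))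
    _ = τ := ENNReal.add_halves τ

end Linearization

/-! ### Linearization of the estimating equations -/

/-- Solutions of an equation depend on a parameter in an approximately linear way. -/
lemma linearization_of_zero {E M : Type*} [NormedAddCommGroup E] [NormedSpace ℝ E]
    [NormedAddCommGroup M] [NormedSpace ℝ M] {G : E × M → E} {e₀ : E} {m₀ : M} {A : M →L[ℝ] E}
    (hG : HasFDerivAt G
      (ContinuousLinearMap.fst ℝ E M - A.comp (ContinuousLinearMap.snd ℝ E M)) (e₀, m₀))
    (h0 : G (e₀, m₀) = 0) {ε : ℝ} (hε : 0 < ε) :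
    ∃ δ > 0, ∀ e m, ‖e - e₀‖ < δ → ‖m - m₀‖ < δ → G (e, m) = 0 →
      ‖e - e₀ - A (m - m₀)‖ ≤ ε * ‖m - m₀‖ := by
  -- The bound 1/2 lets half of ‖x‖ be absorbed into the left side; the other bound leaves at most
  -- ε/2 times ‖m - m₀‖ on the right.
  set η : ℝ := min (1 / 2) (ε / (2 * (‖A‖ + 1))) with hη
  have hA : 0 < ‖A‖ + 1 := by positivity
  have hη0 : 0 < η := by positivity
  have h1 := (hasFDerivAt_iff_isLittleO.1 hG).bound hη0
  obtain ⟨δ, hδ, hball⟩ := Metric.eventually_nhds_iff.1 h1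
  refine ⟨δ, hδ, fun e m he hm hz => ?_⟩
  have h2 := hball (y := (e, m)) (by
    rw [dist_eq_norm, Prod.mk_sub_mk, Prod.norm_def]; exact max_lt he hm)
  rw [hz, h0, sub_zero, zero_sub, norm_neg, Prod.mk_sub_mk, Prod.norm_def] at h2
  set x := e - e₀ - A (m - m₀) with hx
  have h3 : ‖x‖ ≤ η * max ‖e - e₀‖ ‖m - m₀‖ := h2
  have h4 : ‖e - e₀‖ ≤ ‖x‖ + ‖A‖ * ‖m - m₀‖ := by
    have : e - e₀ = x + A (m - m₀) := by rw [hx]; abel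
    calc ‖e - e₀‖ ≤ ‖x‖ + ‖A (m - m₀)‖ := by rw [this]; exact norm_add_le _ _
      _ ≤ _ := by gcongr; exact A.le_opNorm _
  have h5 : max ‖e - e₀‖ ‖m - m₀‖ ≤ ‖x‖ + (‖A‖ + 1) * ‖m - m₀‖ := by
    refine max_le (h4.trans ?_) ?_
    · nlinarith [norm_nonneg (m - m₀)]
    · nlinarith [norm_nonneg (m - m₀), norm_nonneg x,
        mul_nonneg (norm_nonneg A) (norm_nonneg (m - m₀))]
  have h6 : ‖x‖ ≤ η * ‖x‖ + η * (‖A‖ + 1) * ‖m - m₀‖ := by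
    calc ‖x‖ ≤ η * (‖x‖ + (‖A‖ + 1) * ‖m - m₀‖) := h3.trans (by gcongr)
      _ = _ := by ring
  have h7 : η * ‖x‖ ≤ 1 / 2 * ‖x‖ := by gcongr; exact min_le_left _ _
  have h8 : η * (‖A‖ + 1) ≤ ε / 2 := by
    calc η * (‖A‖ + 1) ≤ ε / (2 * (‖A‖ + 1)) * (‖A‖ + 1) := by gcongr; exact min_le_right _ _
      _ = ε / 2 := by field_simp
  have h9 : η * (‖A‖ + 1) * ‖m - m₀‖ ≤ ε / 2 * ‖m - m₀‖ := by gcongr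
  linarith

lemma hasDerivAt_triple {p : ℕ} {u v w : ℝ → Option (Fin p) → ℝ} {m : ℝ → MIdx p → ℝ}
    {u' v' w' : Option (Fin p) → ℝ} {m' : MIdx p → ℝ} {t : ℝ}
    (hu : ∀ a, HasDerivAt (fun t => u t a) (u' a) t)
    (hv : ∀ a, HasDerivAt (fun t => v t a) (v' a) t)
    (hw : ∀ a, HasDerivAt (fun t => w t a) (w' a) t)
    (hm : ∀ j, HasDerivAt (fun t => m t j) (m' j) t) :
    HasDerivAt (fun t => triple (u t) (v t) (w t) (m t))
      (triple u' (v t) (w t) (m t) + triple (u t) v' (w t) (m t) + triple (u t) (v t) w' (m t)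
        + triple (u t) (v t) (w t) m') t := by
  have h := HasDerivAt.fun_sum (u := Finset.univ) fun a _ =>
    HasDerivAt.fun_sum (u := Finset.univ) fun b _ =>
    HasDerivAt.fun_sum (u := Finset.univ) fun d _ =>
      (((hu a).fun_mul (hv b)).fun_mul (hw d)).fun_mul (hm (.inl (a, b, d)))
  refine h.congr_deriv ?_
  simp only [triple, ← Finset.sum_add_distrib]
  exact Finset.sum_congr rfl fun a _ => Finset.sum_congr rfl fun b _ =>
    Finset.sum_congr rfl fun d _ => by ring

lemma hasDerivAt_quadruple {p : ℕ} {u v w y : ℝ → Option (Fin p) → ℝ} {m : ℝ → MIdx p → ℝ}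
    {u' v' w' y' : Option (Fin p) → ℝ} {m' : MIdx p → ℝ} {t : ℝ}
    (hu : ∀ a, HasDerivAt (fun t => u t a) (u' a) t)
    (hv : ∀ a, HasDerivAt (fun t => v t a) (v' a) t)
    (hw : ∀ a, HasDerivAt (fun t => w t a) (w' a) t)
    (hy : ∀ a, HasDerivAt (fun t => y t a) (y' a) t)
    (hm : ∀ j, HasDerivAt (fun t => m t j) (m' j) t) :
    HasDerivAt (fun t => quadruple (u t) (v t) (w t) (y t) (m t))
      (quadruple u' (v t) (w t) (y t) (m t) + quadruple (u t) v' (w t) (y t) (m t)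
        + quadruple (u t) (v t) w' (y t) (m t) + quadruple (u t) (v t) (w t) y' (m t)
        + quadruple (u t) (v t) (w t) (y t) m') t := by
  have h := HasDerivAt.fun_sum (u := Finset.univ) fun a _ =>
    HasDerivAt.fun_sum (u := Finset.univ) fun b _ =>
    HasDerivAt.fun_sum (u := Finset.univ) fun d _ =>
    HasDerivAt.fun_sum (u := Finset.univ) fun e _ =>
      ((((hu a).fun_mul (hv b)).fun_mul (hw d)).fun_mul (hy e)).fun_mul (hm (.inr (a, b, d, e)))
  refine h.congr_deriv ?_
  simp only [quadruple, ← Finset.sum_add_distrib]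
  exact Finset.sum_congr rfl fun a _ => Finset.sum_congr rfl fun b _ =>
    Finset.sum_congr rfl fun d _ => Finset.sum_congr rfl fun e _ => by ring

lemma triple_unitVec_23 {p : ℕ} (u : Option (Fin p) → ℝ) (b d : Option (Fin p))
    (m : MIdx p → ℝ) : triple u (unitVec b) (unitVec d) m = ∑ a, u a * m (.inl (a, b, d)) := by
  simp [triple, unitVec, Pi.single_apply]

lemma triple_unitVec_13 {p : ℕ} (u : Option (Fin p) → ℝ) (a d : Option (Fin p))
    (m : MIdx p → ℝ) : triple (unitVec a) u (unitVec d) m = ∑ b, u b * m (.inl (a, b, d)) := by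
  simp [triple, unitVec, Pi.single_apply]

lemma triple_unitVec_12 {p : ℕ} (u : Option (Fin p) → ℝ) (a b : Option (Fin p))
    (m : MIdx p → ℝ) : triple (unitVec a) (unitVec b) u m = ∑ d, u d * m (.inl (a, b, d)) := by
  simp [triple, unitVec, Pi.single_apply]

lemma triple_unitVec {p : ℕ} (a b d : Option (Fin p)) (m : MIdx p → ℝ) :
    triple (unitVec a) (unitVec b) (unitVec d) m = m (.inl (a, b, d)) := by
  simp [triple, unitVec, Pi.single_apply]

lemma quadruple_unitVec_234 {p : ℕ} (u : Option (Fin p) → ℝ) (b d e : Option (Fin p))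
    (m : MIdx p → ℝ) : quadruple u (unitVec b) (unitVec d) (unitVec e) m
      = ∑ a, u a * m (.inr (a, b, d, e)) := by
  simp [quadruple, unitVec, Pi.single_apply]

lemma quadruple_unitVec_134 {p : ℕ} (u : Option (Fin p) → ℝ) (a d e : Option (Fin p))
    (m : MIdx p → ℝ) : quadruple (unitVec a) u (unitVec d) (unitVec e) m
      = ∑ b, u b * m (.inr (a, b, d, e)) := by
  simp [quadruple, unitVec, Pi.single_apply]

lemma quadruple_unitVec_124 {p : ℕ} (u : Option (Fin p) → ℝ) (a b e : Option (Fin p))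
    (m : MIdx p → ℝ) : quadruple (unitVec a) (unitVec b) u (unitVec e) m
      = ∑ d, u d * m (.inr (a, b, d, e)) := by
  simp [quadruple, unitVec, Pi.single_apply]

lemma quadruple_unitVec_123 {p : ℕ} (u : Option (Fin p) → ℝ) (a b d : Option (Fin p))
    (m : MIdx p → ℝ) : quadruple (unitVec a) (unitVec b) (unitVec d) u m
      = ∑ e, u e * m (.inr (a, b, d, e)) := by
  simp [quadruple, unitVec, Pi.single_apply]

lemma quadruple_unitVec {p : ℕ} (a b d e : Option (Fin p)) (m : MIdx p → ℝ) :
    quadruple (unitVec a) (unitVec b) (unitVec d) (unitVec e) m = m (.inr (a, b, d, e)) := by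
  simp [quadruple, unitVec, Pi.single_apply]

/-! ### Mixed moments of independent standardized variables -/

section MixedMoments

variable {Ω : Type*} [MeasurableSpace Ω] {P : Measure Ω} {p : ℕ}
  {X : Fin p → Ω → ℝ}

lemma integral_pow_mul_pow_of_ne (hX : IsIndepStd X P) {k l : Fin p} (hkl : k ≠ l) (a b : ℕ) :
    ∫ ω, X k ω ^ a * X l ω ^ b ∂P = (∫ ω, X k ω ^ a ∂P) * ∫ ω, X l ω ^ b ∂P :=
  IndepFun.integral_pow_mul_pow (hX.indep.indepFun hkl) (hX.meas k).aestronglyMeasurable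
    (hX.meas l).aestronglyMeasurable a b

/-- A third coordinate is independent of the other two and has mean zero. This is the source of all
zeros among the mixed moments below. -/
lemma integral_aug_mul_pow_mul_pow (hX : IsIndepStd X P) {k l : Fin p} (hkl : k ≠ l)
    (o : Option (Fin p)) (a b : ℕ) :
    ∫ ω, aug (fun k => X k ω) o * (X k ω ^ a * X l ω ^ b) ∂P =
      o.elim ((∫ ω, X k ω ^ a ∂P) * ∫ ω, X l ω ^ b ∂P) fun i =>
        if i = k then (∫ ω, X k ω ^ (a + 1) ∂P) * ∫ ω, X l ω ^ b ∂P
        else if i = l then (∫ ω, X k ω ^ a ∂P) * ∫ ω, X l ω ^ (b + 1) ∂P else 0 := by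
  cases o with
  | none => simpa using integral_pow_mul_pow_of_ne hX hkl a b
  | some i =>
    simp only [aug_some, Option.elim]
    split_ifs with h1 h2
    · subst h1
      rw [← integral_pow_mul_pow_of_ne hX hkl]
      exact integral_congr_ae (ae_of_all _ fun ω => by simp only; ring)
    · subst h2
      rw [← integral_pow_mul_pow_of_ne hX hkl]
      exact integral_congr_ae (ae_of_all _ fun ω => by simp only; ring)
    · have hI := (hX.indep.indepFun_prodMk hX.meas k l i (Ne.symm h1) (Ne.symm h2)).symm
      have hI' := hI.comp (φ := id) (ψ := fun q : ℝ × ℝ => q.1 ^ a * q.2 ^ b) measurable_id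
        (by fun_prop)
      have hk := hX.meas k
      have hl := hX.meas l
      have := hI'.integral_fun_mul_eq_mul_integral (hX.meas i).aestronglyMeasurable
        (Measurable.aestronglyMeasurable (by fun_prop))
      refine this.trans ?_
      simp [hX.mean i]

lemma integral_aug_mul_pow (hX : IsIndepStd X P) (k : Fin p) (o : Option (Fin p)) (a : ℕ) :
    ∫ ω, aug (fun k => X k ω) o * X k ω ^ a ∂P =
      o.elim (∫ ω, X k ω ^ a ∂P) fun i => if i = k then ∫ ω, X k ω ^ (a + 1) ∂P else 0 := by
  cases o with
  | none => simp
  | some i =>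
    simp only [aug_some, Option.elim]
    split_ifs with h1
    · subst h1
      exact integral_congr_ae (ae_of_all _ fun ω => by simp only; ring)
    · have := integral_pow_mul_pow_of_ne hX h1 1 a
      simpa [hX.mean i] using this

lemma popMoments_none_left (hX : IsIndepStd X P) (c : ℝ) (o : Option (Fin p)) (l : Fin p) :
    popMoments c X P (.inl (none, o, some l)) = o.elim 0 fun i => if i = l then 1 else 0 := by
  have := integral_aug_mul_pow hX l o 1
  simpa [popMoments, monom, hX.mean, hX.var] using this

lemma popMoments_none_right (hX : IsIndepStd X P) (c : ℝ) (o : Option (Fin p)) (l : Fin p) :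
    popMoments c X P (.inl (none, some l, o)) = o.elim 0 fun i => if i = l then 1 else 0 := by
  rw [← popMoments_none_left hX c o l]
  exact integral_congr_ae (ae_of_all _ fun ω => by simp only [monom, Sum.elim_inl]; ring)

lemma popMoments_three_left (hX : IsIndepStd X P) (c : ℝ) {k l : Fin p} (hkl : k ≠ l)
    (o : Option (Fin p)) : popMoments c X P (.inl (o, some k, some l)) = 0 := by
  have := integral_aug_mul_pow_mul_pow hX hkl o 1 1
  cases o <;> simpa [popMoments, monom, hX.mean, hX.var, mul_assoc] using this

lemma popMoments_three_mid (hX : IsIndepStd X P) (c : ℝ) {k l : Fin p} (hkl : k ≠ l)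
    (o : Option (Fin p)) : popMoments c X P (.inl (some k, o, some l)) = 0 := by
  rw [← popMoments_three_left hX c hkl o]
  exact integral_congr_ae (ae_of_all _ fun ω => by simp only [monom, Sum.elim_inl]; ring)

lemma popMoments_three_right (hX : IsIndepStd X P) (c : ℝ) (k : Fin p)
    (o : Option (Fin p)) : popMoments c X P (.inl (some k, some k, o)) =
      o.elim 1 fun i => if i = k then gam P (X k) else 0 := by
  rw [← hX.var k]
  refine Eq.trans ?_ (integral_aug_mul_pow hX k o 2)
  exact integral_congr_ae (ae_of_all _ fun ω => by
    simp only [monom, Sum.elim_inl, aug_some]; ring)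

lemma popMoments_four_first (hX : IsIndepStd X P) (c : ℝ) {k l : Fin p} (hkl : k ≠ l)
    (o : Option (Fin p)) : popMoments c X P (.inr (o, some k, some k, some l)) =
      o.elim 0 fun i => if i = l then c else 0 := by
  have h : popMoments c X P (.inr (o, some k, some k, some l)) =
      c * ∫ ω, aug (fun k => X k ω) o * (X k ω ^ 2 * X l ω ^ 1) ∂P := by
    rw [← integral_const_mul]
    exact integral_congr_ae (ae_of_all _ fun ω => by
      simp only [monom, Sum.elim_inr, aug_some]; ring)
  rw [h, integral_aug_mul_pow_mul_pow hX hkl]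
  cases o with
  | none => simp [hX.mean]
  | some i =>
    by_cases h1 : i = k
    · subst h1; simp [hX.mean, hkl]
    · by_cases h2 : i = l <;> simp [hX.var, h1, h2, hkl.symm]

lemma popMoments_four_second (hX : IsIndepStd X P) (c : ℝ) {k l : Fin p} (hkl : k ≠ l)
    (o : Option (Fin p)) : popMoments c X P (.inr (some k, o, some k, some l)) =
      o.elim 0 fun i => if i = l then c else 0 := by
  rw [← popMoments_four_first hX c hkl o]
  exact integral_congr_ae (ae_of_all _ fun ω => by simp only [monom, Sum.elim_inr]; ring)

lemma popMoments_four_third (hX : IsIndepStd X P) (c : ℝ) {k l : Fin p} (hkl : k ≠ l)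
    (o : Option (Fin p)) : popMoments c X P (.inr (some k, some k, o, some l)) =
      o.elim 0 fun i => if i = l then c else 0 := by
  rw [← popMoments_four_first hX c hkl o]
  exact integral_congr_ae (ae_of_all _ fun ω => by simp only [monom, Sum.elim_inr]; ring)

lemma popMoments_four_last (hX : IsIndepStd X P) (c : ℝ) (k : Fin p) (o : Option (Fin p)) :
    popMoments c X P (.inr (some k, some k, some k, o)) =
      o.elim (c * gam P (X k)) fun i => if i = k then c * bet P (X k) else 0 := by
  have h : popMoments c X P (.inr (some k, some k, some k, o)) =
      c * ∫ ω, aug (fun k => X k ω) o * X k ω ^ 3 ∂P := by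
    rw [← integral_const_mul]
    exact integral_congr_ae (ae_of_all _ fun ω => by
      simp only [monom, Sum.elim_inr, aug_some]; ring)
  rw [h, integral_aug_mul_pow hX]
  cases o with
  | none => rfl
  | some i => by_cases h1 : i = k <;> simp [h1, bet, moment]

end MixedMoments

/-! ### The derivative of the estimating equations -/

lemma differentiable_coef {p : ℕ} (k : Fin p) (a : Option (Fin p)) :
    Differentiable ℝ fun q : (Fin p → Fin p → ℝ) × (MIdx p → ℝ) => coef q.1 q.2 k a := by
  cases a <;> simp only [coef, Option.elim] <;> fun_prop

lemma differentiable_covF {p : ℕ} (k l : Fin p) :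
    Differentiable ℝ fun q : (Fin p → Fin p → ℝ) × (MIdx p → ℝ) => covF q.1 q.2 k l := by
  have h := fun (k : Fin p) a => differentiable_coef k a
  unfold covF triple
  fun_prop

lemma differentiable_thirdF {p : ℕ} (k l : Fin p) :
    Differentiable ℝ fun q : (Fin p → Fin p → ℝ) × (MIdx p → ℝ) => thirdF q.1 q.2 k l := by
  have h := fun (k : Fin p) a => differentiable_coef k a
  unfold thirdF triple
  fun_prop

lemma differentiable_fourthF {p : ℕ} (k l : Fin p) :
    Differentiable ℝ fun q : (Fin p → Fin p → ℝ) × (MIdx p → ℝ) => fourthF q.1 q.2 k l := by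
  have h := fun (k : Fin p) a => differentiable_coef k a
  unfold fourthF quadruple
  fun_prop

lemma differentiable_estF {p : ℕ} (α : ℝ) (k l : Fin p) :
    Differentiable ℝ fun q : (Fin p → Fin p → ℝ) × (MIdx p → ℝ) => estF α q.1 q.2 k l := by
  have h3 := fun k l : Fin p => differentiable_thirdF k l
  have h4 := fun k l : Fin p => differentiable_fourthF k l
  unfold estF
  fun_prop

/-- The curvature `3 α γ² + 4 (1 - α) κ²`. -/
def curv {Ω : Type*} [MeasurableSpace Ω] (α : ℝ) (P : Measure Ω) (Y : Ω → ℝ) : ℝ :=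
  3 * α * gam P Y ^ 2 + 4 * (1 - α) * kap P Y ^ 2

/-- The estimating equations, solved for the error to the first order. -/
def solveF {Ω : Type*} [MeasurableSpace Ω] {p : ℕ} (α : ℝ) (X : Fin p → Ω → ℝ) (P : Measure Ω)
    (q : (Fin p → Fin p → ℝ) × (MIdx p → ℝ)) (k l : Fin p) : ℝ :=
  if k = l then (covF q.1 q.2 k k - 1) / 2
  else ((curv α P (X k) + 12 * (1 - α) * (kap P (X k) - kap P (X l))) * covF q.1 q.2 k l
    - estF α q.1 q.2 k l) / (curv α P (X k) + curv α P (X l))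

lemma differentiable_solveF {Ω : Type*} [MeasurableSpace Ω] {p : ℕ} (α : ℝ)
    (X : Fin p → Ω → ℝ) (P : Measure Ω) : Differentiable ℝ (solveF α X P) := by
  refine differentiable_pi.2 fun k => differentiable_pi.2 fun l => ?_
  have h1 := fun k l : Fin p => differentiable_covF k l
  have h2 := fun k l : Fin p => differentiable_estF α k l
  unfold solveF
  split_ifs <;> fun_prop

/-- The influence function, as a function of the deviations of the moments. -/
def influence {Ω : Type*} [MeasurableSpace Ω] {p : ℕ} (α : ℝ) (X : Fin p → Ω → ℝ) (P : Measure Ω)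
    (δ : MIdx p → ℝ) (k l : Fin p) : ℝ :=
  if k = l then -δ (.inl (none, some k, some k)) / 2
  else
    (3 * α * (gam P (X k) * (δ (.inl (some k, some k, some l)) - δ (.inl (none, none, some l)))
        - gam P (X l) * (δ (.inl (some l, some l, some k)) - δ (.inl (none, none, some k))))
      + 4 * (1 - α) *
        (kap P (X k) * (δ (.inr (some k, some k, some k, some l))
          - gam P (X k) * δ (.inl (none, none, some l)))
        - kap P (X l) * (δ (.inr (some l, some l, some l, some k))
          - gam P (X l) * δ (.inl (none, none, some k))))
      - (curv α P (X k) + 12 * (1 - α) * (kap P (X k) - kap P (X l))) *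
        δ (.inl (none, some k, some l))) / (curv α P (X k) + curv α P (X l))

section Derivative

variable {Ω : Type*} [MeasurableSpace Ω] {P : Measure Ω} {p : ℕ}
  {X : Fin p → Ω → ℝ}

/-- The derivative of the coefficients at the identity. -/
def coef' {p : ℕ} (E : Fin p → Fin p → ℝ) (δ : MIdx p → ℝ) (k : Fin p)
    (a : Option (Fin p)) : ℝ := a.elim (-δ (.inl (none, none, some k))) (E k)

lemma coef_one_popMoments (hX : IsIndepStd X P) (c : ℝ) (k : Fin p) :
    coef (Matrix.of.symm (1 : Matrix (Fin p) (Fin p) ℝ)) (popMoments c X P) k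
      = unitVec (some k) := by
  ext a
  cases a with
  | none => simp [coef, unitVec, popMoments_coord hX]
  | some i =>
    by_cases h : k = i <;> simp [coef, unitVec, Matrix.one_apply, h, eq_comm]

/-- The line through the population value in a given direction. -/
def lineF {Ω : Type*} [MeasurableSpace Ω] {p : ℕ} (c : ℝ) (X : Fin p → Ω → ℝ) (P : Measure Ω)
    (E : Fin p → Fin p → ℝ) (δ : MIdx p → ℝ) (t : ℝ) :
    (Fin p → Fin p → ℝ) × (MIdx p → ℝ) :=
  (Matrix.of.symm (1 : Matrix (Fin p) (Fin p) ℝ), popMoments c X P) + t • (E, δ)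

lemma hasDerivAt_lineF_snd (c : ℝ) (E : Fin p → Fin p → ℝ) (δ : MIdx p → ℝ) (j : MIdx p) :
    HasDerivAt (fun t => (lineF c X P E δ t).2 j) (δ j) 0 := by
  have : HasDerivAt (fun t : ℝ => popMoments c X P j + t * δ j) (δ j) 0 := by
    simpa using ((hasDerivAt_id (0 : ℝ)).mul_const (δ j)).const_add (popMoments c X P j)
  exact this

lemma hasDerivAt_lineF_fst (c : ℝ) (E : Fin p → Fin p → ℝ) (δ : MIdx p → ℝ) (k i : Fin p) :
    HasDerivAt (fun t => (lineF c X P E δ t).1 k i) (E k i) 0 := by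
  have : HasDerivAt (fun t : ℝ => (1 : Matrix (Fin p) (Fin p) ℝ) k i + t * E k i) (E k i) 0 := by
    simpa using ((hasDerivAt_id (0 : ℝ)).mul_const (E k i)).const_add
      ((1 : Matrix (Fin p) (Fin p) ℝ) k i)
  exact this

lemma lineF_zero (c : ℝ) (E : Fin p → Fin p → ℝ) (δ : MIdx p → ℝ) :
    lineF c X P E δ 0 = (Matrix.of.symm (1 : Matrix (Fin p) (Fin p) ℝ), popMoments c X P) := by
  simp [lineF]

lemma hasDerivAt_coef (hX : IsIndepStd X P) (c : ℝ) (E : Fin p → Fin p → ℝ) (δ : MIdx p → ℝ)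
    (k : Fin p) (a : Option (Fin p)) :
    HasDerivAt (fun t => coef (lineF c X P E δ t).1 (lineF c X P E δ t).2 k a)
      (coef' E δ k a) 0 := by
  cases a with
  | some i => exact hasDerivAt_lineF_fst c E δ k i
  | none =>
    have h := (HasDerivAt.fun_sum (u := Finset.univ) fun i _ =>
      (hasDerivAt_lineF_fst (P := P) (X := X) c E δ k i).fun_mul
        (hasDerivAt_lineF_snd (P := P) (X := X) c E δ (.inl (none, none, some i)))).fun_neg
    refine h.congr_deriv ?_
    simp only [lineF_zero, popMoments_coord hX, mul_zero, zero_add, coef', Option.elim]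
    simp [Matrix.one_apply]

lemma hasDerivAt_covF (hX : IsIndepStd X P) (c : ℝ) (E : Fin p → Fin p → ℝ) (δ : MIdx p → ℝ)
    (k l : Fin p) :
    HasDerivAt (fun t => covF (lineF c X P E δ t).1 (lineF c X P E δ t).2 k l)
      (E k l + E l k + δ (.inl (none, some k, some l))) 0 := by
  have h := hasDerivAt_triple (fun a => hasDerivAt_const (0 : ℝ) (unitVec (p := p) none a))
    (hasDerivAt_coef hX c E δ k) (hasDerivAt_coef hX c E δ l) (hasDerivAt_lineF_snd (P := P) (X := X) c E δ)
  refine h.congr_deriv ?_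
  simp only [lineF_zero, coef_one_popMoments hX, triple_unitVec_23, triple_unitVec_13,
    triple_unitVec_12, popMoments_none_left hX, popMoments_none_right hX]
  simp [Fintype.sum_option, coef', unitVec, Pi.single_apply]

/-- The value of this derivative is irrelevant for equal indices: in the product rule for `estF` it
multiplies an off-diagonal moment, which is zero in the population. -/
lemma exists_hasDerivAt_thirdF (hX : IsIndepStd X P) (c : ℝ) (E : Fin p → Fin p → ℝ)
    (δ : MIdx p → ℝ) (k l : Fin p) : ∃ d,
    HasDerivAt (fun t => thirdF (lineF c X P E δ t).1 (lineF c X P E δ t).2 k l) d 0 :=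
  ⟨_, hasDerivAt_triple (hasDerivAt_coef hX c E δ k) (hasDerivAt_coef hX c E δ k)
    (hasDerivAt_coef hX c E δ l) (hasDerivAt_lineF_snd (P := P) (X := X) c E δ)⟩

lemma hasDerivAt_thirdF (hX : IsIndepStd X P) (c : ℝ) (E : Fin p → Fin p → ℝ) (δ : MIdx p → ℝ)
    {k l : Fin p} (hkl : k ≠ l) :
    HasDerivAt (fun t => thirdF (lineF c X P E δ t).1 (lineF c X P E δ t).2 k l)
      (δ (.inl (some k, some k, some l)) - δ (.inl (none, none, some l))
        + gam P (X k) * E l k) 0 := by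
  have h := hasDerivAt_triple (hasDerivAt_coef hX c E δ k) (hasDerivAt_coef hX c E δ k)
    (hasDerivAt_coef hX c E δ l) (hasDerivAt_lineF_snd (P := P) (X := X) c E δ)
  refine h.congr_deriv ?_
  simp only [lineF_zero, coef_one_popMoments hX, triple_unitVec_23, triple_unitVec_13,
    triple_unitVec_12, popMoments_three_left hX c hkl,
    popMoments_three_mid hX c hkl, popMoments_three_right hX]
  simp [Fintype.sum_option, coef', unitVec, Pi.single_apply]
  ring

lemma exists_hasDerivAt_fourthF (hX : IsIndepStd X P) (c : ℝ) (E : Fin p → Fin p → ℝ)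
    (δ : MIdx p → ℝ) (k l : Fin p) : ∃ d,
    HasDerivAt (fun t => fourthF (lineF c X P E δ t).1 (lineF c X P E δ t).2 k l) d 0 :=
  ⟨_, hasDerivAt_quadruple (hasDerivAt_coef hX c E δ k) (hasDerivAt_coef hX c E δ k)
    (hasDerivAt_coef hX c E δ k) (hasDerivAt_coef hX c E δ l) (hasDerivAt_lineF_snd (P := P) (X := X) c E δ)⟩

/-- Each of the first three slots contributes c Eₖₗ, since E[zₖ²zₗzᵢ] is nonzero only for i = l; the
last slot contributes the terms with γₖ and βₖ. -/
lemma hasDerivAt_fourthF (hX : IsIndepStd X P) (c : ℝ) (E : Fin p → Fin p → ℝ) (δ : MIdx p → ℝ)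
    {k l : Fin p} (hkl : k ≠ l) :
    HasDerivAt (fun t => fourthF (lineF c X P E δ t).1 (lineF c X P E δ t).2 k l)
      (δ (.inr (some k, some k, some k, some l)) +
        c * (3 * E k l - gam P (X k) * δ (.inl (none, none, some l)) + bet P (X k) * E l k)) 0 := by
  have h := hasDerivAt_quadruple (hasDerivAt_coef hX c E δ k) (hasDerivAt_coef hX c E δ k)
    (hasDerivAt_coef hX c E δ k) (hasDerivAt_coef hX c E δ l) (hasDerivAt_lineF_snd (P := P) (X := X) c E δ)
  refine h.congr_deriv ?_
  simp only [lineF_zero, coef_one_popMoments hX, quadruple_unitVec_234, quadruple_unitVec_134,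
    quadruple_unitVec_124, quadruple_unitVec_123,
    popMoments_four_first hX c hkl, popMoments_four_second hX c hkl,
    popMoments_four_third hX c hkl, popMoments_four_last hX]
  simp [Fintype.sum_option, coef', unitVec, Pi.single_apply]
  ring

lemma thirdF_pop (hX : IsIndepStd X P) (c : ℝ) (k l : Fin p) :
    thirdF (Matrix.of.symm (1 : Matrix (Fin p) (Fin p) ℝ)) (popMoments c X P) k l
      = if l = k then gam P (X k) else 0 := by
  simp only [thirdF, coef_one_popMoments hX, triple_unitVec, popMoments_three_right hX,
    Option.elim]

lemma fourthF_pop (hX : IsIndepStd X P) (c : ℝ) (k l : Fin p) :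
    fourthF (Matrix.of.symm (1 : Matrix (Fin p) (Fin p) ℝ)) (popMoments c X P) k l
      = if l = k then c * bet P (X k) else 0 := by
  simp only [fourthF, coef_one_popMoments hX, quadruple_unitVec, popMoments_four_last hX,
    Option.elim]

lemma covF_pop (hX : IsIndepStd X P) (c : ℝ) (k l : Fin p) :
    covF (Matrix.of.symm (1 : Matrix (Fin p) (Fin p) ℝ)) (popMoments c X P) k l
      = if k = l then 1 else 0 := by
  simp only [covF, coef_one_popMoments hX, triple_unitVec, popMoments_none_left hX, Option.elim]

lemma solveF_pop (hX : IsIndepStd X P) (α c : ℝ) : solveF α X P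
    (Matrix.of.symm (1 : Matrix (Fin p) (Fin p) ℝ), popMoments c X P) = 0 := by
  ext k l
  simp only [solveF, estF, covF_pop hX, thirdF_pop hX, fourthF_pop hX]
  by_cases h : k = l
  · simp [h]
  · simp [h, Ne.symm h]

/-- With β = κ + 3, the part of the derivative of `estF` linear in E is curvₖEₗₖ - curvₗEₖₗ +
12(1-α)(κₖ-κₗ)(Eₖₗ+Eₗₖ), while `covF` contributes Eₖₗ + Eₗₖ. The multiple of `covF` in `solveF`
cancels Eₗₖ and leaves (curvₖ + curvₗ)Eₖₗ. -/
lemma hasDerivAt_solveF (hX : IsIndepStd X P) {α c : ℝ} (hc : α = 1 ∨ c = 1)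
    (hpos : ∀ k l, k ≠ l → curv α P (X k) + curv α P (X l) ≠ 0)
    (E : Fin p → Fin p → ℝ) (δ : MIdx p → ℝ) (k l : Fin p) :
    HasDerivAt (fun t => solveF α X P (lineF c X P E δ t) k l)
      (E k l - influence α X P δ k l) 0 := by
  by_cases hkl : k = l
  · subst hkl
    simp only [solveF, influence, if_true]
    refine (((hasDerivAt_covF hX c E δ k k).sub_const 1).div_const 2).congr_deriv ?_
    ring
  · have hlk := Ne.symm hkl
    simp only [solveF, influence, if_neg hkl]
    obtain ⟨a1, h1⟩ := exists_hasDerivAt_thirdF hX c E δ k k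
    obtain ⟨a2, h2⟩ := exists_hasDerivAt_thirdF hX c E δ l l
    obtain ⟨a3, h3⟩ := exists_hasDerivAt_fourthF hX c E δ k k
    obtain ⟨a4, h4⟩ := exists_hasDerivAt_fourthF hX c E δ l l
    have e1 := (((h1.fun_mul (hasDerivAt_thirdF hX c E δ hkl)).fun_sub
      (h2.fun_mul (hasDerivAt_thirdF hX c E δ hlk))).const_mul (3 * α)).fun_add
      ((((h3.sub_const 3).fun_mul (hasDerivAt_fourthF hX c E δ hkl)).fun_sub
      ((h4.sub_const 3).fun_mul (hasDerivAt_fourthF hX c E δ hlk))).const_mul (4 * (1 - α)))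
    have e2 := (((hasDerivAt_covF hX c E δ k l).const_mul
      (curv α P (X k) + 12 * (1 - α) * (kap P (X k) - kap P (X l)))).fun_sub e1).div_const
      (curv α P (X k) + curv α P (X l))
    refine e2.congr_deriv ?_
    simp only [lineF_zero, thirdF_pop hX, fourthF_pop hX, if_neg hkl, if_neg hlk, if_true]
    have hb : ∀ k, bet P (X k) = kap P (X k) + 3 := fun k => by simp [bet, kap]
    have hne := hpos k l hkl
    rw [eq_sub_iff_add_eq, ← add_div, div_eq_iff hne]
    simp only [hb, curv]
    rcases hc with rfl | rfl <;> ring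

/-- The influence function as a continuous linear map. -/
lemma exists_hasFDerivAt_solveF (hX : IsIndepStd X P) {α c : ℝ} (hc : α = 1 ∨ c = 1)
    (hpos : ∀ k l, k ≠ l → curv α P (X k) + curv α P (X l) ≠ 0) :
    ∃ A : (MIdx p → ℝ) →L[ℝ] (Fin p → Fin p → ℝ), (∀ δ, A δ = influence α X P δ) ∧
      HasFDerivAt (solveF α X P) (ContinuousLinearMap.fst ℝ _ _ -
        A.comp (ContinuousLinearMap.snd ℝ (Fin p → Fin p → ℝ) (MIdx p → ℝ)))
        (Matrix.of.symm (1 : Matrix (Fin p) (Fin p) ℝ), popMoments c X P) := by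
  set q₀ : (Fin p → Fin p → ℝ) × (MIdx p → ℝ) :=
    (Matrix.of.symm (1 : Matrix (Fin p) (Fin p) ℝ), popMoments c X P) with hq₀
  -- `solveF` is polynomial, so the total derivative exists, and derivatives along lines identify
  -- it. Linearity of `influence` comes for free.
  have hF := (differentiable_solveF α X P q₀).hasFDerivAt
  set D := fderiv ℝ (solveF α X P) q₀ with hD
  have hval : ∀ E δ, D (E, δ) = E - influence α X P δ := by
    intro E δ
    have h1 : HasDerivAt (lineF c X P E δ) (E, δ) 0 := by
      have := ((hasDerivAt_id (0 : ℝ)).smul_const ((E, δ) : (Fin p → Fin p → ℝ) × (MIdx p → ℝ))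
        ).const_add q₀
      rw [one_smul] at this
      exact this
    have h2 : HasDerivAt (fun t => solveF α X P (lineF c X P E δ t)) (D (E, δ)) 0 := by
      have h4 : HasFDerivAt (solveF α X P) D (lineF c X P E δ 0) := by rw [lineF_zero]; exact hF
      exact h4.comp_hasDerivAt (0 : ℝ) h1
    ext k l
    have h3 := hasDerivAt_pi.1 (hasDerivAt_pi.1 h2 k) l
    exact h3.unique (hasDerivAt_solveF hX hc hpos E δ k l)
  refine ⟨-D.comp (ContinuousLinearMap.inr ℝ _ _), fun δ => ?_, ?_⟩
  · simp [hval]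
  · have hA : ContinuousLinearMap.fst ℝ _ _ - (-D.comp (ContinuousLinearMap.inr ℝ _ _)).comp
        (ContinuousLinearMap.snd ℝ (Fin p → Fin p → ℝ) (MIdx p → ℝ)) = D := by
      refine ContinuousLinearMap.ext fun q => ?_
      obtain ⟨E, δ⟩ := q
      simp [hval, sub_eq_add_neg]
    rw [hA]
    exact hF

end Derivative

/-! ### Asymptotic normality -/

lemma solveF_sampleMoments {Ω : Type*} [MeasurableSpace Ω] {p n : ℕ} (X : Fin p → Ω → ℝ)
    (P : Measure Ω) {α c : ℝ} (hc : α = 1 ∨ c = 1) {x : Fin n → Fin p → ℝ}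
    (hA : (covMat (empirical x)).PosDef) {W : Matrix (Fin p) (Fin p) ℝ}
    (hW : IsSymPP α (empirical x) W) : solveF α X P (Matrix.of.symm W, sampleMoments c x) = 0 := by
  have e1 : ∀ k l, covF (Matrix.of.symm W) (sampleMoments c x) k l
      = (1 : Matrix (Fin p) (Fin p) ℝ) k l := covF_eq_one c hA hW
  have e2 : ∀ k l, k ≠ l → estF α (Matrix.of.symm W) (sampleMoments c x) k l = 0 :=
    fun k l hkl => estF_eq_zero hc hA hW hkl
  ext k l
  simp only [solveF, e1]
  split_ifs with hkl
  · simp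
  · simp [e2 k l hkl, hkl]

/-- One δ serves all sample sizes: a sequence of counterexamples, of any sizes, would have
covariance matrices tending to I. -/
lemma exists_posDef_of_norm_lt {Ω : Type*} [MeasurableSpace Ω] {P : Measure Ω}
    [IsProbabilityMeasure P] {p : ℕ} {X : Fin p → Ω → ℝ} (hX : IsIndepStd X P)
    (h4 : ∀ k, MemLp (X k) 4 P) (c : ℝ) :
    ∃ δ > 0, ∀ (n : ℕ) (x : Fin n → Fin p → ℝ), ‖sampleMoments c x - popMoments c X P‖ < δ →
      (covMat (empirical x)).PosDef := by
  by_contra! h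
  choose n x hx hnot using fun N : ℕ => h (1 / ((N : ℝ) + 1)) Nat.one_div_pos_of_nat
  have h1 : Tendsto (fun N => sampleMoments c (x N)) atTop (𝓝 (popMoments c X P)) :=
    tendsto_iff_norm_sub_tendsto_zero.2 (squeeze_zero (fun _ => norm_nonneg _)
      (fun N => (hx N).le) tendsto_one_div_add_atTop_nhds_zero_nat)
  have h2 := eventually_posDef (fun N => posSemidef_covMat_empirical (x N))
    (tendsto_covMat_empirical hX h4 h1)
  obtain ⟨N, hN⟩ := h2.exists
  exact hnot N hN

/-- Vectorization of matrices, with values in the Euclidean space. -/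
def vecL (p : ℕ) : (Fin p → Fin p → ℝ) →L[ℝ] EuclideanSpace ℝ (Fin p × Fin p) :=
  LinearMap.toContinuousLinearMap
    { toFun := fun e => WithLp.toLp 2 (Matrix.of e).vec
      map_add' := fun _ _ => rfl
      map_smul' := fun _ _ => rfl }

lemma vecL_apply {p : ℕ} (e : Fin p → Fin p → ℝ) (k l : Fin p) : vecL p e (l, k) = e k l := rfl

lemma runAvg_monom {Ω : Type*} {p : ℕ} [MeasurableSpace Ω] (z : ℕ → Ω → Fin p → ℝ) (c : ℝ) (n : ℕ)
    (ω : Ω) : runAvg z (monom c) n ω = sampleMoments c (sample z n ω) := by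
  ext j
  rw [sampleMoments, avg, runAvg, ← Fin.sum_univ_eq_sum_range (fun i => monom c (z i ω) j)]
  rfl

/-- The limit distribution of consistent sequences of solutions. -/
theorem tendstoInDistribution_scaledError {Ω : Type*} [MeasurableSpace Ω] {P : Measure Ω}
    [IsProbabilityMeasure P] {p : ℕ} {z : ℕ → Ω → Fin p → ℝ} (hmeas : ∀ i, Measurable (z i))
    (hindep : iIndepFun z P) (hident : ∀ i, IdentDistrib (z i) (z 0) P P)
    (hX : IsIndepStd (comp z) P) (h4 : ∀ k, MemLp (comp z k) 4 P) {α c : ℝ}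
    (hc : α = 1 ∨ c = 1) (h2 : ∀ j, MemLp (fun ω => monom c (fun k => comp z k ω) j) 2 P)
    {A : (MIdx p → ℝ) →L[ℝ] (Fin p → Fin p → ℝ)}
    (hA : HasFDerivAt (solveF α (comp z) P) (ContinuousLinearMap.fst ℝ _ _ -
        A.comp (ContinuousLinearMap.snd ℝ (Fin p → Fin p → ℝ) (MIdx p → ℝ)))
        (Matrix.of.symm (1 : Matrix (Fin p) (Fin p) ℝ), popMoments c (comp z) P))
    {W : (n : ℕ) → (Fin n → Fin p → ℝ) → Matrix (Fin p) (Fin p) ℝ}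
    (hW : IsSolutionSeq α W) (hcons : IsConsistent P z W) :
    TendstoInDistribution (scaledError z W) atTop
      (id : EuclideanSpace ℝ (Fin p × Fin p) → EuclideanSpace ℝ (Fin p × Fin p))
      (fun _ => P) (multivariateGaussian 0 (secondMoments P fun ω =>
        vecL p (A (monom c (fun k => comp z k ω) - popMoments c (comp z) P)))) := by
  have hsam : ∀ n, Measurable fun ω => sample z n ω := fun n =>
    measurable_pi_lambda _ fun i => hmeas i
  have hWm : ∀ n k l, Measurable fun ω => W n (sample z n ω) k l := fun n k l =>
    ((hW n).1 k l).comp (hsam n)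
  set T : ℕ → Ω → EuclideanSpace ℝ (Fin p × Fin p) := fun n ω =>
    vecL p (Matrix.of.symm (W n (sample z n ω)) - Matrix.of.symm 1) with hT
  have hTm : ∀ n, AEMeasurable (T n) P := fun n => by
    refine ((vecL p).continuous.measurable.comp ?_).aemeasurable
    exact (measurable_pi_lambda _ fun k => measurable_pi_lambda _ fun l => hWm n k l).sub
      measurable_const
  refine tendstoInDistribution_of_linearization (T := T) hmeas
    (measurable_pi_lambda _ fun j => measurable_monom c j) hindep hident h2
    (m₀ := popMoments c (comp z) P) (fun j => rfl) ((vecL p).comp A) hTm fun ε hε => ?_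
  simp only [runAvg_monom, hT, ContinuousLinearMap.comp_apply, ← map_sub]
  set ε' : ℝ := ε / (‖vecL p‖ + 1) with hε'
  have hv : 0 < ‖vecL p‖ + 1 := by positivity
  obtain ⟨δ₁, hδ₁, hlin⟩ := linearization_of_zero hA (solveF_pop hX α c)
    (show 0 < ε' by positivity)
  obtain ⟨δ₂, hδ₂, hpd⟩ := exists_posDef_of_norm_lt hX h4 c
  have hmom : TendstoInMeasure P (fun n ω => sampleMoments c (sample z n ω)) atTop
      (fun _ => popMoments c (comp z) P) :=
    tendstoInMeasure_of_tendsto_ae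
      (fun n => ((measurable_sampleMoments c).comp (hsam n)).aestronglyMeasurable)
      (tendsto_sampleMoments hindep hident fun j => (h2 j).integrable (by norm_num))
  rw [tendstoInMeasure_iff_norm] at hmom
  have hW1 : ∀ k l, Tendsto (fun n => P {ω | δ₁ ≤
      ‖W n (sample z n ω) k l - (1 : Matrix (Fin p) (Fin p) ℝ) k l‖}) atTop (𝓝 0) :=
    fun k l => tendstoInMeasure_iff_norm.1 (hcons k l) δ₁ hδ₁
  -- The linearization can fail only when some entry of W is far from the identity or the moments
  -- are far from their limit; these events have vanishing probability.
  have hsum : Tendsto (fun n => (∑ k, ∑ l, P {ω | δ₁ ≤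
        ‖W n (sample z n ω) k l - (1 : Matrix (Fin p) (Fin p) ℝ) k l‖}) +
      P {ω | min δ₁ δ₂ ≤ ‖sampleMoments c (sample z n ω) - popMoments c (comp z) P‖}) atTop
      (𝓝 0) := by
    have := (tendsto_finsetSum (Finset.univ : Finset (Fin p)) fun k _ =>
      tendsto_finsetSum (Finset.univ : Finset (Fin p)) fun l _ => hW1 k l).add
      (hmom (min δ₁ δ₂) (lt_min hδ₁ hδ₂))
    simpa using this
  refine tendsto_of_tendsto_of_tendsto_of_le_of_le tendsto_const_nhds hsum
    (fun _ => zero_le) fun n => ?_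
  refine (measure_mono (t := (⋃ k ∈ (Finset.univ : Finset (Fin p)),
    ⋃ l ∈ (Finset.univ : Finset (Fin p)), {ω | δ₁ ≤
        ‖W n (sample z n ω) k l - (1 : Matrix (Fin p) (Fin p) ℝ) k l‖}) ∪
    {ω | min δ₁ δ₂ ≤ ‖sampleMoments c (sample z n ω) - popMoments c (comp z) P‖}) ?_).trans
    ((measure_union_le _ _).trans (add_le_add ((measure_biUnion_finset_le _ _).trans
      (Finset.sum_le_sum fun k _ => measure_biUnion_finset_le _ _)) le_rfl))
  intro ω hω
  by_contra hne
  simp only [Set.mem_union, Set.mem_iUnion, Set.mem_ofPred_eq, not_or, not_exists, not_le,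
    Finset.mem_univ, forall_const, lt_min_iff] at hne
  obtain ⟨hn1, hn2, hn3⟩ := hne
  have hpos := hpd n _ hn3
  have hz := solveF_sampleMoments (comp z) P hc hpos ((hW n).2 _ hpos)
  have hnorm : ‖Matrix.of.symm (W n (sample z n ω)) - Matrix.of.symm 1‖ < δ₁ :=
    (pi_norm_lt_iff hδ₁).2 fun k => (pi_norm_lt_iff hδ₁).2 fun l => hn1 k l
  have h5 := hlin _ _ hnorm hn2 hz
  refine absurd hω (not_lt.2 (((vecL p).le_opNorm _).trans ?_))
  calc ‖vecL p‖ * _ ≤ (‖vecL p‖ + 1) *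
        (ε' * ‖sampleMoments c (sample z n ω) - popMoments c (comp z) P‖) := by
        gcongr
        linarith
    _ = ε * ‖sampleMoments c (sample z n ω) - popMoments c (comp z) P‖ := by
        rw [hε']; field_simp

/-! ### Asymptotic variances -/

section Variances

variable {Ω : Type*} [MeasurableSpace Ω] {P : Measure Ω} [IsProbabilityMeasure P]

/-- The second moment of a cubic polynomial in a standardized variable. -/
lemma integral_cubic_sq {Y : Ω → ℝ} (h6 : MemLp Y 6 P) (h1 : ∫ ω, Y ω ∂P = 0)
    (h2 : ∫ ω, Y ω ^ 2 ∂P = 1) (a₀ a₁ a₂ a₃ : ℝ) :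
    ∫ ω, (a₀ + a₁ * Y ω + a₂ * Y ω ^ 2 + a₃ * Y ω ^ 3) ^ 2 ∂P =
      a₀ ^ 2 + 2 * a₀ * a₂ + a₁ ^ 2 + (2 * a₀ * a₃ + 2 * a₁ * a₂) * moment Y 3 P
        + (2 * a₁ * a₃ + a₂ ^ 2) * moment Y 4 P + 2 * a₂ * a₃ * moment Y 5 P
        + a₃ ^ 2 * moment Y 6 P := by
  have hi := fun k hk => integrable_pow_of_memLp (m := 6) h6 (k := k) hk
  have h : ∀ ω, (a₀ + a₁ * Y ω + a₂ * Y ω ^ 2 + a₃ * Y ω ^ 3) ^ 2 =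
      ∑ j : Fin 7, ![a₀ ^ 2, 2 * a₀ * a₁, 2 * a₀ * a₂ + a₁ ^ 2, 2 * a₀ * a₃ + 2 * a₁ * a₂,
        2 * a₁ * a₃ + a₂ ^ 2, 2 * a₂ * a₃, a₃ ^ 2] j * Y ω ^ (j : ℕ) := by
    intro ω
    simp only [Fin.sum_univ_succ, Fin.sum_univ_zero]
    simp
    ring
  simp only [h]
  rw [integral_finsetSum _ fun (j : Fin 7) _ => (hi (j : ℕ) (by omega)).const_mul _]
  simp only [integral_const_mul, Fin.sum_univ_succ, Fin.sum_univ_zero]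
  simp [h1, h2, moment, Fin.succ]
  ring

/-- The first moment of a cubic polynomial times the variable. -/
lemma integral_cubic_mul {Y : Ω → ℝ} (h6 : MemLp Y 6 P) (h1 : ∫ ω, Y ω ∂P = 0)
    (h2 : ∫ ω, Y ω ^ 2 ∂P = 1) (a₀ a₁ a₂ a₃ : ℝ) :
    ∫ ω, (a₀ + a₁ * Y ω + a₂ * Y ω ^ 2 + a₃ * Y ω ^ 3) * Y ω ∂P =
      a₁ + a₂ * moment Y 3 P + a₃ * moment Y 4 P := by
  have hi := fun k hk => integrable_pow_of_memLp (m := 6) h6 (k := k) hk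
  have h : ∀ ω, (a₀ + a₁ * Y ω + a₂ * Y ω ^ 2 + a₃ * Y ω ^ 3) * Y ω =
      ∑ j : Fin 5, ![0, a₀, a₁, a₂, a₃] j * Y ω ^ (j : ℕ) := by
    intro ω
    simp only [Fin.sum_univ_succ, Fin.sum_univ_zero]
    simp
    ring
  simp only [h]
  rw [integral_finsetSum _ fun (j : Fin 5) _ => (hi (j : ℕ) (by omega)).const_mul _]
  simp only [integral_const_mul, Fin.sum_univ_succ, Fin.sum_univ_zero]
  simp [h1, h2, moment, Fin.succ]
  ring

omit [IsProbabilityMeasure P] in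
-- By independence the cross term has the factor E[f(X)X] = 0, and E X² = E Y² = 1 turns the two
-- squares into E f² and E g².
lemma integral_sq_mul_sub_mul {X Y : Ω → ℝ} (hXY : IndepFun X Y P) (hX2 : MemLp X 2 P) (hY2 : MemLp Y 2 P) (hX1 : ∫ ω, X ω ^ 2 ∂P = 1)
    (hY1 : ∫ ω, Y ω ^ 2 ∂P = 1) {f g : ℝ → ℝ} (hf : Measurable f) (hg : Measurable g)
    (hf2 : MemLp (fun ω => f (X ω)) 2 P) (hg2 : MemLp (fun ω => g (Y ω)) 2 P)
    (h0 : ∫ ω, f (X ω) * X ω ∂P = 0) :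
    ∫ ω, (f (X ω) * Y ω - X ω * g (Y ω)) ^ 2 ∂P =
      ∫ ω, f (X ω) ^ 2 ∂P + ∫ ω, g (Y ω) ^ 2 ∂P := by
  have hI : ∀ {a b : ℝ → ℝ}, Measurable a → Measurable b →
      Integrable (fun ω => a (X ω)) P → Integrable (fun ω => b (Y ω)) P →
      Integrable (fun ω => a (X ω) * b (Y ω)) P ∧
      ∫ ω, a (X ω) * b (Y ω) ∂P = (∫ ω, a (X ω) ∂P) * ∫ ω, b (Y ω) ∂P := by
    intro a b ha hb ha1 hb1
    have h := hXY.comp ha hb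
    exact ⟨h.integrable_mul ha1 hb1, h.integral_fun_mul_eq_mul_integral ha1.1 hb1.1⟩
  obtain ⟨i1, e1⟩ := hI (a := fun x => f x ^ 2) (b := fun y => y ^ 2) (by fun_prop) (by fun_prop)
    hf2.integrable_sq hY2.integrable_sq
  obtain ⟨i2, e2⟩ := hI (a := fun x => f x * x) (b := fun y => y * g y) (by fun_prop)
    (by fun_prop) (hf2.integrable_mul hX2) (hY2.integrable_mul hg2)
  obtain ⟨i3, e3⟩ := hI (a := fun x => x ^ 2) (b := fun y => g y ^ 2) (by fun_prop) (by fun_prop)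
    hX2.integrable_sq hg2.integrable_sq
  have h : ∀ ω, (f (X ω) * Y ω - X ω * g (Y ω)) ^ 2 = f (X ω) ^ 2 * Y ω ^ 2
      + (-2) * (f (X ω) * X ω * (Y ω * g (Y ω))) + X ω ^ 2 * g (Y ω) ^ 2 := fun ω => by ring
  simp only [h]
  rw [integral_add (i1.fun_add (i2.const_mul _)) i3, integral_add i1 (i2.const_mul _),
    integral_const_mul, e1, e2, e3, h0, hX1, hY1]
  ring

lemma memLp_two_cubic {Y : Ω → ℝ} (h6 : MemLp Y 6 P) (a₀ a₁ a₂ a₃ : ℝ) :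
    MemLp (fun ω => a₀ + a₁ * Y ω + a₂ * Y ω ^ 2 + a₃ * Y ω ^ 3) 2 P := by
  have h : ∀ k, 1 ≤ k → k ≤ 3 → MemLp (fun ω => Y ω ^ k) 2 P := by
    intro k h1 h3
    refine (memLp_two_iff_integrable_sq (h6.1.pow k)).2 ?_
    simp only [Pi.pow_apply, ← pow_mul]
    exact integrable_pow_of_memLp (m := 6) h6 (by omega)
  have h1 := h 1 le_rfl (by norm_num)
  simp only [pow_one] at h1
  exact (((memLp_const a₀).add (h1.const_mul a₁)).add ((h 2 (by norm_num) (by norm_num)).const_mul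
    a₂)).add ((h 3 (by norm_num) le_rfl).const_mul a₃)

variable {p : ℕ} {X : Fin p → Ω → ℝ}

/-- The influence on a diagonal entry is (1 - zₖ²)/2. -/
lemma integral_influence_diag_sq (hX : IsIndepStd X P) (h6 : ∀ k, MemLp (X k) 6 P) (α c : ℝ)
    (k : Fin p) :
    ∫ ω, influence α X P (monom c (fun k => X k ω) - popMoments c X P) k k ^ 2 ∂P =
      (kap P (X k) + 2) / 4 := by
  have h : ∀ ω, influence α X P (monom c (fun k => X k ω) - popMoments c X P) k k ^ 2 =
      (1 / 2 + 0 * X k ω + (-1 / 2) * X k ω ^ 2 + 0 * X k ω ^ 3) ^ 2 := by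
    intro ω
    simp only [influence, if_true, Pi.sub_apply, popMoments_none_left hX, monom, Sum.elim_inl,
      aug_none, aug_some, Option.elim]
    ring
  simp only [h]
  rw [integral_cubic_sq (h6 k) (hX.mean k) (hX.var k), kap]
  ring

lemma integral_influence_sq (hX : IsIndepStd X P) (h6 : ∀ k, MemLp (X k) 6 P) {α c : ℝ}
    (hc : α = 1 ∨ c = 1) {k l : Fin p} (hkl : k ≠ l) :
    ∫ ω, influence α X P (monom c (fun k => X k ω) - popMoments c X P) k l ^ 2 ∂P =
      (9 * α ^ 2 * zeta11 P (X k) (X l) + 16 * (1 - α) ^ 2 * zeta22 P (X k) (X l)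
        + 24 * α * (1 - α) * zeta12 P (X k) (X l)) /
        (curv α P (X k) + curv α P (X l)) ^ 2 := by
  set a := 3 * α * gam P (X k) with ha
  set b := 4 * (1 - α) * kap P (X k) with hb
  set a' := 3 * α * gam P (X l) with ha'
  set b' := 4 * (1 - α) * kap P (X l) with hb'
  -- The term in zₖzₗ is split between f and g so that f becomes a(x² - 1 - γₖx) + b(x³ - γₖ - βₖx),
  -- which is orthogonal to x. What remains for g is a'(y² - 1) + b'(y³ - γₗ - 3y); its lack of
  -- orthogonality to y produces the terms γₗ⁴, κₗ⁴ and γₗ²κₗ².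
  set f : ℝ → ℝ := fun x => (-a - b * gam P (X k)) + (-a * gam P (X k) - b * bet P (X k)) * x
    + a * x ^ 2 + b * x ^ 3 with hf
  set g : ℝ → ℝ := fun x => (-a' - b' * gam P (X l)) + (-3 * b') * x
    + a' * x ^ 2 + b' * x ^ 3 with hg
  have hbk : bet P (X k) = kap P (X k) + 3 := by simp [bet, kap]
  have h : ∀ ω, influence α X P (monom c (fun k => X k ω) - popMoments c X P) k l ^ 2 =
      (f (X k ω) * X l ω - X k ω * g (X l ω)) ^ 2 / (curv α P (X k) + curv α P (X l)) ^ 2 := by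
    intro ω
    simp only [influence, if_neg hkl, Pi.sub_apply, popMoments_none_left hX,
      popMoments_three_right hX, popMoments_four_last hX, monom, Sum.elim_inl,
      Sum.elim_inr, aug_none, aug_some, Option.elim, if_neg hkl.symm]
    rw [div_pow]
    congr 2
    simp only [hf, hg, ha, hb, ha', hb', hbk, curv]
    rcases hc with rfl | rfl <;> ring
  simp only [h]
  have h2 : ∀ k, MemLp (X k) 2 P := fun k => (h6 k).mono_exponent (by norm_num)
  have hm : ∀ Y : Ω → ℝ, moment Y 4 P = kap P Y + 3 := fun Y => by simp [kap]
  have hm3 : ∀ Y : Ω → ℝ, moment Y 3 P = gam P Y := fun Y => rfl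
  rw [integral_div, integral_sq_mul_sub_mul (hX.indep.indepFun hkl) (h2 k) (h2 l)
    (hX.var k) (hX.var l) (by fun_prop) (by fun_prop) (memLp_two_cubic (h6 k) _ _ _ _)
    (memLp_two_cubic (h6 l) _ _ _ _)]
  · congr 1
    simp only [hf, hg]
    rw [integral_cubic_sq (h6 k) (hX.mean k) (hX.var k),
      integral_cubic_sq (h6 l) (hX.mean l) (hX.var l)]
    simp only [ha, hb, ha', hb', zeta11, zeta12, zeta22, nu, omg, eta, bet, hm, hm3]
    ring
  · simp only [hf]
    rw [integral_cubic_mul (h6 k) (hX.mean k) (hX.var k)]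
    simp only [hm, hm3, hbk]
    ring

end Variances

/-! ### The limit theorem -/

lemma curv_add_curv_ne_zero {Ω : Type*} [MeasurableSpace Ω] {P : Measure Ω} {p : ℕ}
    {X : Fin p → Ω → ℝ} {α : ℝ} (h0 : 0 ≤ α) (h1 : α ≤ 1) (hsep : Separates α X P) {k l : Fin p}
    (hkl : k ≠ l) : curv α P (X k) + curv α P (X l) ≠ 0 := by
  have h1' : 0 ≤ 1 - α := sub_nonneg.2 h1
  have hn : ∀ k, 0 ≤ α * gam P (X k) ^ 2 ∧ 0 ≤ (1 - α) * kap P (X k) ^ 2 := fun k =>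
    ⟨by positivity, by positivity⟩
  intro h
  refine hkl (hsep k l ?_ ?_) <;>
  · simp only [curv] at h
    have a1 := hn k
    have a2 := hn l
    linarith

/-- The three cases at once: 0 ≤ α ≤ 1, with eighth moments required only for α ≠ 1. -/
theorem hasNormalLimit_of_separates {Ω : Type*} [MeasurableSpace Ω] {P : Measure Ω}
    [IsProbabilityMeasure P] {p : ℕ} {z : ℕ → Ω → Fin p → ℝ} (hmeas : ∀ i, Measurable (z i))
    (hindep : iIndepFun z P) (hident : ∀ i, IdentDistrib (z i) (z 0) P P)
    (hX : IsIndepStd (comp z) P) (h6 : ∀ k, MemLp (comp z k) 6 P) {α : ℝ} (h0 : 0 ≤ α)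
    (h1 : α ≤ 1) (h8 : α = 1 ∨ ∀ k, MemLp (comp z k) 8 P) (hsep : Separates α (comp z) P) :
    HasNormalLimit P z α fun k l =>
      (9 * α ^ 2 * zeta11 P (comp z k) (comp z l) + 16 * (1 - α) ^ 2 * zeta22 P (comp z k) (comp z l)
        + 24 * α * (1 - α) * zeta12 P (comp z k) (comp z l)) /
        (curv α P (comp z k) + curv α P (comp z l)) ^ 2 := by
  have h4 : ∀ k, MemLp (comp z k) 4 P := fun k => (h6 k).mono_exponent (by norm_num)
  -- For α = 1 the monomials of degree four are switched off, so that all remaining averages have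
  -- finite variance under sixth moments.
  obtain ⟨c, hc, hc8⟩ : ∃ c : ℝ, (α = 1 ∨ c = 1) ∧ (c = 0 ∨ ∀ k, MemLp (comp z k) 8 P) := by
    rcases h8 with h | h
    · exact ⟨0, .inl h, .inl rfl⟩
    · exact ⟨1, .inr rfl, .inr h⟩
  have h2 := memLp_two_monom h6 hc8
  obtain ⟨A, hA, hder⟩ := exists_hasFDerivAt_solveF hX hc
    fun k l hkl => curv_add_curv_ne_zero h0 h1 hsep hkl
  set Y : Ω → EuclideanSpace ℝ (Fin p × Fin p) := fun ω =>
    vecL p (A (monom c (fun k => comp z k ω) - popMoments c (comp z) P)) with hY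
  have hC : ∀ k l, secondMoments P Y (l, k) (l, k) = ∫ ω,
      influence α (comp z) P (monom c (fun k => comp z k ω) - popMoments c (comp z) P) k l ^ 2
        ∂P := by
    intro k l
    rw [secondMoments, Matrix.of_apply]
    simp only [hY, vecL_apply, hA, sq]
  refine ⟨secondMoments P Y, posSemidef_secondMoments ?_, fun k => ?_, fun k l hkl => ?_,
    exists_consistent hmeas hindep hident hX h4 h0 h1 hsep, fun W hW hcons =>
      tendstoInDistribution_scaledError hmeas hindep hident hX h4 hc h2 hder hW hcons⟩
  · rintro ⟨l, k⟩
    obtain ⟨a, ha⟩ := exists_coord_eq_sum ((vecL p).comp A) (l, k)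
    have hYa : ∀ ω, Y ω (l, k) = _ := fun ω => ha _
    simp only [hYa]
    exact memLp_finsetSum _ fun j _ => ((h2 j).sub (memLp_const _)).mul_const _
  · rw [hC, integral_influence_diag_sq hX h6]
  · rw [hC, integral_influence_sq hX h6 hc hkl]

end

end SymPP

/-! ### The three cases -/

theorem mainTheorem4 {Ω : Type*} [MeasurableSpace Ω] (P : Measure Ω) [IsProbabilityMeasure P]
    (p : ℕ) (z : ℕ → Ω → Fin p → ℝ)
    -- a random sample: independent and identically distributed random vectors
    (hmeas : ∀ i, Measurable (z i))
    (hindep : iIndepFun z P)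
    (hident : ∀ i, IdentDistrib (z i) (z 0) P P)
    -- with mutually independent and standardized components
    (hcomp : iIndepFun (SymPP.comp z) P)
    (hmean : ∀ k, ∫ ω, SymPP.comp z k ω ∂P = 0)
    (hvar : ∀ k, ∫ ω, SymPP.comp z k ω ^ 2 ∂P = 1) :
    -- (i) skewness only
    ((∀ k, MemLp (SymPP.comp z k) 6 P) →
      (∀ k l, SymPP.gam P (SymPP.comp z k) = 0 → SymPP.gam P (SymPP.comp z l) = 0 → k = l) →
      SymPP.HasNormalLimit P z 1 (fun k l =>
        SymPP.zeta11 P (SymPP.comp z k) (SymPP.comp z l) /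
          (SymPP.gam P (SymPP.comp z k) ^ 2 + SymPP.gam P (SymPP.comp z l) ^ 2) ^ 2)) ∧
    -- (ii) kurtosis only
    ((∀ k, MemLp (SymPP.comp z k) 8 P) →
      (∀ k l, SymPP.kap P (SymPP.comp z k) = 0 → SymPP.kap P (SymPP.comp z l) = 0 → k = l) →
      SymPP.HasNormalLimit P z 0 (fun k l =>
        SymPP.zeta22 P (SymPP.comp z k) (SymPP.comp z l) /
          (SymPP.kap P (SymPP.comp z k) ^ 2 + SymPP.kap P (SymPP.comp z l) ^ 2) ^ 2)) ∧
    -- (iii) both skewness and kurtosis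
    ((∀ k, MemLp (SymPP.comp z k) 8 P) →
      (∀ k l, SymPP.gam P (SymPP.comp z k) = 0 ∧ SymPP.kap P (SymPP.comp z k) = 0 →
        SymPP.gam P (SymPP.comp z l) = 0 ∧ SymPP.kap P (SymPP.comp z l) = 0 → k = l) →
      ∀ α : ℝ, 0 < α → α < 1 →
      SymPP.HasNormalLimit P z α (fun k l =>
        (9 * α ^ 2 * SymPP.zeta11 P (SymPP.comp z k) (SymPP.comp z l)
          + 16 * (1 - α) ^ 2 * SymPP.zeta22 P (SymPP.comp z k) (SymPP.comp z l)
          + 24 * α * (1 - α) * SymPP.zeta12 P (SymPP.comp z k) (SymPP.comp z l)) /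
        (3 * α * (SymPP.gam P (SymPP.comp z k) ^ 2 + SymPP.gam P (SymPP.comp z l) ^ 2)
          + 4 * (1 - α) *
            (SymPP.kap P (SymPP.comp z k) ^ 2 + SymPP.kap P (SymPP.comp z l) ^ 2)) ^ 2)) := by
  have hX : SymPP.IsIndepStd (SymPP.comp z) P :=
    ⟨fun k => (measurable_pi_apply k).comp (hmeas 0), hcomp, hmean, hvar⟩
  have h86 : (∀ k, MemLp (SymPP.comp z k) 8 P) → ∀ k, MemLp (SymPP.comp z k) 6 P :=
    fun h8 k => (h8 k).mono_exponent (by norm_num)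
  refine ⟨fun h6 hsep => ?_, fun h8 hsep => ?_, fun h8 hsep α h0 h1 => ?_⟩
  · convert! SymPP.hasNormalLimit_of_separates hmeas hindep hident hX h6 zero_le_one le_rfl
      (.inl rfl) fun k l hk hl => hsep k l (by simpa using hk) (by simpa using hl) using 3
    simp only [SymPP.curv]
    -- For α = 1 the general formula is this one with numerator and denominator multiplied by 9 =
    -- 3².
    rw [← mul_div_mul_left _ _ (show (9 : ℝ) ≠ 0 by norm_num)]
    congr 1 <;> ring
  · convert! SymPP.hasNormalLimit_of_separates hmeas hindep hident hX (h86 h8) le_rfl zero_le_one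
      (.inr h8) fun k l hk hl => hsep k l (by simpa using hk) (by simpa using hl) using 3
    simp only [SymPP.curv]
    -- For α = 0 the common factor is 16 = 4².
    rw [← mul_div_mul_left _ _ (show (16 : ℝ) ≠ 0 by norm_num)]
    congr 1 <;> ring
  · have hz : ∀ k, α * SymPP.gam P (SymPP.comp z k) ^ 2 +
        (1 - α) * SymPP.kap P (SymPP.comp z k) ^ 2 = 0 →
        SymPP.gam P (SymPP.comp z k) = 0 ∧ SymPP.kap P (SymPP.comp z k) = 0 := by
      intro k hk
      have h1' : 0 < 1 - α := sub_pos.2 h1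
      rw [add_eq_zero_iff_of_nonneg (by positivity) (by positivity)] at hk
      simpa [h0.ne', h1'.ne'] using hk
    convert! SymPP.hasNormalLimit_of_separates hmeas hindep hident hX (h86 h8) h0.le h1.le
      (.inr h8) fun k l hk hl => hsep k l (hz k hk) (hz l hl) using 3
    simp only [SymPP.curv]
    congr 1
    ring
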